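/- Let $n<m$ be nonnegative integers, and let $\mathcal A$ be the $\mathbb C$-algebra of formal power series in the noncommuting variables $a_{ij}$, $1\le i,j\le m$. Let $A=(a_{ij})_{m\times m}$ be a Cartier–Foata matrix, that is, equalities are understood modulo the closed two-sided ideal $\mathcal I_{\rm cf}$ of $\mathcal A$ generated by $a_{ik}a_{jl}-a_{jl}a_{ik}$ for all $i\ne j$ and all $k,l$ (a series belongs to it if up to every degree it agrees with an element of the ideal generated algebraically). For a $k\times k$ matrix put $\det B=\sum_{\sigma\in S_k}\operatorname{sgn}(\sigma)\,b_{\sigma(1)1}\cdots b_{\sigma(k)k}$. For $f\in\mathcal A$ with constant term $1$ put $f^{-1}=\sum_{k\ge0}(1-f)^k$ and $f^\beta=\sum_{k\ge 0}\binom{\beta}{k}(f-1)^k$ for $\beta\in\mathbb C$, where $\binom{x}{k}=x(x-1)\cdots(x-k+1)/k!$. Let $A_0=(a_{ij})_{1\le i,j\le n}$, $a_{i*}=(a_{i1},\dots,a_{in})$, $a_{*j}=(a_{1j},\dots,a_{nj})^T$, and let $$C=(c_{ij})_{n+1\le i,j\le m},\qquad c_{ij}=-\det(I-A_0)^{-1}\cdot\det\begin{pmatrix}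 I-A_0&-a_{*j}\\-a_{i*}&-a_{ij}\end{pmatrix}.$$ **Disjoint cycle decomposition.** Identify the variable $a_{ij}$ with a step from height $i$ to height $j$, and write $a_{\lambda,\mu}=a_{\lambda_1\mu_1}\cdots a_{\lambda_\ell\mu_\ell}$ for words $\lambda,\mu$ of length $\ell$ in the alphabet $\{1,\dots,m\}$. Let $\mu$ be such a word and $\lambda$ its nondecreasing rearrangement. First reorder the steps of $a_{\lambda,\mu}$ as follows: begin with the first step; at each later stage, take the first unused step that starts at the height where the last step taken ended, or, if there is none, the first unused step. The result is a concatenation of closed paths. Then repeat the following until no step is left: find the shortest initial segment of the current sequence whose last step ends at the starting height of one of the steps of the segment; the part of the segment from that step to its end is a cycle (with distinct starting heights); remove it from the sequence. If $u_1,u_2,\dots,u_k$ are the cycles in the order of their removal, then $u_1u_2\cdots u_k$ is the disjoint cycle decomposition of $a_{\lambda,\mu}$. Two cycles are called disjoint if they have no starting height in common. Let $\mathcal J$ be the set of $i\in\{1,\dots,k\}$ such that $u_i$ contains a height $>n$, and let $l=|\mathcal J|$. **Theorem.** For every $\beta\in\mathbb C$, $$\left(\frac1{\det(I-C)}\right)^{\beta}=\sum_\mu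 e_\mu(\beta)\,a_{\lambda,\mu}\quad\text{modulo }\mathcal I_{\rm cf},$$ where $\mu$ runs over all words in the alphabet $\{1,\dots,m\}$, $\lambda$ is the nondecreasing rearrangement of $\mu$, and $e_\mu(\beta)$ is the polynomial function of $\beta$ given, in terms of the disjoint cycle decomposition $u_1\cdots u_k$ of $a_{\lambda,\mu}$, by $$e_\mu(\beta)=\sum_\pi\binom{\beta+l-1-d(\pi)}{l}.$$ Here $d(\pi)$ is the number of descents of the subword of $\pi(1)\pi(2)\cdots\pi(k)$ formed by the letters in $\mathcal J$, and the sum is over all permutations $\pi\in S_k$ such that 1. if $i<j$ and $\pi(i)>\pi(j)$, then $u_{\pi(i)}$ and $u_{\pi(j)}$ are disjoint; 2. for each $i=1,\dots,k$ there exists $j\ge i$ with $\pi(j)\in\mathcal J$; 3. if $j\ge i$ is minimal with $\pi(j)\in\mathcal J$ and if $j>i$, then there exists $p$ with $i<p\le j$ such that $u_{\pi(i)}$ and $u_{\pi(p)}$ are not disjoint; 4. if $\pi(i)>\pi(i+1)$, then $\pi(i)\in\mathcal J$. -/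

import Mathlib

open Finset

noncomputable section

namespace BetaSylvester

/-! ### Formal power series in noncommuting variables -/

/-- Formal power series with complex coefficients in noncommuting variables indexed by `S`:
arbitrary (infinite) linear combinations of words, given by their coefficients. -/
def NCSeries (S : Type) : Type := List S → ℂ

namespace NCSeries

variable {S : Type}

/-- The coefficient of the word `w` in `f`. -/
def coeff (f : NCSeries S) (w : List S) : ℂ := f w

@[ext] theorem ext {f g : NCSeries S} (h : ∀ w, f.coeff w = g.coeff w) : f = g := funext h

instance : AddCommGroup (NCSeries S) := inferInstanceAs (AddCommGroup (List S → ℂ))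

instance : Module ℂ (NCSeries S) := inferInstanceAs (Module ℂ (List S → ℂ))

@[simp] theorem coeff_zero (w : List S) : (0 : NCSeries S).coeff w = 0 := rfl
@[simp] theorem coeff_add (f g : NCSeries S) (w : List S) :
    (f + g).coeff w = f.coeff w + g.coeff w := rfl
@[simp] theorem coeff_neg (f : NCSeries S) (w : List S) : (-f).coeff w = -f.coeff w := rfl
@[simp] theorem coeff_sub (f g : NCSeries S) (w : List S) :
    (f - g).coeff w = f.coeff w - g.coeff w := rfl
@[simp] theorem coeff_smul (c : ℂ) (f : NCSeries S) (w : List S) :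
    (c • f).coeff w = c * f.coeff w := rfl

open Classical in
/-- The series consisting of the single word `v`. -/
def word (v : List S) : NCSeries S := fun w => if w = v then 1 else 0

instance : One (NCSeries S) := ⟨word []⟩

/-- The Cauchy product: the coefficient of `w` is the sum over all factorizations `w = u v`. -/
instance : Mul (NCSeries S) :=
  ⟨fun f g w => ∑ i ∈ range (w.length + 1), f.coeff (w.take i) * g.coeff (w.drop i)⟩

open Classical in
theorem coeff_word (v w : List S) : (word v).coeff w = if w = v then 1 else 0 := rfl

open Classical in
theorem coeff_one (w : List S) : (1 : NCSeries S).coeff w = if w = [] then 1 else 0 := rfl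

theorem coeff_mul (f g : NCSeries S) (w : List S) :
    (f * g).coeff w = ∑ i ∈ range (w.length + 1), f.coeff (w.take i) * g.coeff (w.drop i) := rfl

protected theorem one_mul (f : NCSeries S) : 1 * f = f := by
  ext w
  rw [coeff_mul, sum_eq_single 0]
  · simp [coeff_one]
  · intro i hi h0
    have : w.take i ≠ [] := by
      intro h
      have := congrArg List.length h
      simp only [mem_range] at hi
      simp only [List.length_take, List.length_nil] at this
      omega
    simp [coeff_one, this]
  · simp

protected theorem mul_one (f : NCSeries S) : f * 1 = f := by
  ext w
  rw [coeff_mul, sum_eq_single w.length]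
  · simp [coeff_one]
  · intro i hi h0
    have : w.drop i ≠ [] := by
      intro h
      have := congrArg List.length h
      simp only [mem_range] at hi
      simp only [List.length_drop, List.length_nil] at this
      omega
    simp [coeff_one, this]
  · simp

protected theorem mul_assoc (f g h : NCSeries S) : f * g * h = f * (g * h) := by
  ext w
  have e1 : (f * g * h).coeff w = ∑ i ∈ range (w.length + 1), ∑ j ∈ range (i + 1),
      f.coeff (w.take j) * g.coeff ((w.drop j).take (i - j)) * h.coeff (w.drop i) := by
    rw [coeff_mul]
    refine sum_congr rfl fun i hi => ?_
    simp only [mem_range] at hi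
    have hl : (w.take i).length = i := by simp; omega
    rw [coeff_mul, hl, sum_mul]
    refine sum_congr rfl fun j hj => ?_
    simp only [mem_range] at hj
    rw [List.take_take, List.drop_take, min_eq_left (by omega)]
  have e2 : (f * (g * h)).coeff w = ∑ j ∈ range (w.length + 1),
      ∑ k ∈ range (w.length - j + 1),
      f.coeff (w.take j) * g.coeff ((w.drop j).take k) * h.coeff (w.drop (j + k)) := by
    rw [coeff_mul]
    refine sum_congr rfl fun j hj => ?_
    rw [coeff_mul, mul_sum, List.length_drop]
    refine sum_congr rfl fun k hk => ?_
    rw [List.drop_drop, mul_assoc]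
  rw [e1, e2, sum_sigma', sum_sigma']
  refine sum_bij' (fun p _ => ⟨p.2, p.1 - p.2⟩) (fun p _ => ⟨p.1 + p.2, p.1⟩) ?_ ?_ ?_ ?_ ?_
  · rintro ⟨i, j⟩ hp
    simp only [mem_sigma, mem_range] at hp ⊢
    omega
  · rintro ⟨j, k⟩ hp
    simp only [mem_sigma, mem_range] at hp ⊢
    omega
  · rintro ⟨i, j⟩ hp
    simp only [mem_sigma, mem_range] at hp ⊢
    have : j + (i - j) = i := by omega
    rw [this]
  · rintro ⟨j, k⟩ hp
    have : j + k - j = k := by omega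
    simp only [this]
  · rintro ⟨i, j⟩ hp
    simp only [mem_sigma, mem_range] at hp
    have : j + (i - j) = i := by omega
    simp only [this]

instance : Ring (NCSeries S) :=
  { (inferInstance : AddCommGroup (NCSeries S)) with
    mul := (· * ·)
    one := 1
    one_mul := NCSeries.one_mul
    mul_one := NCSeries.mul_one
    mul_assoc := NCSeries.mul_assoc
    zero_mul := fun f => by ext w; simp [coeff_mul]
    mul_zero := fun f => by ext w; simp [coeff_mul]
    left_distrib := fun f g h => by ext w; simp [coeff_mul, mul_add, sum_add_distrib]
    right_distrib := fun f g h => by ext w; simp [coeff_mul, add_mul, sum_add_distrib] }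

/-- The inverse `1 / (1 - Σ) = 1 + Σ + Σ² + ⋯` of a series `f = 1 - Σ` with constant term `1`.
As `Σ` has no constant term, words of length `ℓ` occur only in `Σ^k` with `k ≤ ℓ`. -/
def inv (f : NCSeries S) : NCSeries S :=
  fun w => ∑ k ∈ range (w.length + 1), ((1 - f) ^ k).coeff w

/-- The complex power `f ^ β = ∑ₖ (β choose k) (f - 1)^k` of a series with constant term `1`
(again, only `k ≤ ℓ` contribute to the coefficient of a word of length `ℓ`). -/
def cpow (f : NCSeries S) (β : ℂ) : NCSeries S :=
  fun w => ∑ k ∈ range (w.length + 1), Ring.choose β k * ((f - 1) ^ k).coeff w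

end NCSeries

/-! ### Determinants and the Cartier–Foata relations -/

/-- The determinant of a matrix over a noncommutative ring, with the factors of every term
ordered by columns: `∑_σ sgn(σ) b_{σ(1) 1} ⋯ b_{σ(k) k}`. -/
def ncDet {R : Type} [Ring R] {k : ℕ} (B : Matrix (Fin k) (Fin k) R) : R :=
  ∑ σ : Equiv.Perm (Fin k),
    ((Equiv.Perm.sign σ : ℤˣ) : ℤ) • (List.ofFn fun j : Fin k => B (σ j) j).prod

/-- The pair `(i, j)` is the lattice step from height `i` to height `j`, identified with the
variable `a_{ij}`. Heights are numbered from `0`. -/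
abbrev Step (m : ℕ) : Type := Fin m × Fin m

/-- The generic matrix `A = (a_{ij})`. -/
def genMatrix (m : ℕ) : Matrix (Fin m) (Fin m) (NCSeries (Step m)) :=
  fun i j => NCSeries.word [(i, j)]

/-- The Cartier–Foata relators `a_{ik} a_{jl} - a_{jl} a_{ik}`, `i ≠ j`. -/
def cfRelators (m : ℕ) : Set (NCSeries (Step m)) :=
  {f | ∃ i j k l : Fin m, i ≠ j ∧
    f = genMatrix m i k * genMatrix m j l - genMatrix m j l * genMatrix m i k}

/-- Equality of power series for a Cartier–Foata matrix `A`: the difference lies in the closure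
of the two-sided ideal generated by the Cartier–Foata relators, that is, it agrees
with elements of this ideal up to any prescribed degree. -/
def CFEq {m : ℕ} (f g : NCSeries (Step m)) : Prop :=
  ∀ d : ℕ, ∃ h ∈ TwoSidedIdeal.span (cfRelators m),
    ∀ w : List (Step m), w.length ≤ d → (f - g).coeff w = h.coeff w

/-- The `j`-th of the indices `n+1, …, m`. -/
def hiIdx {m n : ℕ} (j : Fin (m - n)) : Fin m := ⟨n + j, by omega⟩

/-- The upper left block `A₀ = (a_{ij})_{n × n}`. -/
def matA0 {m n : ℕ} (h : n ≤ m) : Matrix (Fin n) (Fin n) (NCSeries (Step m)) :=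
  (genMatrix m).submatrix (Fin.castLE h) (Fin.castLE h)

/-- The block matrix with rows `(I - A₀, -a_{*j})` and `(-a_{i*}, -a_{ij})`. -/
def bordered {m n : ℕ} (h : n ≤ m) (i j : Fin m) :
    Matrix (Fin (n + 1)) (Fin (n + 1)) (NCSeries (Step m)) :=
  (Matrix.fromBlocks
    (1 - matA0 h)
    (Matrix.of fun (p : Fin n) (_ : Fin 1) => -genMatrix m (Fin.castLE h p) j)
    (Matrix.of fun (_ : Fin 1) (q : Fin n) => -genMatrix m i (Fin.castLE h q))
    (Matrix.of fun (_ _ : Fin 1) => -genMatrix m i j)).reindex finSumFinEquiv finSumFinEquiv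

/-- The matrix `C = (c_{ij})_{n+1 ≤ i,j ≤ m}`, with
`c_{ij} = - det(I - A₀)⁻¹ · det (I - A₀, -a_{*j}; -a_{i*}, -a_{ij})`. -/
def matC {m n : ℕ} (h : n ≤ m) : Matrix (Fin (m - n)) (Fin (m - n)) (NCSeries (Step m)) :=
  fun i j => -((ncDet (1 - matA0 h)).inv * ncDet (bordered h (hiIdx i) (hiIdx j)))

/-! ### Ordered sequences and their disjoint cycle decomposition -/

/-- The o-sequence `a_{λ,μ}`, where `λ` is the nondecreasing rearrangement of `μ`. -/
def oSeq {m : ℕ} (μ : List (Fin m)) : List (Step m) :=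
  (μ.insertionSort (· ≤ ·)).zip μ

/-- One run of the rearrangement of an o-sequence into a p-sequence. Here `h` is the height
reached so far, and the list holds the steps not used yet. If one of them starts at `h`, then the
first such step is moved to the front. Otherwise the path sequence has returned to
its current base height, and it goes on with the first remaining step (which in an o-sequence
starts at the smallest remaining height). -/
def pSeqAux {m : ℕ} (h : Fin m) : List (Step m) → List (Step m)
  | [] => []
  | s₀ :: t =>
    let s := ((s₀ :: t).find? fun s => s.1 = h).getD s₀
    s :: pSeqAux s.2 ((s₀ :: t).erase s)
  termination_by w => w.length
  decreasing_by
    have hs : ((s₀ :: t).find? fun s => s.1 = h).getD s₀ ∈ s₀ :: t := by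
      cases hf : (s₀ :: t).find? fun s => s.1 = h with
      | none => simp
      | some x => exact List.mem_of_find?_eq_some hf
    rw [List.length_erase_of_mem hs]
    simp

/-- The p-sequence `φ(α)` of an o-sequence `α`. -/
def pSeq {m : ℕ} : List (Step m) → List (Step m)
  | [] => []
  | s :: t => pSeqAux s.1 (s :: t)

/-- The decomposition of `pre ++ w` into disjoint cycles, where the prefix `pre` has been read and
has no repeated height. The next step `s` is read; if it ends at the starting height of a step of
the prefix (including `s`), then this is the first repeated height: the part of the prefix from
that step on is a disjoint cycle, which is moved to the beginning and removed.
The algorithm is repeated with the rest, whose prefix has no repeated height. -/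
def cyclesAux {m : ℕ} : List (Step m) → List (Step m) → List (List (Step m))
  | _, [] => []
  | pre, s :: t =>
    let pre' := pre ++ [s]
    if ∃ x ∈ pre', x.1 = s.2 then
      pre'.dropWhile (fun x => x.1 ≠ s.2) :: cyclesAux (pre'.takeWhile fun x => x.1 ≠ s.2) t
    else cyclesAux pre' t

/-- The disjoint cycle decomposition `u₁ u₂ ⋯ u_k` of an o-sequence. -/
def cycleDecomp {m : ℕ} (α : List (Step m)) : List (List (Step m)) := cyclesAux [] (pSeq α)

/-- Two cycles are disjoint if they have no starting height in common. -/
def DisjointCycles {m : ℕ} (u v : List (Step m)) : Prop := ∀ s ∈ u, ∀ t ∈ v, s.1 ≠ t.1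

/-- A cycle is high if it contains a height `> n` (that is `≥ n` when counting from `0`). -/
def IsHigh {m : ℕ} (n : ℕ) (u : List (Step m)) : Prop := ∃ s ∈ u, n ≤ (s.1 : ℕ)

instance {m : ℕ} (u v : List (Step m)) : Decidable (DisjointCycles u v) := by
  unfold DisjointCycles; infer_instance

instance {m : ℕ} (n : ℕ) (u : List (Step m)) : Decidable (IsHigh n u) := by
  unfold IsHigh; infer_instance

/-- The conditions on the permutations `π` that contribute to the coefficient, for a sequence
`u` of `k` cycles. -/
structure Admissible {m k : ℕ} (n : ℕ) (u : Fin k → List (Step m)) (π : Equiv.Perm (Fin k)) :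
    Prop where
  /-- Cycles whose order is reversed are disjoint. -/
  inversion : ∀ i j, i < j → π j < π i → DisjointCycles (u (π i)) (u (π j))
  /-- At or to the right of every position there is a high cycle. -/
  exists_high : ∀ i, ∃ j, i ≤ j ∧ IsHigh n (u (π j))
  /-- If the first high cycle at or after position `i` is at position `j > i`, then one of the
  cycles after position `i` and up to position `j` is not disjoint from the one at `i`. -/
  linked : ∀ i j, i < j → IsHigh n (u (π j)) →
    (∀ p, i ≤ p → p < j → ¬ IsHigh n (u (π p))) →
    ∃ p, i < p ∧ p ≤ j ∧ ¬ DisjointCycles (u (π i)) (u (π p))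
  /-- Only high cycles are followed by a cycle with a smaller index. -/
  descent : ∀ i j : Fin k, (i : ℕ) + 1 = j → π j < π i → IsHigh n (u (π i))

/-- The number `l` of high cycles. -/
def numHigh {m k : ℕ} (n : ℕ) (u : Fin k → List (Step m)) : ℕ :=
  #{i : Fin k | IsHigh n (u i)}

/-- The number `d(π)` of descents of the subword of `π(1) ⋯ π(k)` formed by the letters that are
indices of high cycles: the number of pairs of positions that are consecutive in this subword
and carry a descent. -/
def highDescents {m k : ℕ} (n : ℕ) (u : Fin k → List (Step m)) (π : Equiv.Perm (Fin k)) : ℕ :=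
  #{p : Fin k × Fin k | p.1 < p.2 ∧ IsHigh n (u (π p.1)) ∧ IsHigh n (u (π p.2)) ∧
    (∀ q, p.1 < q → q < p.2 → ¬ IsHigh n (u (π q))) ∧ π p.2 < π p.1}

open Classical in
/-- `∑_π ((β + l - 1 - d(π)) choose l)` over the admissible `π`, for a list of cycles. -/
def cyclesCoeff {m : ℕ} (n : ℕ) (us : List (List (Step m))) (β : ℂ) : ℂ :=
  ∑ π : Equiv.Perm (Fin us.length) with Admissible n us.get π,
    Ring.choose (β + (numHigh n us.get : ℂ) - 1 - (highDescents n us.get π : ℂ))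
      (numHigh n us.get)

/-- The coefficient `e_μ(β)`. -/
def betaCoeff {m : ℕ} (n : ℕ) (μ : List (Fin m)) (β : ℂ) : ℂ :=
  cyclesCoeff n (cycleDecomp (oSeq μ)) β

/-- The series `∑_μ e_μ(β) a_{λ,μ}` over all words `μ`, computed coefficientwise (each word is
`a_{λ,μ}` for at most one `μ`). -/
def betaSeries (m n : ℕ) (β : ℂ) : NCSeries (Step m) :=
  fun w => ∑ᶠ μ : List (Fin m), (betaCoeff n μ β • NCSeries.word (oSeq μ)).coeff w

end BetaSylvester

end

open Finset

noncomputable section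

namespace BetaSylvester

/-! Variables from different rows commute and variables from the same row are free, so words modulo
the Cartier–Foata relations are tuples of words, one for each starting height, multiplied rowwise.
It suffices to compare, for every tuple, the sums of the coefficients over all words with these rows
(`rowCoeff`, `CFEq_of_rowCoeff_eq`).

The base 1/det(I-C) can be made explicit. If the columns of a Cartier–Foata matrix are read as
combinations of anticommuting variables, they anticommute, and column operations with arbitrary
right multipliers yield a Schur complement formula (`ncDet_schur`). It shows that c_ij is the sum of
the paths from i to j with low intermediate heights (`toCF_matC`), and that det(I-A) = det(I-A₀)
det(I-C) (`sylvester`). Let B be the sum of all balanced tuples. In B det(I-A₀) the signs cancel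
everything except the balanced tuples for which the map sending a height to the last letter of its
row has no cycle among the low heights (`rowCoeff_bal_mul_det_eq_ite`). For n = m only the empty
tuple survives, so B = 1/det(I-A), which is MacMahon's master theorem. In general it follows that
1/det(I-C) = B det(I-A₀). Call this series S.

A balanced tuple is the product u₁⋯u_k of its disjoint cycles (`decomposesTo_cycleDecomp`), and
these form a heap: two cycles are ordered by their indices if they are not disjoint. Factorizations
into balanced tuples correspond to down-closed sets of cycles (`sum_splits_rowsOn`), and a factor
occurs in S exactly when its maximal cycles are all high (`noLowCycle_rowsOn_iff`). So the
coefficient of (S-1)^s counts order-preserving maps of the heap onto {1,…,s} in whose fibres all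
maximal cycles are high (`rowCoeff_sub_one_pow`).

As in Stanley's theory of P-partitions, these maps are now sorted. Ordering the cycles by the value
of the map, then by the smallest high cycle above them in their fibre, then by index, produces an
admissible π, together with s-1 cuts where the value jumps. Cuts are possible after each high cycle
except the last, which gives l-1 places, and they are forced at the d(π) descents. This is a
bijection (`cutMap_injective`, `exists_cutMap_eq`), and for fixed π the sum of binom(β,s) over the
free cuts is binom(β+l-1-d(π), l) by Vandermonde's identity (`sum_choose_mul_card_goodMaps`). -/

/-! ### Row tuples: the normal form of words modulo the Cartier–Foata relations -/

/-- The word in the second indices of the steps starting at `h`. -/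
def rowWord {m : ℕ} (w : List (Step m)) (h : Fin m) : List (Fin m) :=
  (w.filter fun s => s.1 = h).map Prod.snd

/-- Concatenation of tuples of words. -/
def cat {m : ℕ} (X Y : Fin m → List (Fin m)) : Fin m → List (Fin m) := fun h => X h ++ Y h

/-- The word with nondecreasing starting heights which has the given rows. -/
def normalWord {m : ℕ} (X : Fin m → List (Fin m)) : List (Step m) :=
  (List.finRange m).flatMap fun h => (X h).map fun j => (h, j)

section rows

variable {m : ℕ}

@[simp] theorem rowWord_nil : rowWord ([] : List (Step m)) = fun _ => [] := rfl

theorem rowWord_append (v w : List (Step m)) : rowWord (v ++ w) = cat (rowWord v) (rowWord w) := by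
  funext h; simp [rowWord, cat]

theorem rowWord_cons (s : Step m) (w : List (Step m)) (h : Fin m) :
    rowWord (s :: w) h = if s.1 = h then s.2 :: rowWord w h else rowWord w h := by
  by_cases hs : s.1 = h <;> simp [rowWord, hs]

theorem cat_assoc (X Y Z : Fin m → List (Fin m)) : cat (cat X Y) Z = cat X (cat Y Z) := by
  funext h; simp [cat]

@[simp] theorem cat_nil (X : Fin m → List (Fin m)) : cat X (fun _ => []) = X := by
  funext h; simp [cat]

theorem cat_left_cancel {X Y Z : Fin m → List (Fin m)} (h : cat X Y = cat X Z) : Y = Z := by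
  funext i; simpa [cat] using congrFun h i

theorem cat_right_cancel {X Y Z : Fin m → List (Fin m)} (h : cat Y X = cat Z X) : Y = Z := by
  funext i; simpa [cat] using congrFun h i

@[simp] theorem nil_cat (X : Fin m → List (Fin m)) : cat (fun _ => []) X = X := by
  funext h; simp [cat]

theorem rowWord_map_mk (l : List (Fin m)) (h i : Fin m) :
    rowWord (l.map fun j => (h, j)) i = if h = i then l else [] := by
  induction l with
  | nil => simp
  | cons a l ih => rw [List.map_cons, rowWord_cons, ih]; split_ifs <;> simp

@[simp] theorem rowWord_normalWord (X : Fin m → List (Fin m)) : rowWord (normalWord X) = X := by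
  -- Induction needs an arbitrary list of heights; without repetitions, no row is produced twice.
  have key : ∀ l : List (Fin m), l.Nodup → ∀ i,
      rowWord (l.flatMap fun h => (X h).map fun j => (h, j)) i = if i ∈ l then X i else [] := by
    intro l
    induction l with
    | nil => simp
    | cons a l ih =>
      intro hl i
      rw [List.nodup_cons] at hl
      rw [List.flatMap_cons, rowWord_append, cat, ih hl.2, rowWord_map_mk]
      by_cases hai : a = i
      · subst hai; simp [hl.1]
      · simp [hai, Ne.symm hai]
  funext i
  simp [normalWord, key _ (List.nodup_finRange m)]

theorem length_eq_sum_rowWord (w : List (Step m)) : w.length = ∑ h, (rowWord w h).length := by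
  induction w with
  | nil => simp
  | cons s w ih =>
    have : ∀ h, (rowWord (s :: w) h).length =
        (if s.1 = h then 1 else 0) + (rowWord w h).length := by
      intro h; rw [rowWord_cons]; split_ifs <;> simp [add_comm]
    simp only [this, sum_add_distrib, sum_ite_eq, mem_univ, if_true, List.length_cons, ih]
    ring

theorem rowWord_mem_iff (w : List (Step m)) (h j : Fin m) : j ∈ rowWord w h ↔ (h, j) ∈ w := by
  simp [rowWord]

theorem rowWord_eq_nil_iff (w : List (Step m)) (h : Fin m) :
    rowWord w h = [] ↔ ∀ s ∈ w, s.1 ≠ h := by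
  simp [rowWord, List.filter_eq_nil_iff]

theorem finite_rowFiber (W : Fin m → List (Fin m)) : {w : List (Step m) | rowWord w = W}.Finite := by
  refine (List.finite_length_eq (Step m) (∑ h, (W h).length)).subset ?_
  rintro w rfl
  exact length_eq_sum_rowWord w

theorem finite_splits (W : Fin m → List (Fin m)) :
    {p : (Fin m → List (Fin m)) × (Fin m → List (Fin m)) | cat p.1 p.2 = W}.Finite := by
  have h1 : (Set.univ.pi fun h => {l : List (Fin m) | l ∈ (W h).inits}).Finite :=
    Set.Finite.pi fun h => (W h).inits.finite_toSet
  have h2 : (Set.univ.pi fun h => {l : List (Fin m) | l ∈ (W h).tails}).Finite :=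
    Set.Finite.pi fun h => (W h).tails.finite_toSet
  refine (h1.prod h2).subset ?_
  rintro ⟨X, Y⟩ rfl
  simp [cat, Set.mem_pi]

/-- The words with given rows. -/
def rowFiber (W : Fin m → List (Fin m)) : Finset (List (Step m)) := (finite_rowFiber W).toFinset

@[simp] theorem mem_rowFiber {W : Fin m → List (Fin m)} {w : List (Step m)} :
    w ∈ rowFiber W ↔ rowWord w = W := by simp [rowFiber]

/-- The factorizations of a tuple of words. -/
def splits (W : Fin m → List (Fin m)) :
    Finset ((Fin m → List (Fin m)) × (Fin m → List (Fin m))) := (finite_splits W).toFinset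

@[simp] theorem mem_splits {W : Fin m → List (Fin m)}
    {p : (Fin m → List (Fin m)) × (Fin m → List (Fin m))} :
    p ∈ splits W ↔ cat p.1 p.2 = W := by simp [splits]

/-- The coefficient of a series at a tuple of words: the sum of the coefficients of all words with
these rows. -/
def rowCoeff (f : NCSeries (Step m)) (W : Fin m → List (Fin m)) : ℂ :=
  ∑ w ∈ rowFiber W, f.coeff w

@[simp] theorem rowCoeff_zero (W : Fin m → List (Fin m)) :
    rowCoeff (0 : NCSeries (Step m)) W = 0 := by simp [rowCoeff]

theorem rowCoeff_add (f g : NCSeries (Step m)) (W : Fin m → List (Fin m)) :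
    rowCoeff (f + g) W = rowCoeff f W + rowCoeff g W := by simp [rowCoeff, sum_add_distrib]

theorem rowCoeff_sub (f g : NCSeries (Step m)) (W : Fin m → List (Fin m)) :
    rowCoeff (f - g) W = rowCoeff f W - rowCoeff g W := by simp [rowCoeff]

theorem rowCoeff_word (v : List (Step m)) (W : Fin m → List (Fin m)) :
    rowCoeff (NCSeries.word v) W = if rowWord v = W then 1 else 0 := by
  classical
  simp only [rowCoeff, NCSeries.coeff_word]
  split_ifs with h
  · rw [sum_eq_single v]
    · simp
    · intro w _ hw; simp [hw]
    · intro hv; exact absurd (mem_rowFiber.2 h) hv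
  · refine sum_eq_zero fun w hw => if_neg ?_
    rintro rfl
    exact h (mem_rowFiber.1 hw)

theorem rowCoeff_one (W : Fin m → List (Fin m)) :
    rowCoeff (1 : NCSeries (Step m)) W = if W = (fun _ => []) then 1 else 0 := by
  have := rowCoeff_word ([] : List (Step m)) W
  rw [rowWord_nil] at this
  simp only [eq_comm (a := W)]
  exact this

/-- Cutting a word cuts each of its rows. Conversely, words over the two factors of a tuple
concatenate to a word over the tuple, and the length of the first one recovers the cut. Hence
`rowCoeff` computes products in the series over a product of free monoids. -/
theorem rowCoeff_mul (f g : NCSeries (Step m)) (W : Fin m → List (Fin m)) :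
    rowCoeff (f * g) W = ∑ p ∈ splits W, rowCoeff f p.1 * rowCoeff g p.2 := by
  have e : ∀ p ∈ splits W, rowCoeff f p.1 * rowCoeff g p.2 =
      ∑ q ∈ rowFiber p.1 ×ˢ rowFiber p.2, f.coeff q.1 * g.coeff q.2 := by
    intro p _
    rw [rowCoeff, rowCoeff, sum_mul_sum, sum_product]
  rw [sum_congr rfl e, sum_sigma']
  simp only [rowCoeff, NCSeries.coeff_mul]
  rw [sum_sigma']
  refine sum_bij' (fun a _ => ⟨(rowWord (a.1.take a.2), rowWord (a.1.drop a.2)),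
      (a.1.take a.2, a.1.drop a.2)⟩) (fun b _ => ⟨b.2.1 ++ b.2.2, b.2.1.length⟩) ?_ ?_ ?_ ?_ ?_
  · rintro ⟨w, i⟩ h
    simp only [mem_sigma, mem_rowFiber, mem_range] at h
    simp [← rowWord_append, h.1]
  · rintro ⟨⟨X, Y⟩, x, y⟩ h
    simp only [mem_sigma, mem_splits, mem_product, mem_rowFiber] at h
    obtain ⟨h0, h1, h2⟩ := h
    simp [rowWord_append, h1, h2, h0]
  · rintro ⟨w, i⟩ h
    simp only [mem_sigma, mem_rowFiber, mem_range] at h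
    have : min i w.length = i := by omega
    simp [this]
  · rintro ⟨⟨X, Y⟩, x, y⟩ h
    simp only [mem_sigma, mem_splits, mem_product, mem_rowFiber] at h
    obtain ⟨h0, h1, h2⟩ := h
    simp [h1, h2]
  · rintro ⟨w, i⟩ h
    rfl

end rows

/-! ### The quotient by the Cartier–Foata relations -/

/-- The congruence identifying series with equal coefficients at all tuples of words. -/
def rowCon (m : ℕ) : RingCon (NCSeries (Step m)) where
  r f g := ∀ W, rowCoeff f W = rowCoeff g W
  iseqv := ⟨fun _ _ => rfl, fun h W => (h W).symm, fun h h' W => (h W).trans (h' W)⟩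
  add' := fun h h' W => by rw [rowCoeff_add, rowCoeff_add, h, h']
  mul' := fun h h' W => by
    rw [rowCoeff_mul, rowCoeff_mul]
    exact sum_congr rfl fun p _ => by rw [h, h']

/-- The algebra of power series in the entries of a Cartier–Foata matrix. -/
abbrev CFAlg (m : ℕ) : Type := (rowCon m).Quotient

/-- The projection to `CFAlg`. -/
def toCF (m : ℕ) : NCSeries (Step m) →+* CFAlg m := (rowCon m).mk'

theorem toCF_eq_iff {m : ℕ} {f g : NCSeries (Step m)} :
    toCF m f = toCF m g ↔ ∀ W, rowCoeff f W = rowCoeff g W :=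
  (rowCon m).eq

theorem word_append {S : Type} (u v : List S) :
    NCSeries.word (u ++ v) = NCSeries.word u * NCSeries.word v := by
  classical
  ext w
  rw [NCSeries.coeff_mul]
  simp only [NCSeries.coeff_word]
  by_cases h : w = u ++ v
  · subst h
    rw [sum_eq_single u.length]
    · simp
    · intro i hi hne
      rw [if_neg, zero_mul]
      intro h
      apply hne
      have := congrArg List.length h
      simp only [mem_range, List.length_append] at hi
      simp at this
      omega
    · simp
  · rw [if_neg h, eq_comm]
    refine sum_eq_zero fun i _ => ?_
    by_cases h1 : w.take i = u
    · by_cases h2 : w.drop i = v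
      · exact absurd (by rw [← h1, ← h2, List.take_append_drop]) h
      · simp [h2]
    · simp [h1]

section ideal

variable {m : ℕ}

theorem word_swap_rel (s t : Step m) (h : s.1 ≠ t.1) :
    (TwoSidedIdeal.span (cfRelators m)).ringCon (NCSeries.word [s, t]) (NCSeries.word [t, s]) := by
  rw [TwoSidedIdeal.rel_iff]
  refine TwoSidedIdeal.subset_span ⟨s.1, t.1, s.2, t.2, h, ?_⟩
  simp [genMatrix, ← word_append]

theorem word_cons_rel {s : Step m} {v w : List (Step m)}
    (h : (TwoSidedIdeal.span (cfRelators m)).ringCon (NCSeries.word v) (NCSeries.word w)) :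
    (TwoSidedIdeal.span (cfRelators m)).ringCon (NCSeries.word (s :: v))
      (NCSeries.word (s :: w)) := by
  have := RingCon.mul (TwoSidedIdeal.span (cfRelators m)).ringCon
    (RingCon.refl (TwoSidedIdeal.span (cfRelators m)).ringCon (NCSeries.word [s])) h
  simpa [← word_append] using this

theorem word_move_rel (s : Step m) (p q : List (Step m)) (h : ∀ a ∈ p, a.1 ≠ s.1) :
    (TwoSidedIdeal.span (cfRelators m)).ringCon (NCSeries.word (s :: (p ++ q)))
      (NCSeries.word (p ++ s :: q)) := by
  induction p with
  | nil => exact RingCon.refl _ _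
  | cons a p ih =>
    have h1 := RingCon.mul (TwoSidedIdeal.span (cfRelators m)).ringCon
      (word_swap_rel s a (h a (by simp)).symm)
      (RingCon.refl (TwoSidedIdeal.span (cfRelators m)).ringCon (NCSeries.word (p ++ q)))
    simp only [← word_append, List.cons_append, List.nil_append] at h1
    exact RingCon.trans _ h1 (word_cons_rel (ih fun b hb => h b (by simp [hb])))

/-- A step whose row is not empty can be moved to the front. -/
theorem exists_first_step {h j : Fin m} {l : List (Fin m)} {w : List (Step m)}
    (hw : rowWord w h = j :: l) : ∃ p q, w = p ++ (h, j) :: q ∧ ∀ a ∈ p, a.1 ≠ h := by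
  induction w with
  | nil => simp at hw
  | cons s w ih =>
    rw [rowWord_cons] at hw
    split_ifs at hw with hs
    · refine ⟨[], w, ?_, by simp⟩
      simp only [List.cons.injEq] at hw
      rw [List.nil_append, ← hs, ← hw.1]
    · obtain ⟨p, q, rfl, hp⟩ := ih hw
      exact ⟨s :: p, q, rfl, List.forall_mem_cons.2 ⟨hs, hp⟩⟩

theorem rowWord_move (s : Step m) (p q : List (Step m)) (h : ∀ a ∈ p, a.1 ≠ s.1) :
    rowWord (p ++ s :: q) = rowWord (s :: (p ++ q)) := by
  funext i
  rw [rowWord_append, rowWord_cons, rowWord_append]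
  simp only [cat, rowWord_cons]
  split_ifs with hi
  · subst hi
    rw [(rowWord_eq_nil_iff p s.1).2 h]; simp
  · rfl

theorem rowWord_eq_nil {w : List (Step m)} (h : rowWord w = fun _ => []) : w = [] := by
  have := length_eq_sum_rowWord w
  simpa [h] using this

/-- The first step of `v` is the first one in its row, so in `w` it is preceded only by steps from
other heights and can be commuted to the front; then both words lose it. -/
theorem word_rel_of_rowWord_eq : ∀ {v w : List (Step m)}, rowWord v = rowWord w →
    (TwoSidedIdeal.span (cfRelators m)).ringCon (NCSeries.word v) (NCSeries.word w) := by
  intro v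
  induction v with
  | nil =>
    intro w h
    rw [rowWord_eq_nil (w := w) (by rw [← h, rowWord_nil])]
    exact RingCon.refl _ _
  | cons s v ih =>
    intro w h
    have h1 : rowWord w s.1 = s.2 :: rowWord v s.1 := by rw [← h, rowWord_cons, if_pos rfl]
    obtain ⟨p, q, rfl, hp⟩ := exists_first_step h1
    rw [rowWord_move _ _ _ hp] at h
    have h2 : rowWord v = rowWord (p ++ q) := by
      funext i
      have := congrFun h i
      rw [rowWord_cons, rowWord_cons] at this
      split_ifs at this <;> simpa using this
    exact RingCon.trans _ (word_cons_rel (ih h2)) (word_move_rel _ _ _ hp)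

/-- A two-sided ideal is only closed under ring multiplication, so the scalar is realized as a
constant series. -/
theorem smul_mem_twoSidedIdeal (I : TwoSidedIdeal (NCSeries (Step m))) (c : ℂ)
    {f : NCSeries (Step m)} (hf : f ∈ I) : c • f ∈ I := by
  have : c • f = (c • (1 : NCSeries (Step m))) * f := by
    ext w
    rw [NCSeries.coeff_mul, sum_eq_single 0]
    · simp [NCSeries.coeff_one]
    · intro i hi h0
      simp only [mem_range] at hi
      have : w.take i ≠ [] := by
        intro h
        have := congrArg List.length h
        simp at this
        rcases this with h | h
        · exact h0 h
        · subst h; simp at hi; exact h0 hi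
      simp [NCSeries.coeff_one, this]
    · simp
  rw [this]
  exact I.mul_mem_left _ _ hf

theorem coeff_sum {S ι : Type} (s : Finset ι) (F : ι → NCSeries S) (w : List S) :
    (∑ i ∈ s, F i).coeff w = ∑ i ∈ s, (F i).coeff w := by
  classical
  induction s using Finset.induction_on with
  | empty => simp
  | insert a s ha ih => rw [sum_insert ha, sum_insert ha, NCSeries.coeff_add, ih]

/-- Up to degree `d`, replace every word of `f - g` by its normal form. This changes the series by
an element of the ideal, and the normalized series vanishes because its coefficients are the row
coefficients of `f - g`. -/
theorem CFEq_of_rowCoeff_eq {f g : NCSeries (Step m)} (h : ∀ W, rowCoeff f W = rowCoeff g W) :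
    CFEq f g := by
  classical
  intro d
  let D : Finset (List (Step m)) := (List.finite_length_le (Step m) d).toFinset
  have hD : ∀ w, w ∈ D ↔ w.length ≤ d := by simp [D]
  refine ⟨∑ w ∈ D, (f - g).coeff w • (NCSeries.word w - NCSeries.word (normalWord (rowWord w))),
    ?_, ?_⟩
  · refine sum_mem fun w _ => smul_mem_twoSidedIdeal _ _ ?_
    rw [← TwoSidedIdeal.rel_iff]
    exact word_rel_of_rowWord_eq (by simp)
  · intro v hv
    rw [coeff_sum]
    simp only [NCSeries.coeff_smul, NCSeries.coeff_sub (NCSeries.word _), mul_sub,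
      sum_sub_distrib]
    have e1 : ∑ w ∈ D, (f - g).coeff w * (NCSeries.word w).coeff v = (f - g).coeff v := by
      rw [sum_eq_single v]
      · simp [NCSeries.coeff_word]
      · intro w _ hw; simp [NCSeries.coeff_word, hw.symm]
      · intro h; exact absurd ((hD v).2 hv) h
    -- At a normal word the sum collects its whole row fibre, which lies in `D` since all words of a
    -- fibre have the same length; at other words it is empty.
    have e2 : ∑ w ∈ D, (f - g).coeff w *
        (NCSeries.word (normalWord (rowWord w))).coeff v = 0 := by
      simp only [NCSeries.coeff_word, mul_ite, mul_one, mul_zero]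
      rw [← sum_filter]
      by_cases hn : v = normalWord (rowWord v)
      · have : D.filter (fun w => v = normalWord (rowWord w)) = rowFiber (rowWord v) := by
          ext w
          rw [mem_filter, mem_rowFiber, hD]
          constructor
          · rintro ⟨_, h⟩
            rw [h]; simp
          · intro h
            rw [h]
            refine ⟨?_, hn⟩
            rw [length_eq_sum_rowWord, h, ← length_eq_sum_rowWord]; exact hv
        rw [this]
        have := h (rowWord v)
        rw [← sub_eq_zero, ← rowCoeff_sub] at this
        exact this
      · refine sum_eq_zero fun w hw => ?_
        rw [mem_filter] at hw
        exact absurd (by rw [hw.2, rowWord_normalWord]) hn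
    rw [e1, e2, sub_zero]

end ideal

/-! ### Inverses and complex powers of series with constant term one -/

section powers

variable {S : Type}

theorem coeff_pow_eq_zero {g : NCSeries S} (hg : g.coeff [] = 0) :
    ∀ (k : ℕ) (w : List S), w.length < k → (g ^ k).coeff w = 0 := by
  intro k
  induction k with
  | zero => intro w hw; omega
  | succ k ih =>
    intro w hw
    rw [pow_succ, NCSeries.coeff_mul]
    refine sum_eq_zero fun i hi => ?_
    simp only [mem_range] at hi
    rcases Nat.lt_or_ge i k with h | h
    · rw [ih _ (by simp; omega), zero_mul]
    · have : w.drop i = [] := by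
        rw [List.drop_eq_nil_iff]; omega
      rw [this, hg, mul_zero]

theorem coeff_sum_pow {g : NCSeries S} (hg : g.coeff [] = 0) {N : ℕ} {w : List S}
    (hN : w.length ≤ N) :
    (∑ k ∈ range (N + 1), g ^ k).coeff w = ∑ k ∈ range (w.length + 1), (g ^ k).coeff w := by
  rw [coeff_sum]
  symm
  refine sum_subset (by intro k; simp only [mem_range]; omega) fun k _ hk => ?_
  simp only [mem_range] at hk
  exact coeff_pow_eq_zero hg _ _ (by omega)

theorem coeff_mul_congr {f f' g g' : NCSeries S} {N : ℕ}
    (hf : ∀ w : List S, w.length ≤ N → f.coeff w = f'.coeff w)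
    (hg : ∀ w : List S, w.length ≤ N → g.coeff w = g'.coeff w)
    {w : List S} (hw : w.length ≤ N) : (f * g).coeff w = (f' * g').coeff w := by
  rw [NCSeries.coeff_mul, NCSeries.coeff_mul]
  refine sum_congr rfl fun i _ => ?_
  rw [hf _ (by simp; omega), hg _ (by simp; omega)]

theorem coeff_inv_eq {f : NCSeries S} (hf : f.coeff [] = 1) {N : ℕ} {w : List S}
    (hN : w.length ≤ N) : f.inv.coeff w = (∑ k ∈ range (N + 1), (1 - f) ^ k).coeff w := by
  rw [coeff_sum_pow (by simp [hf, NCSeries.coeff_one]) hN]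
  rfl

/-- Up to the length of a given word, the inverse is a finite geometric sum, and the remainder of
its telescoping has no words that short. -/
theorem inv_mul_self {f : NCSeries S} (hf : f.coeff [] = 1) : f.inv * f = 1 := by
  ext w
  rw [coeff_mul_congr (f' := ∑ k ∈ range (w.length + 1), (1 - f) ^ k) (g' := f)
    (fun v hv => coeff_inv_eq hf hv) (fun _ _ => rfl) le_rfl]
  have := geom_sum_mul_neg (1 - f) (w.length + 1)
  rw [sub_sub_cancel] at this
  rw [this, NCSeries.coeff_sub, coeff_pow_eq_zero (by simp [hf, NCSeries.coeff_one]) _ _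
    (Nat.lt_succ_self _), sub_zero]

theorem mul_inv_self {f : NCSeries S} (hf : f.coeff [] = 1) : f * f.inv = 1 := by
  ext w
  rw [coeff_mul_congr (f' := f) (g' := ∑ k ∈ range (w.length + 1), (1 - f) ^ k)
    (fun _ _ => rfl) (fun v hv => coeff_inv_eq hf hv) le_rfl]
  have := mul_neg_geom_sum (1 - f) (w.length + 1)
  rw [sub_sub_cancel] at this
  rw [this, NCSeries.coeff_sub, coeff_pow_eq_zero (by simp [hf, NCSeries.coeff_one]) _ _
    (Nat.lt_succ_self _), sub_zero]

theorem coeff_mul_nil (f g : NCSeries S) : (f * g).coeff [] = f.coeff [] * g.coeff [] := by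
  simp [NCSeries.coeff_mul]

/-- The constant term. -/
def constCoeff : NCSeries S →+* ℂ where
  toFun f := f.coeff []
  map_one' := by simp [NCSeries.coeff_one]
  map_zero' := rfl
  map_add' _ _ := rfl
  map_mul' := coeff_mul_nil

theorem constCoeff_apply (f : NCSeries S) : constCoeff f = f.coeff [] := rfl

theorem map_ncDet {R R' : Type} [Ring R] [Ring R'] (φ : R →+* R') {k : ℕ}
    (B : Matrix (Fin k) (Fin k) R) : φ (ncDet B) = ncDet (B.map φ) := by
  simp only [ncDet, map_sum, map_zsmul, map_list_prod, List.map_ofFn]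
  rfl

theorem ncDet_eq_det {R : Type} [CommRing R] {k : ℕ} (B : Matrix (Fin k) (Fin k) R) :
    ncDet B = B.det := by
  simp only [ncDet, Matrix.det_apply, List.prod_ofFn]
  rfl

end powers

/-- The truncation in `cpow` depends only on the length of the word, which is constant on a row
fibre. -/
theorem rowCoeff_cpow {m : ℕ} (f : NCSeries (Step m)) (β : ℂ) (W : Fin m → List (Fin m)) :
    rowCoeff (f.cpow β) W = ∑ k ∈ range (∑ h, (W h).length + 1),
      Ring.choose β k * rowCoeff ((f - 1) ^ k) W := by
  simp only [rowCoeff, mul_sum]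
  rw [sum_comm]
  refine sum_congr rfl fun w hw => ?_
  rw [mem_rowFiber] at hw
  subst hw
  rw [← length_eq_sum_rowWord]
  rfl

/-! ### Constant terms of the determinants and of C -/

section constantTerms

variable {m n : ℕ}

theorem constCoeff_genMatrix (i j : Fin m) : constCoeff (genMatrix m i j) = 0 := by
  simp [constCoeff_apply, genMatrix, NCSeries.coeff_word]

theorem coeff_nil_det_one_sub_matA0 (h : n ≤ m) : (ncDet (1 - matA0 h)).coeff [] = 1 := by
  rw [← constCoeff_apply, map_ncDet, ncDet_eq_det]
  have : (1 - matA0 h).map constCoeff = 1 := by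
    ext i j
    rw [Matrix.map_apply, Matrix.sub_apply, map_sub, matA0, Matrix.submatrix_apply,
      constCoeff_genMatrix, sub_zero, Matrix.one_apply, Matrix.one_apply]
    split_ifs <;> simp
  rw [this, Matrix.det_one]

theorem coeff_nil_matC (h : n ≤ m) (i j : Fin (m - n)) : constCoeff (matC h i j) = 0 := by
  rw [matC, map_neg, map_mul, map_ncDet, ncDet_eq_det, neg_eq_zero]
  -- The last row of the bordered matrix has no constant terms.
  refine mul_eq_zero_of_right _ (Matrix.det_eq_zero_of_row_eq_zero (Fin.natAdd n 0) fun q => ?_)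
  rw [bordered, Matrix.map_apply, Matrix.reindex_apply, Matrix.submatrix_apply,
    finSumFinEquiv_symm_apply_natAdd]
  rcases finSumFinEquiv.symm q with q | q
  · rw [Matrix.fromBlocks_apply₂₁]; simp [constCoeff_genMatrix]
  · rw [Matrix.fromBlocks_apply₂₂]; simp [constCoeff_genMatrix]

theorem coeff_nil_det_one_sub_matC (h : n ≤ m) : (ncDet (1 - matC h)).coeff [] = 1 := by
  rw [← constCoeff_apply, map_ncDet, ncDet_eq_det]
  have : (1 - matC h).map constCoeff = 1 := by
    ext i j
    rw [Matrix.map_apply, Matrix.sub_apply, map_sub, coeff_nil_matC, sub_zero,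
      Matrix.one_apply, Matrix.one_apply]
    split_ifs <;> simp
  rw [this, Matrix.det_one]

end constantTerms

/-! ### A Schur complement formula for determinants of Cartier–Foata matrices -/

section grassmann

open scoped TensorProduct
open ExteriorAlgebra

variable {R : Type} [Ring R]

theorem prod_ofFn_tmul {Λ : Type} [Ring Λ] : ∀ {k : ℕ} (a : Fin k → R) (x : Fin k → Λ),
    (List.ofFn fun j => a j ⊗ₜ[ℤ] x j).prod = (List.ofFn a).prod ⊗ₜ[ℤ] (List.ofFn x).prod := by
  intro k
  induction k with
  | zero => intro a x; simp [Algebra.TensorProduct.one_def]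
  | succ k ih =>
    intro a x
    simp only [List.ofFn_succ, List.prod_cons]
    rw [ih, Algebra.TensorProduct.tmul_mul_tmul]

theorem prod_ofFn_sum {E : Type} [Ring E] {k l : ℕ} (F : Fin l → Fin k → E) :
    (List.ofFn fun j => ∑ i, F i j).prod =
      ∑ f : Fin k → Fin l, (List.ofFn fun j => F (f j) j).prod := by
  have := (MultilinearMap.mkPiAlgebraFin ℤ k E).map_sum fun j i => F i j
  simpa using this

variable {V : Type} [AddCommGroup V]

/-- The product of the columns of a matrix, considered as linear combinations of anticommuting
variables, is the determinant times the product of the variables. -/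
theorem prod_columns {k : ℕ} (M : Matrix (Fin k) (Fin k) R) (v : Fin k → V) :
    (List.ofFn fun j => ∑ i, M i j ⊗ₜ[ℤ] ι ℤ (v i)).prod = ncDet M ⊗ₜ[ℤ] ιMulti ℤ k v := by
  classical
  rw [prod_ofFn_sum]
  have e : ∀ f : Fin k → Fin k, (List.ofFn fun j => M (f j) j ⊗ₜ[ℤ] ι ℤ (v (f j))).prod =
      (List.ofFn fun j => M (f j) j).prod ⊗ₜ[ℤ] ιMulti ℤ k (v ∘ f) := by
    intro f
    rw [prod_ofFn_tmul, ιMulti_apply]; rfl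
  simp only [e]
  rw [ncDet, TensorProduct.sum_tmul]
  symm
  refine sum_of_injOn (fun σ => (σ : Fin k → Fin k)) (fun _ _ _ _ h => Equiv.coe_fn_injective h)
    (fun _ _ => mem_coe.2 (mem_univ _)) ?_ ?_
  · intro f _ hf
    have : ¬ Function.Injective f := by
      intro hi
      refine hf ⟨Equiv.ofBijective f (Finite.injective_iff_bijective.1 hi), by simp, ?_⟩
      rfl
    rw [ιMulti_eq_zero_of_not_inj fun h => this h.of_comp, TensorProduct.tmul_zero]
  · intro σ _
    rw [AlternatingMap.map_perm, Units.smul_def, TensorProduct.tmul_smul, TensorProduct.smul_tmul']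

variable {N : ℕ}

/-- The linear combination of anticommuting variables with coefficients `v`. -/
def odd (v : Fin N → R) : R ⊗[ℤ] ExteriorAlgebra ℤ (Fin N → ℤ) :=
  ∑ i, v i ⊗ₜ[ℤ] ι ℤ (Pi.single i 1)

theorem odd_add (v w : Fin N → R) : odd (v + w) = odd v + odd w := by
  simp [odd, TensorProduct.add_tmul, sum_add_distrib]

theorem ι_mul_ι_add_swap (x y : Fin N → ℤ) : ι ℤ x * ι ℤ y + ι ℤ y * ι ℤ x = 0 :=
  ι_add_mul_swap x y

/-- The terms at (i,j) and (j,i) cancel, since their coefficients commute while the variables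
anticommute; diagonal terms vanish because a variable squares to zero. Nothing is needed about
coefficients in the same row. -/
theorem odd_mul_self {v : Fin N → R} (h : ∀ i j, i ≠ j → v i * v j = v j * v i) :
    odd v * odd v = 0 := by
  rw [odd, sum_mul_sum, ← sum_product']
  simp only [Algebra.TensorProduct.tmul_mul_tmul]
  refine sum_involution (fun p _ => (p.2, p.1)) ?_ ?_ ?_ ?_
  · rintro ⟨i, j⟩ _
    by_cases hij : i = j
    · subst hij; simp
    · simp only
      rw [h i j hij, ← TensorProduct.tmul_add, ι_mul_ι_add_swap, TensorProduct.tmul_zero]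
  · rintro ⟨i, j⟩ _ h0 h1
    simp only [Prod.mk.injEq] at h1
    rw [h1.2] at h0
    simp at h0
  · simp
  · simp

/-- Polarization: `v`, `w` and `v + w` all give elements of square zero. -/
theorem odd_anticomm {v w : Fin N → R}
    (h : ∀ i j, i ≠ j → (v i * v j = v j * v i ∧ w i * w j = w j * w i ∧ v i * w j = w j * v i)) :
    odd v * odd w = - (odd w * odd v) := by
  have h1 := odd_mul_self (v := v) fun i j hij => (h i j hij).1
  have h2 := odd_mul_self (v := w) fun i j hij => (h i j hij).2.1
  have h3 := odd_mul_self (v := v + w) fun i j hij => by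
    simp only [Pi.add_apply, add_mul, mul_add]
    rw [(h i j hij).1, (h i j hij).2.1, (h i j hij).2.2, ← (h j i hij.symm).2.2]
    abel
  rw [odd_add, add_mul, mul_add, mul_add, h1, h2, zero_add, add_zero] at h3
  exact eq_neg_of_add_eq_zero_left h3

theorem prod_mul_eq_zero {E : Type} [Ring E] {x : E} : ∀ (l : List E),
    (∀ y ∈ l, y * x = - (x * y)) → x * x = 0 → x ∈ l → l.prod * x = 0 := by
  intro l
  induction l with
  | nil => intro _ _ h; simp at h
  | cons a l ih =>
    intro h1 h2 h3
    -- Moving `x` to the front of a product costs only signs, absorbed in `u`; `x` then meets its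
    -- own occurrence.
    have hcomm : ∀ l : List E, (∀ y ∈ l, y * x = - (x * y)) → ∃ u : E, l.prod * x = x * u := by
      intro l
      induction l with
      | nil => intro _; exact ⟨1, by simp⟩
      | cons b l ih =>
        intro h
        obtain ⟨u, hu⟩ := ih fun y hy => h y (by simp [hy])
        refine ⟨- (b * u), ?_⟩
        rw [List.prod_cons, mul_assoc, hu, ← mul_assoc, h b (by simp)]
        simp [mul_assoc]
    by_cases hx : x ∈ l
    · rw [List.prod_cons, mul_assoc, ih (fun y hy => h1 y (by simp [hy])) h2 hx, mul_zero]
    · have : x = a := by simpa [hx] using h3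
      obtain ⟨u, hu⟩ := hcomm l fun y hy => h1 y (by simp [hy])
      rw [List.prod_cons, mul_assoc, hu, ← mul_assoc, ← this, h2, zero_mul]

/-- Replacing factors `y` by `y'` in a product is possible if they agree after multiplication
with every element killed by the `z i`. -/
theorem prod_mul_congr {E I J : Type} [Ring E] (z : I → E) (y y' : J → E)
    (h : ∀ j x, (∀ i, z i * x = 0) → y j * x = y' j * x)
    (hc : ∀ i j, z i * y' j = - (y' j * z i)) {x : E} (hx : ∀ i, z i * x = 0) :
    ∀ l : List J, (l.map y).prod * x = (l.map y').prod * x := by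
  have key : ∀ l : List J, (∀ i, z i * ((l.map y').prod * x) = 0) ∧
      (l.map y).prod * x = (l.map y').prod * x := by
    intro l
    induction l with
    | nil => simpa using hx
    | cons j l ih =>
      simp only [List.map_cons, List.prod_cons, mul_assoc]
      refine ⟨fun i => ?_, ?_⟩
      · rw [← mul_assoc, hc, neg_mul, mul_assoc, ih.1, mul_zero, neg_zero]
      · rw [ih.2, h j _ ih.1]
  exact fun l => (key l).2

/-- The determinant, as a functional on the top exterior power, takes the value 1 on the product of
all basis vectors and so reads off the coefficient. -/
theorem tmul_ιMulti_injective {a b : R}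
    (h : a ⊗ₜ[ℤ] ιMulti ℤ N (fun i => (Pi.single i 1 : Fin N → ℤ)) =
      b ⊗ₜ[ℤ] ιMulti ℤ N (fun i => (Pi.single i 1 : Fin N → ℤ))) : a = b := by
  classical
  -- `liftAlternating` takes an alternating map in every degree; all but the top one are zero.
  let f : ∀ i, (Fin N → ℤ) [⋀^Fin i]→ₗ[ℤ] ℤ := fun i =>
    if hi : i = N then hi ▸ Matrix.detRowAlternating else 0
  have hf : f N = Matrix.detRowAlternating := by simp [f]
  have h1 := congrArg (fun t => TensorProduct.rid ℤ R ((liftAlternating f).lTensor R t)) h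
  simp only [LinearMap.lTensor_tmul, liftAlternating_apply_ιMulti, hf, TensorProduct.rid_tmul] at h1
  have h2 : Matrix.detRowAlternating (fun i => (Pi.single i 1 : Fin N → ℤ)) = (1 : ℤ) := by
    have : (fun i => (Pi.single i 1 : Fin N → ℤ)) = (1 : Matrix (Fin N) (Fin N) ℤ) := by
      funext i j; simp [Matrix.one_apply, Pi.single_apply, eq_comm]
    rw [this]; exact Matrix.det_one
  simpa [h2] using h1

end grassmann

/-! ### Block elimination by column operations -/

section schur

open scoped TensorProduct
open ExteriorAlgebra

variable {R : Type} [Ring R]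

/-- Block elimination, carried out on the product of the columns in the Grassmann algebra. The
entries of `U` only multiply columns from the right, so they need not commute with anything. -/
theorem ncDet_schur {n r : ℕ} (M₁₁ : Matrix (Fin n) (Fin n) R) (M₁₂ : Matrix (Fin n) (Fin r) R)
    (M₂₁ : Matrix (Fin r) (Fin n) R) (M₂₂ : Matrix (Fin r) (Fin r) R)
    (U : Matrix (Fin n) (Fin r) R) (hU : M₁₁ * U = M₁₂)
    (hM : ∀ i j, i ≠ j → ∀ k l, Matrix.fromBlocks M₁₁ M₁₂ M₂₁ M₂₂ i k *
      Matrix.fromBlocks M₁₁ M₁₂ M₂₁ M₂₂ j l = Matrix.fromBlocks M₁₁ M₁₂ M₂₁ M₂₂ j l *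
      Matrix.fromBlocks M₁₁ M₁₂ M₂₁ M₂₂ i k) :
    ncDet ((Matrix.fromBlocks M₁₁ M₁₂ M₂₁ M₂₂).reindex finSumFinEquiv finSumFinEquiv) =
      ncDet M₁₁ * ncDet (M₂₂ - M₂₁ * U) := by
  classical
  set M := (Matrix.fromBlocks M₁₁ M₁₂ M₂₁ M₂₂).reindex finSumFinEquiv finSumFinEquiv with hMdef
  have hCF : ∀ i j, i ≠ j → ∀ k l, M i k * M j l = M j l * M i k := by
    intro i j hij k l
    exact hM _ _ (fun h => hij (finSumFinEquiv.symm.injective h)) _ _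
  have m11 : ∀ i j, M (Fin.castAdd r i) (Fin.castAdd r j) = M₁₁ i j := by
    intro i j; simp [hMdef]
  have m12 : ∀ i j, M (Fin.castAdd r i) (Fin.natAdd n j) = M₁₂ i j := by
    intro i j; simp [hMdef]
  have m21 : ∀ i j, M (Fin.natAdd n i) (Fin.castAdd r j) = M₂₁ i j := by
    intro i j; simp [hMdef]
  have m22 : ∀ i j, M (Fin.natAdd n i) (Fin.natAdd n j) = M₂₂ i j := by
    intro i j; simp [hMdef]
  clear_value M
  let e : Fin (n + r) → (Fin (n + r) → ℤ) := fun i => Pi.single i 1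
  let Ψ : Fin (n + r) → R ⊗[ℤ] ExteriorAlgebra ℤ (Fin (n + r) → ℤ) := fun j => odd fun i => M i j
  have hΨ : ∀ j k, Ψ j * Ψ k = - (Ψ k * Ψ j) := fun j k =>
    odd_anticomm fun a b hab => ⟨hCF _ _ hab _ _, hCF _ _ hab _ _, hCF _ _ hab _ _⟩
  have hΨ2 : ∀ j, Ψ j * Ψ j = 0 := fun j => odd_mul_self fun a b hab => hCF _ _ hab _ _
  let χ : Fin r → R ⊗[ℤ] ExteriorAlgebra ℤ (Fin (n + r) → ℤ) := fun j =>
    ∑ i, (M₂₂ - M₂₁ * U) i j ⊗ₜ[ℤ] ι ℤ (e (Fin.natAdd n i))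
  let Λ : Fin n → R ⊗[ℤ] ExteriorAlgebra ℤ (Fin (n + r) → ℤ) := fun j =>
    ∑ i, M₁₁ i j ⊗ₜ[ℤ] ι ℤ (e (Fin.castAdd r i))
  -- Subtracting the combinations of the first `n` columns given by `U` kills the upper part, as
  -- `M₁₁ * U = M₁₂`; what is left are the columns of the Schur complement.
  have hχ : ∀ j, χ j = Ψ (Fin.natAdd n j) - ∑ p, Ψ (Fin.castAdd r p) * (U p j ⊗ₜ[ℤ] 1) := by
    intro j
    have h1 : ∀ p, Ψ (Fin.castAdd r p) * (U p j ⊗ₜ[ℤ] 1) =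
        ∑ i, (M i (Fin.castAdd r p) * U p j) ⊗ₜ[ℤ] ι ℤ (e i) := by
      intro p
      simp only [Ψ, odd, sum_mul, Algebra.TensorProduct.tmul_mul_tmul, mul_one]
      rfl
    simp only [h1]
    rw [sum_comm]
    simp only [Ψ, odd]
    rw [← sum_sub_distrib, Fin.sum_univ_add]
    simp only [← TensorProduct.sum_tmul]
    have h2 : ∀ i : Fin n, ∑ p, M (Fin.castAdd r i) (Fin.castAdd r p) * U p j =
        M (Fin.castAdd r i) (Fin.natAdd n j) := by
      intro i
      rw [m12, ← hU, Matrix.mul_apply]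
      exact sum_congr rfl fun p _ => by rw [m11]
    simp only [h2]
    have h3 : ∀ i : Fin r, ∑ p, M (Fin.natAdd n i) (Fin.castAdd r p) * U p j =
        (M₂₁ * U) i j := by
      intro i
      rw [Matrix.mul_apply]
      exact sum_congr rfl fun p _ => by rw [m21]
    simp only [h3, m22, χ, Matrix.sub_apply, TensorProduct.sub_tmul]
    simp [e]
  set P := (List.ofFn fun p : Fin n => Ψ (Fin.castAdd r p)).prod with hP
  have hPΨ : ∀ p : Fin n, P * Ψ (Fin.castAdd r p) = 0 := by
    intro p
    refine prod_mul_eq_zero _ ?_ (hΨ2 _) ?_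
    · intro y hy
      rw [List.mem_ofFn] at hy
      obtain ⟨q, rfl⟩ := hy
      exact hΨ _ _
    · rw [List.mem_ofFn]; exact ⟨p, rfl⟩
  -- The second claim makes the induction run: a first-block column dies when it reaches `P`, so in
  -- the next factor `χ j` only the original column contributes, and that column again anticommutes
  -- with the first block.
  have step : ∀ l : List (Fin r), P * (l.map χ).prod =
      P * (l.map fun j => Ψ (Fin.natAdd n j)).prod ∧
      ∀ p : Fin n, P * (l.map χ).prod * Ψ (Fin.castAdd r p) = 0 := by
    intro l
    induction l using List.reverseRecOn with
    | nil => simpa using hPΨ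
    | append_singleton l j ih =>
      have h1 : P * ((l ++ [j]).map χ).prod =
          P * (l.map χ).prod * Ψ (Fin.natAdd n j) := by
        rw [List.map_append, List.prod_append, List.map_singleton, List.prod_singleton,
          ← mul_assoc, hχ, mul_sub, mul_sum]
        rw [sum_eq_zero, sub_zero]
        intro p _
        rw [← mul_assoc, ih.2, zero_mul]
      refine ⟨?_, fun p => ?_⟩
      · rw [h1, ih.1, List.map_append, List.prod_append, List.map_singleton, List.prod_singleton,
          ← mul_assoc]
      · rw [h1, mul_assoc, hΨ]
        refine (mul_neg (P * (l.map χ).prod) (Ψ (Fin.castAdd r p) * Ψ (Fin.natAdd n j))).trans ?_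
        rw [← mul_assoc, ih.2, zero_mul, neg_zero]
  have e1 : ncDet M ⊗ₜ[ℤ] ιMulti ℤ (n + r) e =
      P * (List.ofFn fun j : Fin r => Ψ (Fin.natAdd n j)).prod := by
    rw [← prod_columns, hP, ← List.prod_append, ← List.ofFn_fin_append]
    congr 2
    funext j
    refine Fin.addCases (fun j => ?_) (fun j => ?_) j
    · simp [Ψ, odd, e]
    · simp [Ψ, odd, e]
  have e2 : P * (List.ofFn fun j : Fin r => Ψ (Fin.natAdd n j)).prod =
      P * (List.ofFn χ).prod := by
    have := (step (List.finRange r)).1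
    rw [← List.ofFn_eq_map, ← List.ofFn_eq_map] at this
    exact this.symm
  have e3 : (List.ofFn χ).prod = ncDet (M₂₂ - M₂₁ * U) ⊗ₜ[ℤ]
      ιMulti ℤ r (fun i => e (Fin.natAdd n i)) := prod_columns _ _
  have hι : ∀ (a b : R) (x y : Fin (n + r) → ℤ),
      a ⊗ₜ[ℤ] ι ℤ x * b ⊗ₜ[ℤ] ι ℤ y = (a * b) ⊗ₜ[ℤ] (ι ℤ x * ι ℤ y) := fun a b x y =>
    Algebra.TensorProduct.tmul_mul_tmul _ _ _ _
  -- The right factor contains all variables of the lower block, so multiplying by any of these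
  -- gives zero; hence the columns in `P` may be replaced by their upper parts `Λ`.
  have e4 : P * ncDet (M₂₂ - M₂₁ * U) ⊗ₜ[ℤ] ιMulti ℤ r (fun i => e (Fin.natAdd n i)) =
      (List.ofFn Λ).prod * ncDet (M₂₂ - M₂₁ * U) ⊗ₜ[ℤ]
        ιMulti ℤ r (fun i => e (Fin.natAdd n i)) := by
    rw [hP, List.ofFn_eq_map, List.ofFn_eq_map]
    refine prod_mul_congr (fun i : Fin r => (1 : R) ⊗ₜ[ℤ] ι ℤ (e (Fin.natAdd n i))) _ _ ?_ ?_ ?_ _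
    · intro j x hx
      simp only [Ψ, odd, Λ]
      rw [Fin.sum_univ_add, add_mul]
      refine (congrArg₂ (· + ·) ?_ ?_).trans (add_zero _)
      · simp [m11, e]
      · rw [sum_mul]
        refine sum_eq_zero fun i _ => ?_
        have : M (Fin.natAdd n i) (Fin.castAdd r j) ⊗ₜ[ℤ]
            (ι ℤ (Pi.single (Fin.natAdd n i) 1 : Fin (n + r) → ℤ)) =
            M (Fin.natAdd n i) (Fin.castAdd r j) ⊗ₜ[ℤ] 1 *
              (1 : R) ⊗ₜ[ℤ] ι ℤ (e (Fin.natAdd n i)) := by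
          rw [Algebra.TensorProduct.tmul_mul_tmul, mul_one, one_mul]
        rw [this, mul_assoc, hx, mul_zero]
    · intro i j
      simp only [Λ, mul_sum, sum_mul, hι, ← sum_neg_distrib]
      refine sum_congr rfl fun p _ => ?_
      rw [one_mul, mul_one, ← TensorProduct.tmul_neg]
      congr 1
      exact eq_neg_of_add_eq_zero_left (ι_mul_ι_add_swap _ _)
    · intro i
      rw [Algebra.TensorProduct.tmul_mul_tmul]
      have : ι ℤ (e (Fin.natAdd n i)) * ιMulti ℤ r (fun i => e (Fin.natAdd n i)) =
          ιMulti ℤ (r + 1) (Matrix.vecCons (e (Fin.natAdd n i)) fun i => e (Fin.natAdd n i)) := by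
        rw [ιMulti_succ_apply]; rfl
      rw [this, ιMulti_eq_zero_of_not_inj, TensorProduct.tmul_zero]
      intro hinj
      have := @hinj 0 i.succ rfl
      exact absurd this (Fin.succ_ne_zero i).symm
  have e5 : (List.ofFn Λ).prod = ncDet M₁₁ ⊗ₜ[ℤ] ιMulti ℤ n (fun i => e (Fin.castAdd r i)) :=
    prod_columns _ _
  refine tmul_ιMulti_injective (N := n + r) ?_
  change ncDet M ⊗ₜ[ℤ] ιMulti ℤ (n + r) e = _ ⊗ₜ[ℤ] ιMulti ℤ (n + r) e
  rw [e1, e2, e3, e4, e5, Algebra.TensorProduct.tmul_mul_tmul, ιMulti_mul_ιMulti]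
  congr 2
  funext j
  refine Fin.addCases (fun j => ?_) (fun j => ?_) j <;> simp

end schur

/-! ### Sylvester's identity -/

section sylvester

variable {m n : ℕ}

theorem coeff_gen_mul_nil (i j : Fin m) (f : NCSeries (Step m)) :
    (genMatrix m i j * f).coeff [] = 0 := by
  simp [coeff_mul_nil, genMatrix, NCSeries.coeff_word]

theorem coeff_gen_mul_cons (i j : Fin m) (f : NCSeries (Step m)) (s : Step m)
    (t : List (Step m)) :
    (genMatrix m i j * f).coeff (s :: t) = if s = (i, j) then f.coeff t else 0 := by
  rw [NCSeries.coeff_mul, sum_eq_single 1]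
  · simp [genMatrix, NCSeries.coeff_word]
  · intro k hk h1
    simp only [mem_range, List.length_cons] at hk
    have : (s :: t).take k ≠ [(i, j)] := by
      intro h
      have := congrArg List.length h
      simp at this
      omega
    simp [genMatrix, NCSeries.coeff_word, this]
  · simp

/-- The indicator of the words that are paths from `p` to `j` whose intermediate heights are less
than `n`. -/
def lowPathCoeff (n : ℕ) (j : Fin m) : Fin m → List (Step m) → ℂ
  | _, [] => 0
  | p, s :: t => if s.1 = p then
      (if s.2 = j ∧ t = [] then 1 else 0) + (if (s.2 : ℕ) < n then lowPathCoeff n j s.2 t else 0)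
    else 0

/-- The sum of all paths from `p` to `j` whose intermediate heights are less than `n`. -/
def lowPath (n : ℕ) (j p : Fin m) : NCSeries (Step m) := lowPathCoeff n j p

/-- The first step of a path either finishes it at `j` or leads to a low height, from which a
shorter path remains. -/
theorem lowPath_eq (h : n ≤ m) (j p : Fin m) :
    lowPath n j p = genMatrix m p j +
      ∑ q : Fin n, genMatrix m p (Fin.castLE h q) * lowPath n j (Fin.castLE h q) := by
  ext w
  rw [NCSeries.coeff_add, coeff_sum]
  cases w with
  | nil =>
    simp only [coeff_gen_mul_nil, sum_const_zero, add_zero]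
    simp only [genMatrix, NCSeries.coeff_word]
    simp; rfl
  | cons s t =>
    simp only [coeff_gen_mul_cons]
    have e0 : (lowPath n j p).coeff (s :: t) = if s.1 = p then
      (if s.2 = j ∧ t = [] then 1 else 0) +
        (if (s.2 : ℕ) < n then (lowPath n j s.2).coeff t else 0) else 0 := by
      change lowPathCoeff n j p (s :: t) = _
      rw [lowPathCoeff]; rfl
    rw [e0]
    obtain ⟨a, b⟩ := s
    by_cases hp : a = p
    · subst hp
      simp only [if_true, Prod.mk.injEq, true_and]
      congr 1
      · simp [genMatrix, NCSeries.coeff_word]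
      · split_ifs with hb
        · rw [sum_eq_single (⟨b, hb⟩ : Fin n)]
          · rw [if_pos (by ext; rfl)]; rfl
          · intro q _ hq
            rw [if_neg]
            rintro rfl
            exact hq rfl
          · simp
        · symm
          refine sum_eq_zero fun q _ => if_neg ?_
          rintro rfl
          exact hb q.2
    · simp [hp, genMatrix, NCSeries.coeff_word]

theorem toCF_gen_comm {i j : Fin m} (h : i ≠ j) (k l : Fin m) :
    Commute (toCF m (genMatrix m i k)) (toCF m (genMatrix m j l)) := by
  rw [Commute, SemiconjBy, ← map_mul, ← map_mul, toCF_eq_iff]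
  intro W
  rw [genMatrix, genMatrix, ← word_append, ← word_append, rowCoeff_word, rowCoeff_word]
  have : rowWord ([(i, k)] ++ [(j, l)]) = rowWord ([(j, l)] ++ [(i, k)]) :=
    rowWord_move (j, l) [(i, k)] [] (by simpa using h)
  rw [this]

/-- The entries of the matrices to which `ncDet_schur` is applied are variables subtracted from
integers, and integers are central. -/
theorem toCF_shift_gen_comm {i j : Fin m} (h : i ≠ j) (k l : Fin m) (a b : ℤ) {x y : CFAlg m}
    (hx : x = (a : CFAlg m) - toCF m (genMatrix m i k))
    (hy : y = (b : CFAlg m) - toCF m (genMatrix m j l)) : x * y = y * x := by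
  subst hx hy
  exact Commute.sub_left (Int.cast_commute _ _)
    (Commute.sub_right (Int.commute_cast _ _) (toCF_gen_comm h k l))

theorem ncDet_submatrix_cast {R : Type} [Ring R] {a b : ℕ} (h : a = b)
    (B : Matrix (Fin b) (Fin b) R) :
    ncDet (B.submatrix (Fin.cast h) (Fin.cast h)) = ncDet B := by
  subst h; rfl

theorem one_sub_matA0_apply (h : n ≤ m) (i j : Fin n) :
    toCF m ((1 - matA0 h : Matrix _ _ _) i j) = ((if i = j then 1 else 0 : ℤ) : CFAlg m) -
      toCF m (genMatrix m (Fin.castLE h i) (Fin.castLE h j)) := by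
  rw [Matrix.sub_apply, map_sub, Matrix.one_apply, matA0, Matrix.submatrix_apply]
  split_ifs <;> simp

/-- The recursion `lowPath_eq`, read as a linear system: it supplies the matrix `U` of
`ncDet_schur`, both for a single border and for all high columns at once. -/
theorem map_one_sub_matA0_mul (h : n ≤ m) {r : ℕ} (κ : Fin r → Fin m) :
    (1 - matA0 h).map (toCF m) *
      (Matrix.of fun (p : Fin n) (j : Fin r) => -toCF m (lowPath n (κ j) (Fin.castLE h p))) =
    Matrix.of fun (p : Fin n) (j : Fin r) => -toCF m (genMatrix m (Fin.castLE h p) (κ j)) := by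
  ext p j
  rw [Matrix.mul_apply]
  simp only [Matrix.map_apply, Matrix.of_apply, one_sub_matA0_apply, sub_mul, mul_neg,
    sum_sub_distrib, sum_neg_distrib, neg_inj, ← map_mul]
  rw [sub_eq_iff_eq_add]
  simp only [Int.cast_ite, Int.cast_one, Int.cast_zero, ite_mul, one_mul, zero_mul, sum_ite_eq,
    mem_univ, if_true, ← map_sum]
  rw [← map_add]
  exact congrArg _ (lowPath_eq h _ _)

/-- For the bordered matrix the Schur complement is the 1×1 matrix with entry -(a_ij + ∑ a_iq ·
paths from q to j), which is minus the sum of the low paths from i to j; the factor det(I-A₀)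
cancels. -/
theorem toCF_matC (h : n ≤ m) (i j : Fin (m - n)) :
    toCF m (matC h i j) = toCF m (lowPath n (hiIdx j) (hiIdx i)) := by
  have h1 : toCF m (ncDet (bordered h (hiIdx i) (hiIdx j))) =
      -(toCF m (ncDet (1 - matA0 h)) * toCF m (lowPath n (hiIdx j) (hiIdx i))) := by
    have e1 : (bordered h (hiIdx i) (hiIdx j)).map (toCF m) =
        (Matrix.fromBlocks ((1 - matA0 h).map (toCF m))
        (Matrix.of fun (p : Fin n) (_ : Fin 1) =>
          -toCF m (genMatrix m (Fin.castLE h p) (hiIdx j)))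
        (Matrix.of fun (_ : Fin 1) (q : Fin n) =>
          -toCF m (genMatrix m (hiIdx i) (Fin.castLE h q)))
        (Matrix.of fun (_ _ : Fin 1) => -toCF m (genMatrix m (hiIdx i) (hiIdx j)))).reindex
          finSumFinEquiv finSumFinEquiv := by
      rw [bordered]
      ext a b
      simp only [Matrix.map_apply, Matrix.reindex_apply, Matrix.submatrix_apply]
      rcases finSumFinEquiv.symm a with a | a <;> rcases finSumFinEquiv.symm b with b | b <;> simp
    rw [map_ncDet, map_ncDet, e1, ncDet_schur _ _ _ _ _
      (map_one_sub_matA0_mul h fun _ : Fin 1 => hiIdx j), ← mul_neg]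
    · congr 1
      rw [lowPath_eq h]
      simp [ncDet, Matrix.mul_apply, map_add, map_sum, map_mul]
      abel
    · have key : ∀ a b, ∃ ε : ℤ, Matrix.fromBlocks ((1 - matA0 h).map (toCF m))
        (Matrix.of fun (p : Fin n) (_ : Fin 1) =>
          -toCF m (genMatrix m (Fin.castLE h p) (hiIdx j)))
        (Matrix.of fun (_ : Fin 1) (q : Fin n) =>
          -toCF m (genMatrix m (hiIdx i) (Fin.castLE h q)))
        (Matrix.of fun (_ _ : Fin 1) => -toCF m (genMatrix m (hiIdx i) (hiIdx j))) a b =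
          (ε : CFAlg m) - toCF m (genMatrix m
            (Sum.elim (Fin.castLE h) (fun _ => hiIdx i) a)
            (Sum.elim (Fin.castLE h) (fun _ => hiIdx j) b)) := by
        rintro (a | a) (b | b)
        · exact ⟨_, one_sub_matA0_apply h a b⟩
        all_goals exact ⟨0, by simp⟩
      intro a b hab k l
      obtain ⟨ε, hε⟩ := key a k
      obtain ⟨δ, hδ⟩ := key b l
      refine toCF_shift_gen_comm ?_ _ _ ε δ hε hδ
      rcases a with a | a <;> rcases b with b | b
      · intro hh; exact hab (congrArg _ (Fin.castLE_injective h hh))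
      · intro hh; have := congrArg Fin.val hh; simp [hiIdx] at this; omega
      · intro hh; have := congrArg Fin.val hh; simp [hiIdx] at this; omega
      · exact absurd (congrArg _ (Subsingleton.elim a b)) hab
  rw [matC, map_neg, map_mul, h1, mul_neg, neg_neg, ← mul_assoc, ← map_mul,
    inv_mul_self (coeff_nil_det_one_sub_matA0 h), map_one, one_mul]

/-- The Schur complement of I-A₀ in I-A is I minus the matrix of low path sums, which is I-C. -/
theorem sylvester (h : n ≤ m) :
    toCF m (ncDet (1 - matA0 (le_refl m))) =
      toCF m (ncDet (1 - matA0 h)) * toCF m (ncDet (1 - matC h)) := by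
  have hc : n + (m - n) = m := by omega
  let ρ : Fin n ⊕ Fin (m - n) → Fin m := Sum.elim (Fin.castLE h) hiIdx
  have hρ : ∀ a, Fin.cast hc (finSumFinEquiv a) = ρ a := by
    rintro (a | a) <;> rfl
  have hρi : Function.Injective ρ := by
    intro a b hab
    rw [← hρ, ← hρ] at hab
    exact finSumFinEquiv.injective (Fin.cast_injective hc hab)
  set M := Matrix.fromBlocks ((1 - matA0 h).map (toCF m))
      (Matrix.of fun (p : Fin n) (j : Fin (m - n)) =>
        -toCF m (genMatrix m (Fin.castLE h p) (hiIdx j)))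
      (Matrix.of fun (i : Fin (m - n)) (q : Fin n) =>
        -toCF m (genMatrix m (hiIdx i) (Fin.castLE h q)))
      (Matrix.of fun (i j : Fin (m - n)) => ((if i = j then 1 else 0 : ℤ) : CFAlg m) -
        toCF m (genMatrix m (hiIdx i) (hiIdx j))) with hM
  have key : ∀ a b, M a b = ((if a = b then 1 else 0 : ℤ) : CFAlg m) -
      toCF m (genMatrix m (ρ a) (ρ b)) := by
    rintro (a | a) (b | b)
    · simpa [hM, ρ] using one_sub_matA0_apply h a b
    all_goals simp [hM, ρ]
  have e1 : ((1 - matA0 (le_refl m)).map (toCF m)).submatrix (Fin.cast hc) (Fin.cast hc) =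
      M.reindex finSumFinEquiv finSumFinEquiv := by
    ext a b
    rw [Matrix.submatrix_apply, Matrix.map_apply, one_sub_matA0_apply, Matrix.reindex_apply,
      Matrix.submatrix_apply, key]
    have h1 : ∀ a, Fin.castLE (le_refl m) (Fin.cast hc a) = ρ (finSumFinEquiv.symm a) := by
      intro a; rw [← hρ, Equiv.apply_symm_apply]; rfl
    rw [h1, h1]
    simp [(Fin.cast_injective hc).eq_iff]
  rw [map_ncDet, ← ncDet_submatrix_cast hc, e1, hM, ncDet_schur _ _ _ _ _
      (map_one_sub_matA0_mul h hiIdx), ← map_ncDet]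
  · congr 1
    rw [map_ncDet]
    congr 1
    ext i j
    rw [Matrix.map_apply, Matrix.sub_apply, Matrix.sub_apply, map_sub, toCF_matC, lowPath_eq h,
      Matrix.mul_apply, Matrix.one_apply]
    simp only [Matrix.of_apply, neg_mul_neg, map_add, map_sum, map_mul, sub_sub]
    split_ifs <;> simp
  · intro a b hab k l
    exact toCF_shift_gen_comm (fun hh => hab (hρi hh)) _ _ _ _ (key a k) (key b l)

end sylvester

/-! ### Balanced tuples and the inverse of the determinant -/

section balanced

variable {m n : ℕ}

/-- Every height is the start of as many steps as it is the end of. -/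
def IsBalanced (W : Fin m → List (Fin m)) : Prop := ∀ j, ∑ h, (W h).count j = (W j).length

theorem isBalanced_nil : IsBalanced (fun _ : Fin m => ([] : List (Fin m))) := by
  intro j; simp

theorem sum_count_cat (X Y : Fin m → List (Fin m)) (j : Fin m) :
    ∑ h, (cat X Y h).count j = ∑ h, (X h).count j + ∑ h, (Y h).count j := by
  simp [cat, sum_add_distrib]

theorem IsBalanced.cat {X Y : Fin m → List (Fin m)} (hX : IsBalanced X) (hY : IsBalanced Y) :
    IsBalanced (cat X Y) := by
  intro j
  rw [sum_count_cat, hX, hY]; simp [BetaSylvester.cat]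

theorem IsBalanced.of_cat_right {X Y : Fin m → List (Fin m)} (hY : IsBalanced Y)
    (h : IsBalanced (BetaSylvester.cat X Y)) : IsBalanced X := by
  intro j
  have h1 := h j
  have h2 := hY j
  rw [sum_count_cat] at h1
  simp only [BetaSylvester.cat, List.length_append] at h1
  omega

theorem IsBalanced.of_cat_left {X Y : Fin m → List (Fin m)} (hX : IsBalanced X)
    (h : IsBalanced (BetaSylvester.cat X Y)) : IsBalanced Y := by
  intro j
  have h1 := h j
  have h2 := hX j
  rw [sum_count_cat] at h1
  simp only [BetaSylvester.cat, List.length_append] at h1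
  omega

theorem sum_count_rowWord (w : List (Step m)) (j : Fin m) :
    ∑ h, (rowWord w h).count j = (w.map Prod.snd).count j := by
  induction w with
  | nil => simp
  | cons s w ih =>
    have : ∀ h, (rowWord (s :: w) h).count j =
        (rowWord w h).count j + if s.1 = h then (if s.2 = j then 1 else 0) else 0 := by
      intro h; rw [rowWord_cons]; split_ifs <;> simp [*]
    simp only [this, sum_add_distrib, sum_ite_eq, mem_univ, if_true, List.map_cons, ih]
    rw [List.count_cons]; simp

theorem length_rowWord (w : List (Step m)) (j : Fin m) :
    (rowWord w j).length = (w.map Prod.fst).count j := by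
  induction w with
  | nil => simp
  | cons s w ih => rw [rowWord_cons, List.map_cons, List.count_cons, ← ih]; split_ifs <;> simp_all

theorem isBalanced_rowWord_iff {w : List (Step m)} :
    IsBalanced (rowWord w) ↔ (w.map Prod.snd).Perm (w.map Prod.fst) := by
  rw [List.perm_iff_count]
  simp only [IsBalanced, sum_count_rowWord, length_rowWord]

theorem IsBalanced.ne_nil_of_mem {W : Fin m → List (Fin m)} (hW : IsBalanced W) {h j : Fin m}
    (hj : j ∈ W h) : W j ≠ [] := by
  intro h0
  have h1 := hW j
  rw [h0, List.length_nil, sum_eq_zero_iff] at h1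
  exact (List.count_pos_iff.2 hj).ne' (h1 h (mem_univ _))

/-- The series whose coefficients at the tuples of words are given by `g`. -/
def ofRow (g : (Fin m → List (Fin m)) → ℂ) : NCSeries (Step m) := fun w =>
  open Classical in if w = normalWord (rowWord w) then g (rowWord w) else 0

@[simp] theorem rowCoeff_ofRow (g : (Fin m → List (Fin m)) → ℂ) (W : Fin m → List (Fin m)) :
    rowCoeff (ofRow g) W = g W := by
  rw [rowCoeff, sum_eq_single (normalWord W)]
  · simp [ofRow, NCSeries.coeff]
  · intro w hw hne
    rw [mem_rowFiber] at hw
    subst hw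
    exact if_neg hne
  · simp

open Classical in
/-- The sum of all balanced tuples. -/
def balSeries (m : ℕ) : NCSeries (Step m) := ofRow fun W => if IsBalanced W then 1 else 0

/-- `rowCoeff` as an additive map. -/
def rowCoeffHom (W : Fin m → List (Fin m)) : NCSeries (Step m) →+ ℂ where
  toFun f := rowCoeff f W
  map_zero' := rowCoeff_zero W
  map_add' f g := rowCoeff_add f g W

theorem rowWord_eq_singleton {v : List (Step m)} (hv : (v.map Prod.fst).Nodup) {s : Step m}
    (hs : s ∈ v) : rowWord v s.1 = [s.2] := by
  induction v with
  | nil => simp at hs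
  | cons a v ih =>
    rw [List.map_cons, List.nodup_cons] at hv
    rw [rowWord_cons]
    rcases List.mem_cons.1 hs with rfl | hs
    · rw [if_pos rfl, (rowWord_eq_nil_iff v s.1).2]
      intro t ht h
      exact hv.1 (h ▸ List.mem_map_of_mem ht)
    · rw [if_neg, ih hv.2 hs]
      intro h
      exact hv.1 (h ▸ List.mem_map_of_mem hs)

/-- Every row of `v` has at most one letter, so `v` is a right factor exactly when these letters are
last in their rows. -/
theorem exists_cat_rowWord_iff {v : List (Step m)} (hv : (v.map Prod.fst).Nodup)
    {W : Fin m → List (Fin m)} :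
    (∃ X, cat X (rowWord v) = W) ↔ ∀ s ∈ v, (W s.1).getLast? = some s.2 := by
  constructor
  · rintro ⟨X, rfl⟩ s hs
    simp [cat, rowWord_eq_singleton hv hs]
  · intro h
    refine ⟨fun i => if rowWord v i = [] then W i else (W i).dropLast, ?_⟩
    funext i
    by_cases hi : rowWord v i = []
    · simp [cat, hi]
    · obtain ⟨s, hs, rfl⟩ : ∃ s ∈ v, s.1 = i := by
        rw [rowWord_eq_nil_iff] at hi; push Not at hi; exact hi
      rw [cat, if_neg hi, rowWord_eq_singleton hv hs]
      exact List.dropLast_append_getLast? _ (by rw [h s hs]; rfl)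

-- The left factor is unique by cancellation, and it is balanced exactly when the product is.
open Classical in
theorem rowCoeff_bal_mul_word {v : List (Step m)} (hv : (v.map Prod.fst).Nodup)
    (hb : IsBalanced (rowWord v)) (W : Fin m → List (Fin m)) :
    rowCoeff (balSeries m * NCSeries.word v) W =
      if IsBalanced W ∧ ∀ s ∈ v, (W s.1).getLast? = some s.2 then 1 else 0 := by
  rw [rowCoeff_mul]
  simp only [rowCoeff_word, balSeries, rowCoeff_ofRow]
  split_ifs with h
  · obtain ⟨X, hX⟩ := (exists_cat_rowWord_iff hv).2 h.2
    rw [sum_eq_single (X, rowWord v)]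
    · rw [if_pos rfl, if_pos (hb.of_cat_right (hX ▸ h.1)), one_mul]
    · rintro ⟨X', Y⟩ hp hne
      rw [mem_splits] at hp
      by_cases hY : rowWord v = Y
      · subst hY
        refine absurd ?_ hne
        rw [cat_right_cancel ((show cat X' (rowWord v) = W from hp).trans hX.symm)]
      · simp [hY]
    · intro hp; exact absurd (mem_splits.2 hX) hp
  · refine sum_eq_zero ?_
    rintro ⟨X, Y⟩ hp
    rw [mem_splits] at hp
    by_cases hY : rowWord v = Y
    · subst hY
      by_cases hX : IsBalanced X
      · exact absurd ⟨hp ▸ hX.cat hb, (exists_cat_rowWord_iff hv).1 ⟨X, hp⟩⟩ h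
      · simp [hX]
    · simp [hY]

/-- The indicator of the last letter of a row. -/
def lastInd (W : Fin m → List (Fin m)) (s : Step m) : ℂ :=
  if (W s.1).getLast? = some s.2 then 1 else 0

-- The product is expanded one factor at a time: `K` lists the columns where the variable has been
-- chosen, `js` those still to be expanded. Columns where the identity was chosen are fixed by `σ`,
-- so the word finally obtained from `K` is balanced.
open Classical in
theorem rowCoeff_bal_mul_prod (h : n ≤ m) (σ : Equiv.Perm (Fin n)) (W : Fin m → List (Fin m)) :
    ∀ js K : List (Fin n), (K ++ js).Nodup → (∀ j, j ∉ K ++ js → σ j = j) →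
    rowCoeff (balSeries m * (NCSeries.word (K.map fun j => (Fin.castLE h (σ j), Fin.castLE h j)) *
      (js.map fun j => (1 - matA0 h : Matrix _ _ _) (σ j) j).prod)) W =
    (if IsBalanced W then 1 else 0) *
      (K.map fun j => lastInd W (Fin.castLE h (σ j), Fin.castLE h j)).prod *
      (js.map fun j => (1 : Matrix _ _ ℂ) (σ j) j -
        lastInd W (Fin.castLE h (σ j), Fin.castLE h j)).prod := by
  intro js
  induction js with
  | nil =>
    intro K hnd hfix
    simp only [List.append_nil] at hnd hfix
    have hst : ((K.map fun j => (Fin.castLE h (σ j), Fin.castLE h j)).map Prod.fst).Nodup := by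
      rw [List.map_map]
      exact hnd.map ((Fin.castLE_injective h).comp σ.injective)
    rw [List.map_nil, List.prod_nil, mul_one, List.map_nil, List.prod_nil, mul_one,
      rowCoeff_bal_mul_word hst]
    · have : (K.map fun j => lastInd W (Fin.castLE h (σ j), Fin.castLE h j)).prod =
        if ∀ s ∈ K.map (fun j => (Fin.castLE h (σ j), Fin.castLE h j)),
          (W s.1).getLast? = some s.2 then 1 else 0 := by
        clear hnd hfix hst
        induction K with
        | nil => simp
        | cons a K ih =>
          rw [List.map_cons, List.prod_cons, ih, List.map_cons]
          simp only [List.forall_mem_cons, lastInd, ite_and]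
          split_ifs <;> simp
      rw [this, ite_and]
      split_ifs <;> simp
    · rw [isBalanced_rowWord_iff, List.map_map, List.map_map]
      -- As `σ` fixes everything outside `K`, it maps `K` to itself.
      have hK : (K.map σ).Perm K := by
        refine (List.subperm_of_subset (hnd.map σ.injective) ?_).perm_of_length_le (by simp)
        intro i hi
        obtain ⟨j, hj, rfl⟩ := List.mem_map.1 hi
        by_contra hc
        have := σ.injective (hfix _ hc)
        rw [this] at hc
        exact hc hj
      have := (hK.map (Fin.castLE h)).symm
      rw [List.map_map] at this
      exact this
  | cons j js ih =>
    intro K hnd hfix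
    have h1 : rowCoeff (balSeries m * (NCSeries.word (K.map fun j =>
        (Fin.castLE h (σ j), Fin.castLE h j)) * (genMatrix m (Fin.castLE h (σ j)) (Fin.castLE h j) *
        (js.map fun j => (1 - matA0 h : Matrix _ _ _) (σ j) j).prod))) W =
        (if IsBalanced W then 1 else 0) *
          (K.map fun j => lastInd W (Fin.castLE h (σ j), Fin.castLE h j)).prod *
          (lastInd W (Fin.castLE h (σ j), Fin.castLE h j) *
          (js.map fun j => (1 : Matrix _ _ ℂ) (σ j) j -
            lastInd W (Fin.castLE h (σ j), Fin.castLE h j)).prod) := by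
      have := ih (K ++ [j]) (by simpa using hnd) (by simpa using hfix)
      rw [List.map_append, word_append, List.map_append, List.prod_append] at this
      simp only [List.map_singleton, List.prod_singleton] at this
      rw [genMatrix, ← mul_assoc (NCSeries.word _), this]
      ring
    rw [List.map_cons, List.prod_cons, List.map_cons, List.prod_cons, Matrix.sub_apply, sub_mul,
      mul_sub, mul_sub, rowCoeff_sub, sub_mul, mul_sub]
    congr 1
    -- The identity contributes only in a fixed column, which may then be dropped from the list.
    · by_cases hj : σ j = j
      · rw [hj, Matrix.one_apply_eq, Matrix.one_apply_eq, one_mul, one_mul]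
        refine ih K ?_ ?_
        · rw [List.nodup_append] at hnd ⊢
          refine ⟨hnd.1, (List.nodup_cons.1 hnd.2.1).2, fun a ha b hb => hnd.2.2 a ha b (by simp [hb])⟩
        · intro i hi
          by_cases hij : i = j
          · rw [hij, hj]
          · exact hfix i (by simp only [List.mem_append, List.mem_cons] at hi ⊢; tauto)
      · rw [Matrix.one_apply_ne hj, Matrix.one_apply_ne hj]
        simp

/-- Against the sum of all balanced tuples, each variable acts as the indicator of a last letter, so
the noncommutative determinant becomes a numerical one. -/
theorem rowCoeff_bal_mul_det (h : n ≤ m) (W : Fin m → List (Fin m)) :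
    rowCoeff (balSeries m * ncDet (1 - matA0 h)) W =
      (open Classical in if IsBalanced W then 1 else 0) *
        (1 - Matrix.of fun i j => lastInd W (Fin.castLE h i, Fin.castLE h j) :
          Matrix (Fin n) (Fin n) ℂ).det := by
  have key : ∀ σ : Equiv.Perm (Fin n), rowCoeff (balSeries m *
      (List.ofFn fun j : Fin n => (1 - matA0 h : Matrix _ _ _) (σ j) j).prod) W =
      (open Classical in if IsBalanced W then 1 else 0) * ∏ j, ((1 : Matrix _ _ ℂ) (σ j) j -
        lastInd W (Fin.castLE h (σ j), Fin.castLE h j)) := by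
    intro σ
    have := rowCoeff_bal_mul_prod h σ W (List.finRange n) []
      (by simpa using List.nodup_finRange n) (by simp)
    rw [← List.ofFn_eq_map, ← List.ofFn_eq_map, List.prod_ofFn] at this
    have h1 : NCSeries.word ([] : List (Step m)) = 1 := rfl
    simpa [h1] using this
  rw [Matrix.det_apply, ncDet, mul_sum, mul_sum]
  change rowCoeffHom W _ = _
  rw [map_sum]
  refine sum_congr rfl fun σ _ => ?_
  rw [mul_smul_comm, map_zsmul, Units.smul_def, mul_smul_comm]
  congr 1
  exact key σ

/-- The determinant of `1 - L`, where `L` is the adjacency matrix of a partial function. -/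
theorem det_one_sub_functional (P : Fin n → Fin n → Prop) [∀ i j, Decidable (P i j)]
    (hP : ∀ i j k, P i j → P i k → j = k) :
    (1 - Matrix.of fun i j => if P i j then 1 else 0 : Matrix (Fin n) (Fin n) ℂ).det =
      open Classical in
      if ∀ K : Finset (Fin n), K.Nonempty → ∃ i ∈ K, ∀ j ∈ K, ¬ P i j then 1 else 0 := by
  classical
  split_ifs with h
  · rw [Matrix.det_apply, sum_eq_single 1]
    · rw [Equiv.Perm.sign_one, one_smul]
      refine prod_eq_one fun i _ => ?_
      obtain ⟨j, hj, hji⟩ := h {i} (by simp)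
      rw [mem_singleton] at hj
      subst hj
      simp [hji j (by simp)]
    · intro σ _ hσ
      -- Some `i` moved by `σ` has no successor moved by `σ`, so the factor in row `i` and column
      -- `σ⁻¹ i` is zero.
      obtain ⟨i, hi, hi'⟩ := h σ.support (by
        rw [nonempty_iff_ne_empty, Ne, Equiv.Perm.support_eq_empty_iff]; exact hσ)
      have hi2 : σ⁻¹ i ∈ σ.support := by
        rw [Equiv.Perm.mem_support] at hi ⊢
        rw [show σ (σ⁻¹ i) = i from σ.apply_symm_apply i]
        intro h0
        exact hi (by conv_lhs => rw [h0]; exact σ.apply_symm_apply i)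
      have h0 := hi' _ hi2
      rw [prod_eq_zero (mem_univ (σ⁻¹ i)), smul_zero]
      rw [Equiv.Perm.mem_support] at hi2
      rw [Matrix.sub_apply, Matrix.one_apply_ne hi2, show σ (σ⁻¹ i) = i from σ.apply_symm_apply i]
      simpa using h0
    · simp
  · push Not at h
    obtain ⟨K₀, hK₀, hc₀⟩ := h
    -- The union `K` of all sets in which every element has a successor is closed under predecessors
    -- too, so its indicator vector is a nonzero fixed vector of the adjacency matrix.
    let F : Finset (Finset (Fin n)) := univ.filter fun K => ∀ i ∈ K, ∃ j ∈ K, P i j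
    let K : Finset (Fin n) := F.biUnion id
    have hKc : ∀ i ∈ K, ∃ j ∈ K, P i j := by
      intro i hi
      obtain ⟨A, hA, hiA⟩ := mem_biUnion.1 hi
      obtain ⟨j, hj, hij⟩ := (mem_filter.1 hA).2 i hiA
      exact ⟨j, mem_biUnion.2 ⟨A, hA, hj⟩, hij⟩
    have hKm : ∀ i j, P i j → j ∈ K → i ∈ K := by
      intro i j hij hj
      obtain ⟨A, hA, hjA⟩ := mem_biUnion.1 hj
      refine mem_biUnion.2 ⟨insert i A, mem_filter.2 ⟨mem_univ _, ?_⟩, by simp⟩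
      intro a ha
      rcases mem_insert.1 ha with rfl | ha
      · exact ⟨j, by simp [show j ∈ A from hjA], hij⟩
      · obtain ⟨b, hb, hab⟩ := (mem_filter.1 hA).2 a ha
        exact ⟨b, by simp [hb], hab⟩
    rw [← Matrix.exists_mulVec_eq_zero_iff]
    refine ⟨fun i => if i ∈ K then 1 else 0, ?_, ?_⟩
    · obtain ⟨i, hi⟩ := hK₀
      intro h0
      have := congrFun h0 i
      have hiK : i ∈ K := mem_biUnion.2 ⟨K₀, mem_filter.2 ⟨mem_univ _, hc₀⟩, hi⟩
      simp [hiK] at this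
    · funext i
      rw [Matrix.sub_mulVec, Matrix.one_mulVec, Pi.sub_apply, Pi.zero_apply, sub_eq_zero,
        Matrix.mulVec, dotProduct]
      simp only [Matrix.of_apply, mul_ite, mul_one, mul_zero, ← ite_and]
      by_cases hi : i ∈ K
      · obtain ⟨j, hj, hij⟩ := hKc i hi
        rw [if_pos hi, sum_eq_single j]
        · rw [if_pos ⟨hj, hij⟩]
        · intro k _ hk
          rw [if_neg]
          rintro ⟨_, h2⟩
          exact hk (hP _ _ _ h2 hij)
        · simp
      · rw [if_neg hi, sum_eq_zero]
        intro j _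
        rw [if_neg]
        rintro ⟨h1, h2⟩
        exact hi (hKm i j h2 h1)

/-- The map sending a height to the last letter of its row has no cycles below height `n`. -/
def NoLowCycle (n : ℕ) (W : Fin m → List (Fin m)) : Prop :=
  ∀ K : Finset (Fin m), K.Nonempty → (∀ i ∈ K, (i : ℕ) < n) →
    ∃ i ∈ K, ∀ j ∈ K, (W i).getLast? ≠ some j

open Classical in
theorem rowCoeff_bal_mul_det_eq_ite (h : n ≤ m) (W : Fin m → List (Fin m)) :
    rowCoeff (balSeries m * ncDet (1 - matA0 h)) W =
      if IsBalanced W ∧ NoLowCycle n W then 1 else 0 := by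
  rw [rowCoeff_bal_mul_det]
  have := det_one_sub_functional (n := n)
    (fun i j => (W (Fin.castLE h i)).getLast? = some (Fin.castLE h j))
    (fun i j k h1 h2 => Fin.castLE_injective h (by rw [h1] at h2; exact Option.some.inj h2))
  simp only [lastInd]
  rw [this, ite_and]
  have e : NoLowCycle n W ↔ ∀ K : Finset (Fin n), K.Nonempty →
      ∃ i ∈ K, ∀ j ∈ K, ¬ (W (Fin.castLE h i)).getLast? = some (Fin.castLE h j) := by
    constructor
    · intro H K hK
      obtain ⟨i, hi, hi'⟩ := H (K.map (Fin.castLEEmb h)) (by simpa using hK) (by simp)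
      rw [mem_map] at hi
      obtain ⟨i, hi, rfl⟩ := hi
      exact ⟨i, hi, fun j hj => hi' _ (mem_map_of_mem _ hj)⟩
    · intro H K hK hlow
      obtain ⟨i, hi, hi'⟩ := H (univ.filter fun i => Fin.castLE h i ∈ K) (by
        obtain ⟨i, hi⟩ := hK
        exact ⟨⟨i, hlow i hi⟩, by simpa using hi⟩)
      simp only [mem_filter, mem_univ, true_and] at hi hi'
      exact ⟨_, hi, fun j hj => hi' ⟨j, hlow j hj⟩ hj⟩
  rw [if_congr e rfl rfl]
  split_ifs <;> simp

theorem noLowCycle_nil : NoLowCycle n (fun _ : Fin m => ([] : List (Fin m))) := by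
  rintro K ⟨i, hi⟩ -
  exact ⟨i, hi, by simp⟩

/-- In a balanced tuple the last letter of a nonempty row names another nonempty row, so the set of
nonempty rows could never be left. -/
theorem IsBalanced.eq_nil {W : Fin m → List (Fin m)} (hW : IsBalanced W) (h : NoLowCycle m W) :
    W = fun _ => [] := by
  by_contra hne
  obtain ⟨h₀, hh₀⟩ : ∃ h, W h ≠ [] := by
    by_contra! hc; exact hne (funext hc)
  obtain ⟨i, hi, hi'⟩ := h (univ.filter fun h => W h ≠ []) ⟨h₀, by simpa using hh₀⟩ (by simp)
  simp only [mem_filter, mem_univ, true_and] at hi hi'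
  exact hi' _ (hW.ne_nil_of_mem (List.getLast_mem hi)) (List.getLast?_eq_getLast_of_ne_nil hi)

-- MacMahon's master theorem: when all heights are low, only the empty tuple survives.
open Classical in
theorem toCF_bal_mul_det : toCF m (balSeries m) * toCF m (ncDet (1 - matA0 (le_refl m))) = 1 := by
  rw [← map_mul, ← map_one (toCF m), toCF_eq_iff]
  intro W
  rw [rowCoeff_bal_mul_det_eq_ite, rowCoeff_one]
  have : IsBalanced W ∧ NoLowCycle m W ↔ W = fun _ => [] := by
    refine ⟨fun h => h.1.eq_nil h.2, ?_⟩
    rintro rfl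
    exact ⟨isBalanced_nil, noLowCycle_nil⟩
  split_ifs <;> tauto

/-- By Sylvester's identity and the master theorem, the right-hand side is a left inverse of
det(I-C), hence equal to the inverse. -/
theorem toCF_inv_det_one_sub_matC (h : n ≤ m) :
    toCF m (ncDet (1 - matC h)).inv = toCF m (balSeries m * ncDet (1 - matA0 h)) := by
  have h1 := toCF_bal_mul_det (m := m)
  rw [sylvester h, ← mul_assoc, ← map_mul] at h1
  have h2 := congrArg (toCF m) (mul_inv_self (coeff_nil_det_one_sub_matC h))
  rw [map_mul, map_one] at h2
  exact (left_inv_eq_right_inv h1 h2).symm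

open Classical in
theorem rowCoeff_inv_det_one_sub_matC (h : n ≤ m) (W : Fin m → List (Fin m)) :
    rowCoeff (ncDet (1 - matC h)).inv W = if IsBalanced W ∧ NoLowCycle n W then 1 else 0 := by
  rw [toCF_eq_iff.1 (toCF_inv_det_one_sub_matC h) W, rowCoeff_bal_mul_det_eq_ite]

end balanced

/-! ### The disjoint cycle decomposition -/

section cycles

variable {m : ℕ}

/-- A closed path with distinct heights. -/
structure IsCycleWord (u : List (Step m)) : Prop where
  ne_nil : u ≠ []
  nodup : (u.map Prod.fst).Nodup
  perm : (u.map Prod.snd).Perm (u.map Prod.fst)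
  irreducible : ∀ K : Set (Fin m), (∀ s ∈ u, s.1 ∈ K → s.2 ∈ K) → (∃ s ∈ u, s.1 ∈ K) →
    ∀ s ∈ u, s.1 ∈ K

/-- The sequence of steps is a path from `b` to `h`. -/
def IsPath : Fin m → List (Step m) → Fin m → Prop
  | b, [], h => b = h
  | b, s :: t, h => s.1 = b ∧ IsPath s.2 t h

theorem isPath_append {b h : Fin m} {p q : List (Step m)} :
    IsPath b (p ++ q) h ↔ ∃ c, IsPath b p c ∧ IsPath c q h := by
  induction p generalizing b with
  | nil => simp [IsPath]
  | cons s p ih => simp [IsPath, ih, and_assoc]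

theorem IsPath.fst_append {b h : Fin m} {p : List (Step m)} (hp : IsPath b p h) :
    p.map Prod.fst ++ [h] = b :: p.map Prod.snd := by
  induction p generalizing b with
  | nil => simpa [IsPath] using hp.symm
  | cons s p ih => simp [← hp.1, ih hp.2]

theorem IsPath.closed {b h : Fin m} {p : List (Step m)} (hp : IsPath b p h) {K : Set (Fin m)}
    (hK : ∀ s ∈ p, s.1 ∈ K → s.2 ∈ K) (hb : b ∈ K) : h ∈ K ∧ ∀ s ∈ p, s.1 ∈ K := by
  induction p generalizing b with
  | nil => exact ⟨(show b = h from hp) ▸ hb, by simp⟩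
  | cons s p ih =>
    have h1 : s.1 ∈ K := hp.1.symm ▸ hb
    obtain ⟨h2, h3⟩ := ih hp.2 (fun t ht => hK t (by simp [ht])) (hK s (by simp) h1)
    exact ⟨h2, List.forall_mem_cons.2 ⟨h1, h3⟩⟩

theorem IsPath.isCycleWord {b : Fin m} {p : List (Step m)} (hp : IsPath b p b) (hne : p ≠ [])
    (hnd : (p.map Prod.fst).Nodup) : IsCycleWord p where
  ne_nil := hne
  nodup := hnd
  perm := by
    have h1 : (b :: p.map Prod.snd).Perm (b :: p.map Prod.fst) := by
      rw [← hp.fst_append]; exact List.perm_append_singleton _ _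
    exact h1.cons_inv
  irreducible K hK := by
    -- Following the path from `s` to its end brings the base height into `K`, and from there the
    -- whole path lies in `K`.
    rintro ⟨s, hs, hsK⟩
    obtain ⟨q, r, rfl⟩ := List.append_of_mem hs
    obtain ⟨c, hc1, hc2⟩ := isPath_append.1 hp
    obtain rfl : s.1 = c := hc2.1
    have hb := (hc2.closed (fun t ht => hK t (by simp only [List.mem_append]; exact Or.inr ht))
      hsK).1
    exact (hp.closed hK hb).2

theorem rowWord_append_comm {u v : List (Step m)} (h : ∀ s ∈ u, ∀ t ∈ v, s.1 ≠ t.1) :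
    cat (rowWord u) (rowWord v) = cat (rowWord v) (rowWord u) := by
  funext i
  by_cases hu : rowWord u i = []
  · simp [cat, hu]
  · have : rowWord v i = [] := by
      rw [rowWord_eq_nil_iff] at hu ⊢
      push Not at hu
      obtain ⟨s, hs, rfl⟩ := hu
      exact fun t ht => (h s hs t ht).symm
    simp [cat, this]

theorem exists_split_at_height {v : Fin m} {l : List (Step m)} (h : ∃ x ∈ l, x.1 = v) :
    ∃ s q, l = (l.takeWhile fun x => x.1 ≠ v) ++ s :: q ∧ s.1 = v ∧
      (l.dropWhile fun x => x.1 ≠ v) = s :: q ∧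
      ∀ x ∈ l.takeWhile fun x => x.1 ≠ v, x.1 ≠ v := by
  induction l with
  | nil => simp at h
  | cons a l ih =>
    by_cases ha : a.1 = v
    · exact ⟨a, l, by simp [ha], ha, by simp [ha], by simp [ha]⟩
    · obtain ⟨s, q, h1, h2, h3, h4⟩ := ih (by simpa [ha] using h)
      refine ⟨s, q, ?_, h2, ?_, ?_⟩
      · rw [List.takeWhile_cons_of_pos (by simpa using ha), List.cons_append, ← h1]
      · rw [List.dropWhile_cons_of_pos (by simpa using ha), h3]
      · rw [List.takeWhile_cons_of_pos (by simpa using ha)]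
        exact List.forall_mem_cons.2 ⟨ha, h4⟩

/-- The set of facts carried through the decomposition algorithm: the cycles are cycles and the
rows do not change. -/
def DecomposesTo (us : List (List (Step m))) (W : Fin m → List (Fin m)) : Prop :=
  (∀ u ∈ us, IsCycleWord u) ∧ rowWord us.flatten = W

/-- One step of the reading algorithm. If a cycle closes, it is moved in front of the rest of the
prefix; this preserves the rows because the starting heights in the prefix are distinct. -/
theorem cyclesAux_cons {b : Fin m} {pre t : List (Step m)} {s : Step m}
    {W : Fin m → List (Fin m)} (hp : IsPath b pre s.1) (hnd : (pre.map Prod.fst).Nodup)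
    (hs : ∀ x ∈ pre, x.1 ≠ s.1)
    (ih : ∀ pre', IsPath b pre' s.2 → (pre'.map Prod.fst).Nodup → (∀ x ∈ pre', x.1 ≠ s.2) →
      DecomposesTo (cyclesAux pre' t) (cat (rowWord pre') W)) :
    DecomposesTo (cyclesAux pre (s :: t)) (cat (rowWord pre) (cat (rowWord [s]) W)) := by
  have hp' : IsPath b (pre ++ [s]) s.2 := isPath_append.2 ⟨s.1, hp, rfl, rfl⟩
  have hnd' : ((pre ++ [s]).map Prod.fst).Nodup := by
    rw [List.map_append, List.nodup_append]
    refine ⟨hnd, by simp, ?_⟩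
    intro a ha c hc
    obtain ⟨x, hx, rfl⟩ := List.mem_map.1 ha
    simp only [List.map_cons, List.map_nil, List.mem_singleton] at hc
    subst hc
    exact hs x hx
  rw [← cat_assoc, ← rowWord_append, cyclesAux]
  split_ifs with hx
  · obtain ⟨x, q, h1, h2, h3, h4⟩ := exists_split_at_height hx
    set p := (pre ++ [s]).takeWhile fun x => x.1 ≠ s.2 with hpdef
    rw [h3]
    rw [h1] at hp' hnd' ⊢
    obtain ⟨c, hc1, hc2⟩ := isPath_append.1 hp'
    have hc : c = s.2 := by rw [← hc2.1, h2]
    subst hc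
    rw [List.map_append, List.nodup_append] at hnd'
    obtain ⟨ih1, ih2⟩ := ih p hc1 hnd'.1 h4
    refine ⟨List.forall_mem_cons.2 ⟨hc2.isCycleWord (by simp) hnd'.2.1, ih1⟩, ?_⟩
    rw [List.flatten_cons, rowWord_append, ih2, ← cat_assoc, rowWord_append p,
      rowWord_append_comm (u := p)]
    intro y hy z hz
    exact hnd'.2.2 _ (List.mem_map_of_mem hy) _ (List.mem_map_of_mem hz)
  · push Not at hx
    exact ih _ hp' hnd' hx

/-- If no step starts at `h`, the first remaining step is taken, exactly as when restarting from its
own height. -/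
theorem pSeqAux_of_find_none {h : Fin m} {s : Step m} {t : List (Step m)}
    (hf : (s :: t).find? (fun s => s.1 = h) = none) :
    pSeqAux h (s :: t) = pSeqAux s.1 (s :: t) := by
  rw [pSeqAux, pSeqAux, hf]; simp

theorem pSeqAux_of_append {h j : Fin m} {p q : List (Step m)} (hp : ∀ a ∈ p, a.1 ≠ h) :
    pSeqAux h (p ++ (h, j) :: q) = (h, j) :: pSeqAux j (p ++ q) := by
  have hf : (p ++ (h, j) :: q).find? (fun s => s.1 = h) = some (h, j) := by
    rw [List.find?_eq_some_iff_append]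
    exact ⟨by simp, p, q, rfl, by simpa using fun a b hab => hp (a, b) hab⟩
  have he : (p ++ (h, j) :: q).erase (h, j) = p ++ q := by
    rw [List.erase_append_right _ fun hmem => hp _ hmem rfl, List.erase_cons_head]
  obtain ⟨s, t, hst⟩ : ∃ s t, p ++ (h, j) :: q = s :: t := by
    cases p with
    | nil => exact ⟨_, _, rfl⟩
    | cons a p => exact ⟨_, _, rfl⟩
  rw [hst] at hf he ⊢
  rw [pSeqAux, hf]
  simp [he]

/-- Both algorithms are followed at once. The prefix is an open path from the base `b` to the
current height `h`, and the permutation hypothesis says that the remaining steps would be balanced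
together with a step from `b` to `h`'s place: they can lead from `h` back to `b`. -/
theorem decomposesTo_cyclesAux_pSeqAux : ∀ (N : ℕ) (w : List (Step m)), w.length = N →
    ∀ (h b : Fin m) (pre : List (Step m)), IsPath b pre h → (pre.map Prod.fst).Nodup →
    (∀ s ∈ pre, s.1 ≠ h) → (b :: w.map Prod.fst).Perm (h :: w.map Prod.snd) →
    DecomposesTo (cyclesAux pre (pSeqAux h w)) (cat (rowWord pre) (rowWord w)) := by
  intro N
  induction N with
  | zero =>
    intro w hw h b pre hp hnd hpre hperm
    rw [List.length_eq_zero_iff] at hw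
    subst hw
    have hbh : b = h := by simpa using hperm
    subst hbh
    cases pre with
    | cons s t => exact absurd hp.1 (hpre s (by simp))
    | nil => rw [pSeqAux, cyclesAux]; exact ⟨by simp, by simp⟩
  | succ N ih =>
    have main : ∀ (w : List (Step m)), w.length = N + 1 →
        ∀ (h b : Fin m) (pre : List (Step m)), IsPath b pre h → (pre.map Prod.fst).Nodup →
        (∀ s ∈ pre, s.1 ≠ h) → (b :: w.map Prod.fst).Perm (h :: w.map Prod.snd) →
        rowWord w h ≠ [] →
        DecomposesTo (cyclesAux pre (pSeqAux h w)) (cat (rowWord pre) (rowWord w)) := by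
      intro w hw h b pre hp hnd hpre hperm hne
      obtain ⟨j, l, hjl⟩ := List.exists_cons_of_ne_nil hne
      obtain ⟨p, q, rfl, hpq⟩ := exists_first_step hjl
      rw [pSeqAux_of_append hpq, rowWord_move _ _ _ hpq]
      have : rowWord ((h, j) :: (p ++ q)) = cat (rowWord [(h, j)]) (rowWord (p ++ q)) :=
        rowWord_append [(h, j)] (p ++ q)
      rw [this]
      refine cyclesAux_cons (s := (h, j)) hp hnd hpre fun pre' h1 h2 h3 => ?_
      refine ih _ (by simp at hw ⊢; omega) _ b _ h1 h2 h3 ?_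
      have e1 : (h :: b :: (p ++ q).map Prod.fst).Perm (h :: j :: (p ++ q).map Prod.snd) := by
        refine (List.Perm.swap b h _).trans ?_
        simp only [List.map_append, List.map_cons] at hperm ⊢
        refine (List.Perm.cons b List.perm_middle.symm).trans (hperm.trans ?_)
        exact List.Perm.cons h List.perm_middle
      exact e1.cons_inv
    intro w hw h b pre hp hnd hpre hperm
    by_cases hne : rowWord w h = []
    -- If no step starts at `h`, then counting forces `h = b`. A nonempty prefix would start at `b`,
    -- but its heights differ from `h`; so it is empty, and the path restarts at a new base.
    · rw [rowWord_eq_nil_iff] at hne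
      have hbh : h = b := by
        have : h ∈ b :: w.map Prod.fst := hperm.symm.subset (by simp)
        rcases List.mem_cons.1 this with h1 | h1
        · exact h1
        · obtain ⟨s, hs, h2⟩ := List.mem_map.1 h1
          exact absurd h2 (hne s hs)
      subst hbh
      cases pre with
      | cons s t => exact absurd hp.1 (hpre s (by simp))
      | nil =>
        obtain ⟨s, t, rfl⟩ : ∃ s t, w = s :: t := List.exists_cons_of_ne_nil (by
          rintro rfl; simp at hw)
        rw [pSeqAux_of_find_none (by simpa [List.find?_eq_none] using hne)]
        refine main _ hw s.1 s.1 [] rfl (by simp) (by simp) (List.Perm.cons _ hperm.cons_inv) ?_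
        rw [rowWord_cons]; simp
    · exact main w hw h b pre hp hnd hpre hperm hne

theorem map_fst_oSeq (μ : List (Fin m)) : (oSeq μ).map Prod.fst = μ.insertionSort (· ≤ ·) := by
  rw [oSeq, List.map_fst_zip]; simp

theorem map_snd_oSeq (μ : List (Fin m)) : (oSeq μ).map Prod.snd = μ := by
  rw [oSeq, List.map_snd_zip]; simp

theorem isBalanced_oSeq (μ : List (Fin m)) : IsBalanced (rowWord (oSeq μ)) := by
  rw [isBalanced_rowWord_iff, map_fst_oSeq, map_snd_oSeq]
  exact (List.perm_insertionSort _ _).symm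

theorem decomposesTo_cycleDecomp (μ : List (Fin m)) :
    DecomposesTo (cycleDecomp (oSeq μ)) (rowWord (oSeq μ)) := by
  have hb := isBalanced_rowWord_iff.1 (isBalanced_oSeq μ)
  rw [cycleDecomp]
  cases h : oSeq μ with
  | nil => rw [pSeq, cyclesAux]; exact ⟨by simp, by simp⟩
  | cons s t =>
    rw [h] at hb
    have := decomposesTo_cyclesAux_pSeqAux _ (s :: t) rfl s.1 s.1 [] rfl (by simp) (by simp)
      (hb.symm.cons _)
    simpa [pSeq] using this

/-- Sequences with nondecreasing starting heights are determined by their rows. -/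
theorem eq_of_rowWord_eq_of_sorted : ∀ {v w : List (Step m)},
    (v.map Prod.fst).Pairwise (· ≤ ·) → (w.map Prod.fst).Pairwise (· ≤ ·) →
    rowWord v = rowWord w → v = w := by
  intro v
  induction v with
  | nil => intro w _ _ h; exact (rowWord_eq_nil h.symm).symm
  | cons s v ih =>
    intro w hv hw h
    cases w with
    | nil => exact absurd (rowWord_eq_nil h) (by simp)
    | cons t w =>
      -- The first step of one word occurs in the other, whose first step has the smallest starting
      -- height.
      have key : ∀ {a b : Step m} {x y : List (Step m)},
          ((b :: y).map Prod.fst).Pairwise (· ≤ ·) →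
          rowWord (a :: x) = rowWord (b :: y) → b.1 ≤ a.1 := by
        intro a b x y hy hab
        have h1 := (rowWord_mem_iff (b :: y) a.1 a.2).1 (by rw [← hab, rowWord_cons]; simp)
        rcases List.mem_cons.1 h1 with h2 | h2
        · rw [← h2]
        · rw [List.map_cons, List.pairwise_cons] at hy
          exact hy.1 _ (List.mem_map_of_mem (f := Prod.fst) h2)
      have hst : s.1 = t.1 := le_antisymm (key hv h.symm) (key hw h)
      have h0 := congrFun h s.1
      rw [rowWord_cons, rowWord_cons, if_pos rfl, if_pos hst.symm] at h0
      have hst' : s = t := Prod.ext hst (List.cons.inj h0).1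
      subst hst'
      have hvw : rowWord v = rowWord w := by
        funext i
        have := congrFun h i
        rw [rowWord_cons, rowWord_cons] at this
        split_ifs at this <;> simpa using this
      rw [List.map_cons, List.pairwise_cons] at hv hw
      rw [ih hv.2 hw.2 hvw]

theorem rowWord_oSeq_injective : Function.Injective fun μ : List (Fin m) => rowWord (oSeq μ) := by
  intro μ ν h
  have := eq_of_rowWord_eq_of_sorted
    (by rw [map_fst_oSeq]; exact List.pairwise_insertionSort _ _)
    (by rw [map_fst_oSeq]; exact List.pairwise_insertionSort _ _) h
  rw [← map_snd_oSeq μ, this, map_snd_oSeq]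

/-- In the normal word of a balanced tuple, the starting heights are the sorted ends, so it is an
o-sequence. -/
theorem exists_rowWord_oSeq {W : Fin m → List (Fin m)} (hW : IsBalanced W) :
    ∃ μ, rowWord (oSeq μ) = W := by
  refine ⟨(normalWord W).map Prod.snd, ?_⟩
  have hs : ((normalWord W).map Prod.fst).Pairwise (· ≤ ·) := by
    rw [normalWord, List.map_flatMap, List.pairwise_flatMap]
    refine ⟨fun h _ => ?_, (List.pairwise_lt_finRange m).imp fun {a b} hab x hx y hy => ?_⟩
    · rw [List.map_map]
      exact List.pairwise_map.2 (List.pairwise_of_forall fun _ _ => le_rfl)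
    · simp only [List.map_map, List.mem_map, Function.comp] at hx hy
      obtain ⟨_, _, rfl⟩ := hx
      obtain ⟨_, _, rfl⟩ := hy
      exact hab.le
  have hp : ((normalWord W).map Prod.snd).Perm ((normalWord W).map Prod.fst) := by
    rw [← isBalanced_rowWord_iff, rowWord_normalWord]; exact hW
  have h1 : ((normalWord W).map Prod.snd).insertionSort (· ≤ ·) = (normalWord W).map Prod.fst :=
    List.Perm.eq_of_pairwise' (List.pairwise_insertionSort _ _) hs
      ((List.perm_insertionSort _ _).trans hp)
  rw [oSeq, h1, List.zip_map', List.map_id']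
  exact rowWord_normalWord W

/-- Each row fibre contains at most one o-sequence, so the row coefficient is a single coefficient.
-/
theorem rowCoeff_betaSeries_oSeq (n : ℕ) (β : ℂ) (μ : List (Fin m)) :
    rowCoeff (betaSeries m n β) (rowWord (oSeq μ)) = betaCoeff n μ β := by
  classical
  have h : ∀ w ∈ rowFiber (rowWord (oSeq μ)), (betaSeries m n β).coeff w =
      if w = oSeq μ then betaCoeff n μ β else 0 := by
    intro w hw
    rw [mem_rowFiber] at hw
    change ∑ᶠ ν : List (Fin m), (betaCoeff n ν β • NCSeries.word (oSeq ν)).coeff w = _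
    rw [finsum_eq_single _ μ]
    · simp [NCSeries.coeff_word]
    · intro ν hν
      rw [NCSeries.coeff_smul, NCSeries.coeff_word, if_neg, mul_zero]
      rintro rfl
      exact hν (rowWord_oSeq_injective hw)
  rw [rowCoeff, sum_congr rfl h]
  simp

theorem rowCoeff_betaSeries_of_not_isBalanced (n : ℕ) (β : ℂ) {W : Fin m → List (Fin m)}
    (hW : ¬ IsBalanced W) : rowCoeff (betaSeries m n β) W = 0 := by
  classical
  refine sum_eq_zero fun w hw => ?_
  rw [mem_rowFiber] at hw
  change ∑ᶠ ν : List (Fin m), (betaCoeff n ν β • NCSeries.word (oSeq ν)).coeff w = _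
  refine finsum_eq_zero_of_forall_eq_zero fun ν => ?_
  rw [NCSeries.coeff_smul, NCSeries.coeff_word, if_neg, mul_zero]
  rintro rfl
  exact hW (hw ▸ isBalanced_oSeq ν)

end cycles

/-! ### Factorizations of products of cycles -/

section factor

variable {m k n : ℕ}

/-- The rows of the product of the cycles with indices in the list `l`. -/
def rowsOf (u : Fin k → List (Step m)) (l : List (Fin k)) : Fin m → List (Fin m) :=
  rowWord (l.flatMap u)

/-- The rows of the product of the cycles with indices in `I`, in increasing order. -/
def rowsOn (u : Fin k → List (Step m)) (I : Finset (Fin k)) : Fin m → List (Fin m) :=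
  rowsOf u ((List.finRange k).filter (· ∈ I))

variable (u : Fin k → List (Step m))

theorem rowsOf_nil : rowsOf u [] = fun _ => [] := rfl

theorem rowsOf_cons (i : Fin k) (l : List (Fin k)) :
    rowsOf u (i :: l) = cat (rowWord (u i)) (rowsOf u l) := by
  rw [rowsOf, List.flatMap_cons, rowWord_append]; rfl

theorem rowsOf_append (l l' : List (Fin k)) :
    rowsOf u (l ++ l') = cat (rowsOf u l) (rowsOf u l') := by
  rw [rowsOf, List.flatMap_append, rowWord_append]; rfl

variable {u}

theorem rowsOf_eq_nil_iff {l : List (Fin k)} {h : Fin m} :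
    rowsOf u l h = [] ↔ ∀ i ∈ l, ∀ s ∈ u i, s.1 ≠ h := by
  rw [rowsOf, rowWord_eq_nil_iff]
  constructor
  · intro H i hi s hs
    exact H s (List.mem_flatMap.2 ⟨i, hi, hs⟩)
  · intro H s hs
    obtain ⟨i, hi, hs⟩ := List.mem_flatMap.1 hs
    exact H i hi s hs

theorem DisjointCycles.symm {v w : List (Step m)} (h : DisjointCycles v w) : DisjointCycles w v :=
  fun s hs t ht => (h t ht s hs).symm

theorem isBalanced_rowsOf (hu : ∀ i, IsCycleWord (u i)) (l : List (Fin k)) :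
    IsBalanced (rowsOf u l) := by
  induction l with
  | nil => exact isBalanced_nil
  | cons i l ih => rw [rowsOf_cons]; exact (isBalanced_rowWord_iff.2 (hu i).perm).cat ih

/-- The set `D` is closed under passing to earlier cycles in `l` that are not disjoint. -/
def LowerOn (u : Fin k → List (Step m)) (l : List (Fin k)) (D : Finset (Fin k)) : Prop :=
  l.Pairwise fun i j => ¬ DisjointCycles (u i) (u j) → j ∈ D → i ∈ D

theorem LowerOn.disjoint {i : Fin k} {l : List (Fin k)} {D : Finset (Fin k)}
    (h : LowerOn u (i :: l) D) (hi : i ∉ D) : ∀ j ∈ l, j ∈ D → DisjointCycles (u i) (u j) := by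
  intro j hj hjD
  by_contra hc
  exact hi ((List.pairwise_cons.1 h).1 j hj hc hjD)

/-- Bringing the cycles of a down-closed set to the front only moves them past disjoint ones. -/
theorem rowsOf_eq_cat_filter {l : List (Fin k)} {D : Finset (Fin k)} (h : LowerOn u l D) :
    rowsOf u l = cat (rowsOf u (l.filter (· ∈ D))) (rowsOf u (l.filter (· ∉ D))) := by
  induction l with
  | nil => rw [List.filter_nil, List.filter_nil, rowsOf_nil, cat_nil]
  | cons i l ih =>
    have ih' := ih (List.pairwise_cons.1 h).2
    by_cases hi : i ∈ D
    · rw [List.filter_cons_of_pos (by simpa using hi), List.filter_cons_of_neg (by simpa using hi),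
        rowsOf_cons, rowsOf_cons, ih', cat_assoc]
    · rw [List.filter_cons_of_neg (by simpa using hi), List.filter_cons_of_pos (by simpa using hi),
        rowsOf_cons, rowsOf_cons, ih', ← cat_assoc, ← cat_assoc]
      congr 1
      refine rowWord_append_comm fun s hs t ht => ?_
      obtain ⟨j, hj, ht⟩ := List.mem_flatMap.1 ht
      rw [List.mem_filter] at hj
      exact h.disjoint hi j hj.1 (by simpa using hj.2) s hs t ht

/-- Membership of the first cycle can be read off the product: if it is not in the set, then no
cycle of the set meets its heights, so the rows at these heights are empty. -/
theorem LowerOn.rowsOf_injective (hu : ∀ i, IsCycleWord (u i)) {l : List (Fin k)}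
    {D D' : Finset (Fin k)} (h : LowerOn u l D) (h' : LowerOn u l D')
    (he : rowsOf u (l.filter (· ∈ D)) = rowsOf u (l.filter (· ∈ D'))) :
    ∀ i ∈ l, i ∈ D ↔ i ∈ D' := by
  induction l with
  | nil => simp
  | cons i l ih =>
    obtain ⟨s, hs⟩ := List.exists_mem_of_ne_nil _ (hu i).ne_nil
    have key : ∀ {A : Finset (Fin k)}, LowerOn u (i :: l) A →
        (i ∈ A ↔ rowsOf u ((i :: l).filter (· ∈ A)) s.1 ≠ []) := by
      intro A hA
      rw [Ne, rowsOf_eq_nil_iff]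
      constructor
      · intro hi H
        exact H i (by simp [hi]) s hs rfl
      · intro H
        by_contra hi
        refine H fun j hj t ht hts => ?_
        rw [List.filter_cons_of_neg (by simpa using hi), List.mem_filter] at hj
        exact hA.disjoint hi j hj.1 (by simpa using hj.2) s hs t ht hts.symm
    have hi : i ∈ D ↔ i ∈ D' := by rw [key h, key h', he]
    refine List.forall_mem_cons.2 ⟨hi, ih (List.pairwise_cons.1 h).2 (List.pairwise_cons.1 h').2 ?_⟩
    by_cases hD : i ∈ D
    · have hD' := hi.1 hD
      rw [List.filter_cons_of_pos (by simpa using hD), List.filter_cons_of_pos (by simpa using hD'),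
        rowsOf_cons, rowsOf_cons] at he
      exact cat_left_cancel he
    · have hD' := fun h => hD (hi.2 h)
      rwa [List.filter_cons_of_neg (by simpa using hD),
        List.filter_cons_of_neg (by simpa using hD')] at he

/-- The first cycle cannot be shared by the two factors: it belongs entirely to `X` or entirely to
`Y`. It can then be cancelled. -/
theorem exists_lowerOn_of_cat_eq (hu : ∀ i, IsCycleWord (u i)) : ∀ {l : List (Fin k)}, l.Nodup →
    ∀ {X Y : Fin m → List (Fin m)}, cat X Y = rowsOf u l → IsBalanced X →
    ∃ D, LowerOn u l D ∧ rowsOf u (l.filter (· ∈ D)) = X ∧ rowsOf u (l.filter (· ∉ D)) = Y := by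
  intro l
  induction l with
  | nil =>
    intro _ X Y h _
    refine ⟨∅, List.Pairwise.nil, ?_, ?_⟩
    · funext i
      have := congrFun h i
      simp only [cat, rowsOf_nil, List.append_eq_nil_iff] at this
      simp [rowsOf_nil, this.1]
    · funext i
      have := congrFun h i
      simp only [cat, rowsOf_nil, List.append_eq_nil_iff] at this
      simp [rowsOf_nil, this.2]
  | cons i l ih =>
    intro hnd X Y h hX
    rw [List.nodup_cons] at hnd
    rw [rowsOf_cons] at h
    have hfil : ∀ {D D' : Finset (Fin k)}, (∀ j, j ≠ i → (j ∈ D ↔ j ∈ D')) →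
        l.filter (· ∈ D) = l.filter (· ∈ D') ∧ l.filter (· ∉ D) = l.filter (· ∉ D') := by
      intro D D' hDD
      constructor <;>
      · refine List.filter_congr fun j hj => ?_
        have : j ≠ i := fun hji => hnd.1 (hji ▸ hj)
        simp [hDD j this]
    have hrow : ∀ {h : Fin m}, rowWord (u i) h ≠ [] →
        ∃ s ∈ u i, s.1 = h ∧ rowWord (u i) h = [s.2] := by
      intro h hh
      rw [Ne, rowWord_eq_nil_iff] at hh
      push Not at hh
      obtain ⟨s, hs, rfl⟩ := hh
      exact ⟨s, hs, rfl, rowWord_eq_singleton (hu i).nodup hs⟩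
    by_cases hA : ∃ s ∈ u i, X s.1 ≠ []
    -- Where `X` is nonempty on the first cycle, its row begins with the step of this cycle. As `X`
    -- is balanced, it is also nonempty at the end of that step, and by irreducibility along the
    -- entire cycle.
    · have hhead : ∀ s ∈ u i, X s.1 ≠ [] → ∃ x, X s.1 = [s.2] ++ x := by
        intro s hs hne
        obtain ⟨a, x, hax⟩ := List.exists_cons_of_ne_nil hne
        have := congrFun h s.1
        rw [cat, cat, hax, rowWord_eq_singleton (hu i).nodup hs] at this
        simp only [List.cons_append, List.cons.injEq] at this
        exact ⟨x, by rw [hax, this.1]; rfl⟩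
      have hall := (hu i).irreducible {h | X h ≠ []} (fun s hs hne => by
        obtain ⟨x, hx⟩ := hhead s hs hne
        exact hX.ne_nil_of_mem (h := s.1) (by rw [hx]; simp)) hA
      have hex : ∀ h, ∃ x, X h = rowWord (u i) h ++ x := by
        intro h
        by_cases hh : rowWord (u i) h = []
        · exact ⟨X h, by simp [hh]⟩
        · obtain ⟨s, hs, rfl, h2⟩ := hrow hh
          rw [h2]
          exact hhead s hs (hall s hs)
      choose X' hX' using hex
      obtain rfl : X = cat (rowWord (u i)) X' := funext hX'
      rw [cat_assoc] at h
      obtain ⟨D, h1, h2, h3⟩ := ih hnd.2 (cat_left_cancel h)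
        (IsBalanced.of_cat_left (isBalanced_rowWord_iff.2 (hu i).perm) hX)
      have hf := hfil (D := D) (D' := insert i D) (fun j hj => by simp [hj])
      refine ⟨insert i D, List.pairwise_cons.2 ⟨fun _ _ _ _ => mem_insert_self _ _, ?_⟩, ?_, ?_⟩
      · refine h1.imp_of_mem fun {a b} _ hb hab hR hbD => ?_
        have hbi : b ≠ i := fun hbi => hnd.1 (hbi ▸ hb)
        exact mem_insert_of_mem (hab hR ((mem_insert.1 hbD).resolve_left hbi))
      · rw [List.filter_cons_of_pos (by simp), ← hf.1, rowsOf_cons, h2]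
      · rw [List.filter_cons_of_neg (by simp), ← hf.2, h3]
    -- Here `X` avoids the heights of the first cycle, so the cycle is a left factor of `Y` and
    -- commutes with `X`.
    · push Not at hA
      have hex : ∀ h, ∃ y, Y h = rowWord (u i) h ++ y := by
        intro j
        by_cases hh : rowWord (u i) j = []
        · exact ⟨Y j, by simp [hh]⟩
        · obtain ⟨s, hs, rfl, h2⟩ := hrow hh
          have := congrFun h s.1
          rw [cat, cat, hA s hs, List.nil_append] at this
          exact ⟨_, this⟩
      choose Y' hY' using hex
      obtain rfl : Y = cat (rowWord (u i)) Y' := funext hY'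
      have hc : cat X (rowWord (u i)) = cat (rowWord (u i)) X := by
        funext j
        by_cases hh : rowWord (u i) j = []
        · simp [cat, hh]
        · obtain ⟨s, hs, rfl, h2⟩ := hrow hh
          simp [cat, hA s hs]
      rw [← cat_assoc, hc, cat_assoc] at h
      obtain ⟨D, h1, h2, h3⟩ := ih hnd.2 (cat_left_cancel h) hX
      have hf := hfil (D := D) (D' := D.erase i) (fun j hj => by simp [hj])
      refine ⟨D.erase i, List.pairwise_cons.2 ⟨fun j hj hR hjD => ?_, ?_⟩, ?_, ?_⟩
      · exfalso
        rw [DisjointCycles] at hR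
        push Not at hR
        obtain ⟨s, hs, t, ht, hst⟩ := hR
        have h0 := hA s hs
        rw [← h2, rowsOf_eq_nil_iff] at h0
        exact h0 j (List.mem_filter.2 ⟨hj, by simpa using mem_of_mem_erase hjD⟩) t ht hst.symm
      · refine h1.imp_of_mem fun {a b} ha _ hab hR hbD => ?_
        exact mem_erase.2 ⟨fun hai => hnd.1 (hai ▸ ha), hab hR (mem_of_mem_erase hbD)⟩
      · rw [List.filter_cons_of_neg (by simp), ← hf.1, h2]
      · rw [List.filter_cons_of_pos (by simp), ← hf.2, rowsOf_cons, h3]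

/-- The set `D` is closed under passing to earlier elements of `I` whose cycles are not
disjoint. -/
def IsLowerIn (u : Fin k → List (Step m)) (I D : Finset (Fin k)) : Prop :=
  ∀ i ∈ I, ∀ j ∈ D, i < j → ¬ DisjointCycles (u i) (u j) → i ∈ D

theorem lowerOn_iff {I D : Finset (Fin k)} (hD : D ⊆ I) :
    LowerOn u ((List.finRange k).filter (· ∈ I)) D ↔ IsLowerIn u I D := by
  rw [LowerOn, List.pairwise_filter]
  constructor
  · intro H i hi j hj hij hR
    have : [i, j].Sublist (List.finRange k) := by
      have h1 := List.pairwise_lt_finRange k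
      refine List.sublist_of_subperm_of_pairwise (r := (· < ·)) ?_ (by simpa using hij) h1
      exact List.subperm_of_subset (by simpa using hij.ne) (by simp)
    have := H.sublist this
    simp only [List.pairwise_cons, List.mem_singleton, decide_eq_true_eq] at this
    exact this.1 j rfl hi (hD hj) hR hj
  · intro H
    refine (List.pairwise_lt_finRange k).imp fun {i j} hij hi hj hR hjD => ?_
    exact H i (by simpa using hi) j hjD hij hR

theorem rowsOn_filter_mem {I D : Finset (Fin k)} (hD : D ⊆ I) :
    rowsOf u (((List.finRange k).filter (· ∈ I)).filter (· ∈ D)) = rowsOn u D := by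
  rw [rowsOn, List.filter_filter]
  congr 1
  refine List.filter_congr fun i _ => ?_
  have := @hD i
  by_cases h : i ∈ D <;> simp [h]
  exact this h

theorem rowsOn_filter_not_mem (I D : Finset (Fin k)) :
    rowsOf u (((List.finRange k).filter (· ∈ I)).filter (· ∉ D)) = rowsOn u (I \ D) := by
  rw [rowsOn, List.filter_filter]
  congr 1
  refine List.filter_congr fun i _ => ?_
  simp [Bool.and_comm]

-- Down-closed sets parametrize the factorizations with balanced left factor, to which the sum is
-- restricted by the support of `F`.
open Classical in
theorem sum_splits_rowsOn (hu : ∀ i, IsCycleWord (u i)) (I : Finset (Fin k))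
    (F : (Fin m → List (Fin m)) → (Fin m → List (Fin m)) → ℂ)
    (hF : ∀ X Y, cat X Y = rowsOn u I → F X Y ≠ 0 → IsBalanced X) :
    ∑ p ∈ splits (rowsOn u I), F p.1 p.2 =
      ∑ D ∈ I.powerset with IsLowerIn u I D, F (rowsOn u D) (rowsOn u (I \ D)) := by
  symm
  refine sum_of_injOn (fun D => (rowsOn u D, rowsOn u (I \ D))) ?_ ?_ ?_ fun _ _ => rfl
  · intro D hD D' hD' h
    simp only [coe_filter, mem_powerset, Set.mem_ofPred_eq] at hD hD'
    have h1 : rowsOn u D = rowsOn u D' := congrArg Prod.fst h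
    rw [← rowsOn_filter_mem hD.1, ← rowsOn_filter_mem hD'.1] at h1
    have h2 := ((lowerOn_iff hD.1).2 hD.2).rowsOf_injective hu ((lowerOn_iff hD'.1).2 hD'.2) h1
    ext i
    by_cases hi : i ∈ I
    · exact h2 i (by simpa using hi)
    · exact ⟨fun h => absurd (hD.1 h) hi, fun h => absurd (hD'.1 h) hi⟩
  · intro D hD
    simp only [coe_filter, mem_powerset, Set.mem_ofPred_eq] at hD
    rw [mem_coe, mem_splits]
    simp only
    rw [← rowsOn_filter_mem hD.1, ← rowsOn_filter_not_mem]
    exact (rowsOf_eq_cat_filter ((lowerOn_iff hD.1).2 hD.2)).symm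
  · rintro ⟨X, Y⟩ hp hne
    rw [mem_splits] at hp
    by_contra hF0
    obtain ⟨D, h1, h2, h3⟩ := exists_lowerOn_of_cat_eq hu
      ((List.nodup_finRange k).filter _) hp (hF X Y hp hF0)
    -- Indices of `D` outside `I` do not affect the factors and are discarded.
    refine hne ⟨I ∩ D, ?_, ?_⟩
    · simp only [coe_filter, mem_powerset, Set.mem_ofPred_eq]
      refine ⟨inter_subset_left, (lowerOn_iff inter_subset_left).1 ?_⟩
      refine h1.imp_of_mem fun {a b} ha _ hab hR hb => ?_
      exact mem_inter.2 ⟨by simpa using ha, hab hR (mem_inter.1 hb).2⟩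
    · have e1 : I \ (I ∩ D) = I \ D := by ext; simp
      refine Prod.ext ?_ (by simp only [e1]; rw [← rowsOn_filter_not_mem, h3])
      change rowsOn u (I ∩ D) = X
      rw [← rowsOn_filter_mem (I := I) inter_subset_left, ← show _ = X from h2]
      congr 1
      refine List.filter_congr fun i hi => ?_
      have : i ∈ I := by simpa using hi
      simp [this]

theorem rowsOn_eq_nil_iff (hu : ∀ i, IsCycleWord (u i)) {I : Finset (Fin k)} :
    (rowsOn u I = fun _ => []) ↔ I = ∅ := by
  constructor
  · intro h
    rw [eq_empty_iff_forall_notMem]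
    intro i hi
    obtain ⟨s, hs⟩ := List.exists_mem_of_ne_nil _ (hu i).ne_nil
    have := congrFun h s.1
    rw [rowsOn, rowsOf_eq_nil_iff] at this
    exact this i (by simpa using hi) s hs rfl
  · rintro rfl
    funext h
    rw [rowsOn, rowsOf_eq_nil_iff]; simp

theorem rowsOn_apply_split {I : Finset (Fin k)} {j : Fin k} (hj : j ∈ I) {h : Fin m}
    (hlast : ∀ i ∈ I, j < i → ∀ s ∈ u i, s.1 ≠ h) :
    ∃ l, rowsOn u I h = l ++ rowWord (u j) h := by
  have hmem : j ∈ (List.finRange k).filter (· ∈ I) := by simpa using hj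
  have hsort := (List.pairwise_lt_finRange k).filter (· ∈ I)
  obtain ⟨l₁, l₂, hl⟩ := List.append_of_mem hmem
  rw [rowsOn]
  have hI : ∀ i ∈ l₂, i ∈ I := fun i hi => by
    have : i ∈ (List.finRange k).filter (· ∈ I) := by rw [hl]; simp [hi]
    simpa using this
  rw [hl] at hsort ⊢
  rw [List.pairwise_append] at hsort
  have h2 : rowsOf u l₂ h = [] := by
    rw [rowsOf_eq_nil_iff]
    intro i hi
    exact hlast i (hI i hi) ((List.pairwise_cons.1 hsort.2.1).1 i hi)
  refine ⟨rowsOf u l₁ h, ?_⟩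
  rw [rowsOf_append, rowsOf_cons, cat, cat, h2, List.append_nil]

theorem getLast?_rowsOn (hu : ∀ i, IsCycleWord (u i)) {I : Finset (Fin k)} {j : Fin k}
    (hj : j ∈ I) {s : Step m} (hs : s ∈ u j)
    (hlast : ∀ i ∈ I, j < i → ∀ t ∈ u i, t.1 ≠ s.1) : (rowsOn u I s.1).getLast? = some s.2 := by
  obtain ⟨l, hl⟩ := rowsOn_apply_split hj hlast
  rw [hl, rowWord_eq_singleton (hu j).nodup hs]
  simp

/-- A low cycle met by no later one stands at the ends of its rows and is a cycle of the last-letter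
map. Conversely, if the last-letter map sends a low set K to itself, the last cycle meeting K lies
inside K; it is low, and no later cycle meets it. -/
theorem noLowCycle_rowsOn_iff (hu : ∀ i, IsCycleWord (u i)) {I : Finset (Fin k)} :
    NoLowCycle n (rowsOn u I) ↔
      ∀ i ∈ I, ¬ IsHigh n (u i) → ∃ j ∈ I, i < j ∧ ¬ DisjointCycles (u i) (u j) := by
  classical
  constructor
  · intro H i hi hlow
    by_contra! hc
    obtain ⟨h, hh, hh'⟩ := H ((u i).map Prod.fst).toFinset
      (by
        obtain ⟨s, hs⟩ := List.exists_mem_of_ne_nil _ (hu i).ne_nil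
        exact ⟨s.1, by simpa using ⟨s.2, hs⟩⟩)
      (by
        intro h hh
        rw [List.mem_toFinset, List.mem_map] at hh
        obtain ⟨s, hs, rfl⟩ := hh
        by_contra hsn
        exact hlow ⟨s, hs, not_lt.1 hsn⟩)
    rw [List.mem_toFinset, List.mem_map] at hh
    obtain ⟨s, hs, rfl⟩ := hh
    refine hh' s.2 ?_ (getLast?_rowsOn hu hi hs fun j hj hij t ht => ?_)
    · rw [List.mem_toFinset]
      exact (hu i).perm.subset (List.mem_map_of_mem hs)
    · exact (hc j hj hij s hs t ht).symm
  · intro H K hK hlow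
    by_contra! hc
    have hmeet : ∀ h ∈ K, ∃ i ∈ I, ∃ s ∈ u i, s.1 = h := by
      intro h hh
      by_contra! hne
      obtain ⟨j, _, hj⟩ := hc h hh
      have : rowsOn u I h = [] := by
        rw [rowsOn, rowsOf_eq_nil_iff]
        intro i hi
        exact hne i (by simpa using hi)
      rw [this] at hj
      simp at hj
    obtain ⟨h₀, hh₀⟩ := hK
    obtain ⟨i₀, hi₀, s₀, hs₀, hs₀'⟩ := hmeet h₀ hh₀
    obtain ⟨j, hj, hmax⟩ := (I.filter fun i => ∃ s ∈ u i, s.1 ∈ K).exists_max_image id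
      ⟨i₀, mem_filter.2 ⟨hi₀, s₀, hs₀, hs₀' ▸ hh₀⟩⟩
    rw [mem_filter] at hj
    have hlast : ∀ i ∈ I, j < i → ∀ t ∈ u i, t.1 ∉ K := by
      intro i hi hji t ht htK
      exact absurd (hmax i (mem_filter.2 ⟨hi, t, ht, htK⟩)) (not_le.2 hji)
    have hall := (hu j).irreducible (K : Set (Fin m)) (fun s hs hsK => by
      obtain ⟨x, hx, hx'⟩ := hc s.1 hsK
      rw [getLast?_rowsOn hu hj.1 hs fun i hi hji t ht hts =>
        hlast i hi hji t ht (by rw [hts]; exact hsK)] at hx'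
      rw [Option.some.inj hx']
      exact hx) hj.2
    obtain ⟨i, hi, hji, hR⟩ := H j hj.1 fun ⟨s, hs, hsn⟩ => absurd (hlow _ (hall s hs)) (not_lt.2 hsn)
    rw [DisjointCycles] at hR
    push Not at hR
    obtain ⟨s, hs, t, ht, hst⟩ := hR
    exact hlast i hi hji t ht (hst ▸ hall s hs)

end factor

/-! ### Good maps and the powers of S - 1 -/

section goodMaps

variable {m k : ℕ}

/-- The function `f` maps `I` onto `{1, …, s}`, it respects the order of non-disjoint cycles, and the
maximal elements of every fibre are high. -/
def IsGoodMap (n : ℕ) (u : Fin k → List (Step m)) (s : ℕ) (I : Finset (Fin k)) (f : Fin k → ℕ) :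
    Prop :=
  (∀ i ∈ I, ∀ j ∈ I, i < j → ¬ DisjointCycles (u i) (u j) → f i ≤ f j) ∧
  (∀ i ∈ I, ¬ IsHigh n (u i) → ∃ j ∈ I, i < j ∧ ¬ DisjointCycles (u i) (u j) ∧ f j = f i) ∧
  (∀ v, 1 ≤ v → v ≤ s → ∃ i ∈ I, f i = v)

open Classical in
/-- The good maps of `I` onto `{1, …, s}`, extended by zero to all indices. -/
def goodMaps (n : ℕ) (u : Fin k → List (Step m)) (s : ℕ) (I : Finset (Fin k)) :
    Finset (Fin k → ℕ) :=
  (Fintype.piFinset fun i => if i ∈ I then Icc 1 s else {0}).filter (IsGoodMap n u s I)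

variable {n : ℕ} {u : Fin k → List (Step m)}

theorem mem_goodMaps {s : ℕ} {I : Finset (Fin k)} {f : Fin k → ℕ} :
    f ∈ goodMaps n u s I ↔ (∀ i ∈ I, 1 ≤ f i ∧ f i ≤ s) ∧ (∀ i, i ∉ I → f i = 0) ∧
    (∀ i ∈ I, ∀ j ∈ I, i < j → ¬ DisjointCycles (u i) (u j) → f i ≤ f j) ∧
    (∀ i ∈ I, ¬ IsHigh n (u i) → ∃ j ∈ I, i < j ∧ ¬ DisjointCycles (u i) (u j) ∧ f j = f i) ∧
    (∀ v, 1 ≤ v → v ≤ s → ∃ i ∈ I, f i = v) := by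
  classical
  rw [goodMaps, mem_filter, Fintype.mem_piFinset, IsGoodMap,
    ← and_assoc (a := ∀ i ∈ I, 1 ≤ f i ∧ f i ≤ s)]
  refine and_congr_left fun _ => ?_
  constructor
  · intro H
    refine ⟨fun i hi => ?_, fun i hi => ?_⟩
    · have := H i; rw [if_pos hi] at this; exact mem_Icc.1 this
    · have := H i; rw [if_neg hi] at this; exact mem_singleton.1 this
  · rintro ⟨h1, h2⟩ i
    split_ifs with hi
    · exact mem_Icc.2 (h1 i hi)
    · exact mem_singleton.2 (h2 i hi)

theorem card_goodMaps_zero (I : Finset (Fin k)) :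
    #(goodMaps n u 0 I) = if I = ∅ then 1 else 0 := by
  split_ifs with h
  · subst h
    rw [card_eq_one]
    refine ⟨fun _ => 0, ?_⟩
    ext f
    rw [mem_goodMaps, mem_singleton]
    constructor
    · rintro ⟨-, h, -⟩
      exact funext fun i => h i (notMem_empty i)
    · rintro rfl
      refine ⟨by simp, by simp, by simp, by simp, ?_⟩
      intro v hv hv'; omega
  · rw [card_eq_zero, eq_empty_iff_forall_notMem]
    intro f hf
    obtain ⟨i, hi⟩ := nonempty_iff_ne_empty.2 h
    have := (mem_goodMaps.1 hf).1 i hi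
    omega

-- A good map is determined by the set where it is at most `s`, which is down-closed, and its
-- restriction to it. The complement is the last fibre, which has to be nonempty with high maximal
-- elements.
open Classical in
theorem card_goodMaps_succ (s : ℕ) (I : Finset (Fin k)) :
    #(goodMaps n u (s + 1) I) = ∑ D ∈ I.powerset with IsLowerIn u I D,
      if I \ D ≠ ∅ ∧ (∀ i ∈ I \ D, ¬ IsHigh n (u i) →
        ∃ j ∈ I \ D, i < j ∧ ¬ DisjointCycles (u i) (u j)) then #(goodMaps n u s D) else 0 := by
  rw [card_eq_sum_card_fiberwise (f := fun f => I.filter fun i => f i ≤ s)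
    (t := I.powerset.filter fun D => IsLowerIn u I D)]
  · refine sum_congr rfl fun D hD => ?_
    rw [mem_filter, mem_powerset] at hD
    obtain ⟨hDI, hlow⟩ := hD
    have hfib : ∀ f ∈ (goodMaps n u (s + 1) I).filter (fun f => I.filter (fun i => f i ≤ s) = D),
        ∀ i ∈ I, (i ∈ D ↔ f i ≤ s) ∧ (i ∉ D ↔ f i = s + 1) := by
      intro f hf i hi
      rw [mem_filter] at hf
      have h1 := ((mem_goodMaps.1 hf.1).1 i hi).2
      have h2 : i ∈ D ↔ f i ≤ s := by rw [← hf.2, mem_filter]; simp [hi]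
      refine ⟨h2, ?_⟩
      rw [h2]; omega
    split_ifs with hJ
    · refine card_nbij' (fun f i => if i ∈ D then f i else 0)
        (fun g i => if i ∈ I \ D then s + 1 else g i) ?_ ?_ ?_ ?_
      · intro f hf
        have hfD := hfib f hf
        have hf' := mem_goodMaps.1 (mem_filter.1 hf).1
        obtain ⟨h1, h2, h3, h4, h5⟩ := hf'
        rw [mem_coe, mem_goodMaps]
        beta_reduce
        refine ⟨fun i hi => ?_, fun i hi => by simp [hi], fun i hi j hj hij hR => ?_,
          fun i hi hl => ?_, fun v hv hvs => ?_⟩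
        · rw [if_pos hi]
          exact ⟨(h1 i (hDI hi)).1, ((hfD i (hDI hi)).1).1 hi⟩
        · rw [if_pos hi, if_pos hj]
          exact h3 i (hDI hi) j (hDI hj) hij hR
        · obtain ⟨j, hj, hij, hR, he⟩ := h4 i (hDI hi) hl
          have hjD : j ∈ D := (hfD j hj).1.2 (he ▸ (hfD i (hDI hi)).1.1 hi)
          exact ⟨j, hjD, hij, hR, by rw [if_pos hi, if_pos hjD, he]⟩
        · obtain ⟨i, hi, hv'⟩ := h5 v hv (by omega)
          have hiD : i ∈ D := (hfD i hi).1.2 (by omega)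
          exact ⟨i, hiD, by rw [if_pos hiD, hv']⟩
      · intro g hg
        rw [mem_coe, mem_goodMaps] at hg
        obtain ⟨h1, h2, h3, h4, h5⟩ := hg
        have hD : ∀ {i}, i ∈ D → (if i ∈ I \ D then s + 1 else g i) = g i := by
          intro i hi; rw [if_neg]; simp [hi]
        have hJv : ∀ {i}, i ∈ I → i ∉ D → (if i ∈ I \ D then s + 1 else g i) = s + 1 := by
          intro i hi hi'; rw [if_pos]; simp [hi, hi']
        rw [mem_coe, mem_filter, mem_goodMaps]
        beta_reduce
        refine ⟨⟨fun i hi => ?_, fun i hi => ?_, fun i hi j hj hij hR => ?_, fun i hi hl => ?_,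
          fun v hv hvs => ?_⟩, ?_⟩
        · by_cases hiD : i ∈ D
          · rw [hD hiD]; have := h1 i hiD; omega
          · rw [hJv hi hiD]; omega
        · rw [if_neg (by simp [hi])]
          exact h2 i fun h => hi (hDI h)
        · by_cases hjD : j ∈ D
          · have hiD := hlow i hi j hjD hij hR
            rw [hD hiD, hD hjD]; exact h3 i hiD j hjD hij hR
          · rw [hJv hj hjD]
            by_cases hiD : i ∈ D
            · rw [hD hiD]; have := h1 i hiD; omega
            · rw [hJv hi hiD]
        · by_cases hiD : i ∈ D
          · obtain ⟨j, hj, hij, hR, he⟩ := h4 i hiD hl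
            exact ⟨j, hDI hj, hij, hR, by rw [hD hiD, hD hj, he]⟩
          · obtain ⟨j, hj, hij, hR⟩ := hJ.2 i (mem_sdiff.2 ⟨hi, hiD⟩) hl
            rw [mem_sdiff] at hj
            exact ⟨j, hj.1, hij, hR, by rw [hJv hi hiD, hJv hj.1 hj.2]⟩
        · by_cases hv' : v ≤ s
          · obtain ⟨i, hi, he⟩ := h5 v hv hv'
            exact ⟨i, hDI hi, by rw [hD hi, he]⟩
          · obtain ⟨i, hi⟩ := nonempty_iff_ne_empty.2 hJ.1
            rw [mem_sdiff] at hi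
            exact ⟨i, hi.1, by rw [hJv hi.1 hi.2]; omega⟩
        · ext i
          rw [mem_filter]
          constructor
          · rintro ⟨hi, hle⟩
            by_contra hiD
            rw [hJv hi hiD] at hle; omega
          · intro hi
            rw [hD hi]
            exact ⟨hDI hi, (h1 i hi).2⟩
      · intro f hf
        have hfD := hfib f hf
        have h2 := (mem_goodMaps.1 (mem_filter.1 hf).1).2.1
        funext i
        simp only
        by_cases hi : i ∈ I
        · by_cases hiD : i ∈ D
          · simp [hiD]
          · rw [if_pos (mem_sdiff.2 ⟨hi, hiD⟩)]
            exact (((hfD i hi).2).1 hiD).symm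
        · rw [if_neg (by simp [hi]), if_neg fun h => hi (hDI h), h2 i hi]
      · intro g hg
        rw [mem_coe, mem_goodMaps] at hg
        funext i
        simp only
        by_cases hiD : i ∈ D
        · simp [hiD]
        · rw [if_neg hiD, hg.2.1 i hiD]
    · rw [card_eq_zero, eq_empty_iff_forall_notMem]
      intro f hf
      have hfD := hfib f hf
      obtain ⟨h1, h2, h3, h4, h5⟩ := mem_goodMaps.1 (mem_filter.1 hf).1
      refine hJ ⟨?_, fun i hi hl => ?_⟩
      · obtain ⟨i, hi, he⟩ := h5 (s + 1) (by omega) le_rfl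
        exact ne_empty_of_mem (mem_sdiff.2 ⟨hi, (hfD i hi).2.2 he⟩)
      · rw [mem_sdiff] at hi
        obtain ⟨j, hj, hij, hR, he⟩ := h4 i hi.1 hl
        refine ⟨j, mem_sdiff.2 ⟨hj, (hfD j hj).2.2 ?_⟩, hij, hR⟩
        rw [he, (hfD i hi.1).2.1 hi.2]
  · intro f hf
    rw [mem_coe, mem_goodMaps] at hf
    rw [mem_coe, mem_filter, mem_powerset]
    refine ⟨filter_subset _ _, fun i hi j hj hij hR => ?_⟩
    rw [mem_filter] at hj ⊢
    exact ⟨hi, (hf.2.2.1 i hi j hj.1 hij hR).trans hj.2⟩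

open Classical in
/-- The coefficients of the powers of `S - 1`, where `S` is the sum of all balanced tuples without
low cycles at the end. -/
theorem rowCoeff_sub_one_pow (hu : ∀ i, IsCycleWord (u i)) {S : NCSeries (Step m)}
    (hS : ∀ W, rowCoeff S W = if IsBalanced W ∧ NoLowCycle n W then 1 else 0) (s : ℕ) :
    ∀ I : Finset (Fin k), rowCoeff ((S - 1) ^ s) (rowsOn u I) = #(goodMaps n u s I) := by
  -- Subtracting 1 removes exactly the empty tuple, so that every factor of a power is nonempty;
  -- this is the surjectivity of good maps.
  have hS1 : ∀ W, rowCoeff (S - 1) W =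
      if IsBalanced W ∧ NoLowCycle n W ∧ W ≠ (fun _ => []) then 1 else 0 := by
    intro W
    rw [rowCoeff_sub, hS, rowCoeff_one]
    by_cases hW : W = fun _ => []
    · subst hW
      simp [isBalanced_nil, noLowCycle_nil]
    · simp [hW]
  induction s with
  | zero =>
    intro I
    rw [pow_zero, rowCoeff_one, card_goodMaps_zero]
    simp only [rowsOn_eq_nil_iff hu]
    split_ifs <;> simp
  | succ s ih =>
    intro I
    rw [pow_succ, rowCoeff_mul, card_goodMaps_succ,
      sum_splits_rowsOn hu I (fun X Y => rowCoeff ((S - 1) ^ s) X * rowCoeff (S - 1) Y)]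
    · push_cast
      refine sum_congr rfl fun D _ => ?_
      simp only [ih, hS1, noLowCycle_rowsOn_iff hu, ne_eq, rowsOn_eq_nil_iff hu]
      have hb : IsBalanced (rowsOn u (I \ D)) := isBalanced_rowsOf hu _
      simp only [hb, true_and]
      by_cases h1 : I \ D = ∅
      · simp [h1]
      · simp only [h1, not_false_iff, and_true, true_and]
        split_ifs <;> simp
    · intro X Y hXY hne
      have hY : IsBalanced Y := by
        by_contra hY
        rw [hS1] at hne
        simp [hY] at hne
      exact hY.of_cat_right (hXY ▸ isBalanced_rowsOf hu _)

theorem isBalanced_of_rowCoeff_sub_one_pow {S : NCSeries (Step m)}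
    (hS : ∀ W, ¬ IsBalanced W → rowCoeff S W = 0) (s : ℕ) :
    ∀ W, ¬ IsBalanced W → rowCoeff ((S - 1) ^ s) W = 0 := by
  have h1 : ∀ W : Fin m → List (Fin m), ¬ IsBalanced W →
      rowCoeff (1 : NCSeries (Step m)) W = 0 := by
    intro W hW
    rw [rowCoeff_one, if_neg]
    rintro rfl
    exact hW isBalanced_nil
  induction s with
  | zero => simpa using h1
  | succ s ih =>
    intro W hW
    rw [pow_succ, rowCoeff_mul]
    refine sum_eq_zero ?_
    rintro ⟨X, Y⟩ hp
    rw [mem_splits] at hp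
    by_cases hX : IsBalanced X
    · have hY : ¬ IsBalanced Y := fun hY => hW (hp ▸ hX.cat hY)
      rw [rowCoeff_sub, hS _ hY, h1 _ hY, sub_zero, mul_zero]
    · rw [ih _ hX, zero_mul]

end goodMaps

/-! ### Good maps and admissible permutations -/

section sorting

variable {m k : ℕ}

/-- The order generated by the pairs of non-disjoint cycles. -/
def HeapLE (u : Fin k → List (Step m)) : Fin k → Fin k → Prop :=
  Relation.ReflTransGen fun i j => i < j ∧ ¬ DisjointCycles (u i) (u j)

variable {n : ℕ} {u : Fin k → List (Step m)}

theorem HeapLE.le {i j : Fin k} (h : HeapLE u i j) : i ≤ j := by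
  induction h with
  | refl => exact le_rfl
  | tail _ h ih => exact ih.trans h.1.le

theorem HeapLE.map_le {s : ℕ} {f : Fin k → ℕ} (hf : f ∈ goodMaps n u s univ) {i j : Fin k}
    (h : HeapLE u i j) : f i ≤ f j := by
  induction h with
  | refl => exact le_rfl
  | tail _ h ih => exact ih.trans ((mem_goodMaps.1 hf).2.2.1 _ (mem_univ _) _ (mem_univ _) h.1 h.2)

/-- A low cycle has a later non-disjoint one in its fibre; climbing must end at a high cycle. -/
theorem exists_high_above {s : ℕ} {f : Fin k → ℕ} (hf : f ∈ goodMaps n u s univ) (x : Fin k) :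
    ∃ y, IsHigh n (u y) ∧ HeapLE u x y ∧ f y = f x := by
  induction x using WellFoundedGT.induction with
  | _ x ih =>
    by_cases hx : IsHigh n (u x)
    · exact ⟨x, hx, Relation.ReflTransGen.refl, rfl⟩
    · obtain ⟨j, -, hj, hR, he⟩ := (mem_goodMaps.1 hf).2.2.2.1 x (mem_univ _) hx
      obtain ⟨y, h1, h2, h3⟩ := ih j hj
      exact ⟨y, h1, h2.head ⟨hj, hR⟩, h3.trans he⟩

/-- The smallest high element above `x` in its fibre. -/
def topOf (n : ℕ) (u : Fin k → List (Step m)) (f : Fin k → ℕ) (x : Fin k) : Fin k :=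
  open Classical in
  if h : ((univ : Finset (Fin k)).filter fun y =>
    IsHigh n (u y) ∧ HeapLE u x y ∧ f y = f x).Nonempty then Finset.min' _ h else x

theorem topOf_spec {s : ℕ} {f : Fin k → ℕ} (hf : f ∈ goodMaps n u s univ) (x : Fin k) :
    (IsHigh n (u (topOf n u f x)) ∧ HeapLE u x (topOf n u f x) ∧ f (topOf n u f x) = f x) ∧
    ∀ z, IsHigh n (u z) → HeapLE u x z → f z = f x → topOf n u f x ≤ z := by
  classical
  have h : ((univ : Finset (Fin k)).filter fun y =>
      IsHigh n (u y) ∧ HeapLE u x y ∧ f y = f x).Nonempty := by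
    obtain ⟨y, hy⟩ := exists_high_above hf x
    exact ⟨y, mem_filter.2 ⟨mem_univ _, hy⟩⟩
  have e : topOf n u f x = Finset.min' _ h := by
    rw [topOf]; exact dif_pos h
  rw [e]
  refine ⟨(mem_filter.1 (Finset.min'_mem _ h)).2, fun z h1 h2 h3 => Finset.min'_le _ _ ?_⟩
  exact mem_filter.2 ⟨mem_univ _, h1, h2, h3⟩

theorem topOf_eq_self {s : ℕ} {f : Fin k → ℕ} (hf : f ∈ goodMaps n u s univ) {x : Fin k}
    (hx : IsHigh n (u x)) : topOf n u f x = x :=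
  le_antisymm ((topOf_spec hf x).2 x hx Relation.ReflTransGen.refl rfl) (topOf_spec hf x).1.2.1.le

/-- The key by which the cycles are sorted. -/
def sortKey (n : ℕ) (u : Fin k → List (Step m)) (f : Fin k → ℕ) (x : Fin k) :
    ℕ ×ₗ (Fin k ×ₗ Fin k) := toLex (f x, toLex (topOf n u f x, x))

theorem sortKey_lt_iff {f : Fin k → ℕ} {x y : Fin k} :
    sortKey n u f x < sortKey n u f y ↔ f x < f y ∨ f x = f y ∧
      (topOf n u f x < topOf n u f y ∨ topOf n u f x = topOf n u f y ∧ x < y) := by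
  rw [sortKey, sortKey, Prod.Lex.toLex_lt_toLex]
  simp only [Prod.Lex.toLex_lt_toLex]

theorem sortKey_injective (f : Fin k → ℕ) : Function.Injective (sortKey n u f) := by
  intro x y h
  have h1 := congrArg (fun p => (ofLex (ofLex p).2).2) h
  exact h1

/-- The map `f` is increasing along `π`, with jumps only after high cycles and with jumps between
any two high cycles in decreasing order. -/
structure Compatible (n : ℕ) (u : Fin k → List (Step m)) (π : Equiv.Perm (Fin k))
    (f : Fin k → ℕ) : Prop where
  mono : ∀ i j, i ≤ j → f (π i) ≤ f (π j)
  jump : ∀ i j : Fin k, (i : ℕ) + 1 = j → f (π i) ≠ f (π j) → IsHigh n (u (π i))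
  descent : ∀ i j, i < j → IsHigh n (u (π i)) → IsHigh n (u (π j)) → π j < π i →
    f (π i) < f (π j)

/-- Witness: the second element of a chain from `x` to its top. Monotonicity keeps it in the fibre,
and minimality of tops makes its top the same. -/
theorem heapLE_topOf_of_lt {s : ℕ} {f : Fin k → ℕ} (hf : f ∈ goodMaps n u s univ) {x : Fin k}
    (hx : ¬ IsHigh n (u x)) : ∃ z, x < z ∧ ¬ DisjointCycles (u x) (u z) ∧ f z = f x ∧
      topOf n u f z = topOf n u f x := by
  obtain ⟨⟨h1, h2, h3⟩, h4⟩ := topOf_spec hf x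
  rcases Relation.ReflTransGen.cases_head h2 with h | ⟨z, ⟨hxz, hR⟩, hz⟩
  · rw [← h] at h1; exact absurd h1 hx
  · have hxz' : HeapLE u x z := Relation.ReflTransGen.single ⟨hxz, hR⟩
    have hfz : f z = f x := le_antisymm (h3 ▸ HeapLE.map_le hf hz) (hxz'.map_le hf)
    refine ⟨z, hxz, hR, hfz, le_antisymm ?_ ?_⟩
    · exact (topOf_spec hf z).2 _ h1 hz (h3.trans hfz.symm)
    · obtain ⟨⟨g1, g2, g3⟩, -⟩ := topOf_spec hf z
      exact h4 _ g1 (hxz'.trans g2) (g3.trans hfz)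

theorem position_lt_topOf {s : ℕ} {f : Fin k → ℕ} (hf : f ∈ goodMaps n u s univ)
    {π : Equiv.Perm (Fin k)} (hπ : StrictMono fun i => sortKey n u f (π i))
    {i : Fin k} (hi : ¬ IsHigh n (u (π i))) :
    i < π.symm (topOf n u f (π i)) := by
  obtain ⟨⟨h1, h2, h3⟩, -⟩ := topOf_spec hf (π i)
  rw [← hπ.lt_iff_lt]
  simp only [Equiv.apply_symm_apply]
  rw [sortKey_lt_iff]
  refine Or.inr ⟨h3.symm, Or.inr ⟨(topOf_eq_self hf h1).symm, lt_of_le_of_ne h2.le ?_⟩⟩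
  intro h
  rw [← h] at h1
  exact hi h1

/-- The sorting keys in between are squeezed: they agree in value and top, so only the index can
grow. -/
theorem eq_of_between {s : ℕ} {f : Fin k → ℕ} (hf : f ∈ goodMaps n u s univ)
    {π : Equiv.Perm (Fin k)} (hπ : StrictMono fun i => sortKey n u f (π i))
    {i j : Fin k} (hij : i < j) (hj : j ≤ π.symm (topOf n u f (π i))) :
    f (π j) = f (π i) ∧ topOf n u f (π j) = topOf n u f (π i) ∧ π i < π j := by
  obtain ⟨⟨h1, h2, h3⟩, -⟩ := topOf_spec hf (π i)
  have e1 := (sortKey_lt_iff.1 (hπ hij))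
  have e2 : sortKey n u f (π j) ≤ sortKey n u f (topOf n u f (π i)) := by
    have := hπ.monotone hj
    simpa using this
  rcases e2.lt_or_eq with e2 | e2
  · rw [sortKey_lt_iff, topOf_eq_self hf h1, h3] at e2
    rcases e1 with e1 | ⟨e1, e1'⟩ <;> rcases e2 with e2 | ⟨e2, e2'⟩
    · omega
    · omega
    · omega
    · rcases e1' with e1' | ⟨e1', e1''⟩
      · rcases e2' with e2' | ⟨e2', -⟩
        · exact absurd e1' e2'.asymm
        · exact absurd e2' e1'.ne'
      · exact ⟨e1.symm, e1'.symm, e1''⟩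
  · have := sortKey_injective f e2
    refine ⟨by rw [this, h3], by rw [this, topOf_eq_self hf h1], ?_⟩
    rw [this]
    refine lt_of_le_of_ne h2.le fun h => ?_
    rw [← this] at h
    exact hij.ne (π.injective h)

/-- Sorting puts each low cycle into a block of increasing indices that ends with its top.
Inversions of non-disjoint cycles are excluded because both the map and, within a fibre, the top are
monotone in the heap order. -/
theorem admissible_of_strictMono {s : ℕ} {f : Fin k → ℕ} (hf : f ∈ goodMaps n u s univ)
    {π : Equiv.Perm (Fin k)} (hπ : StrictMono fun i => sortKey n u f (π i)) :
    Admissible n u π where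
  inversion := by
    intro i j hij hlt
    by_contra hR
    have hR' : ¬ DisjointCycles (u (π j)) (u (π i)) := fun h => hR h.symm
    have hle : HeapLE u (π j) (π i) := Relation.ReflTransGen.single ⟨hlt, hR'⟩
    have h1 := hle.map_le hf
    obtain ⟨⟨g1, g2, g3⟩, -⟩ := topOf_spec hf (π i)
    rcases sortKey_lt_iff.1 (hπ hij) with e | ⟨e, e'⟩
    · omega
    · have h2 := (topOf_spec hf (π j)).2 _ g1 (hle.trans g2) (g3.trans e)
      rcases e' with e' | ⟨_, e'⟩
      · exact absurd e' h2.not_gt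
      · exact absurd e' hlt.asymm
  exists_high := by
    intro i
    by_cases hi : IsHigh n (u (π i))
    · exact ⟨i, le_rfl, hi⟩
    · refine ⟨_, (position_lt_topOf hf hπ hi).le, ?_⟩
      rw [Equiv.apply_symm_apply]
      exact (topOf_spec hf (π i)).1.1
  linked := by
    intro i j hij hj hlow
    have hi := hlow i le_rfl hij
    have hpos := position_lt_topOf hf hπ hi
    have htop := (topOf_spec hf (π i)).1.1
    have hj' : j ≤ π.symm (topOf n u f (π i)) := by
      by_contra hc
      exact hlow _ hpos.le (not_le.1 hc) (by rw [Equiv.apply_symm_apply]; exact htop)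
    obtain ⟨e1, e2, -⟩ := eq_of_between hf hπ hij hj'
    rw [topOf_eq_self hf hj] at e2
    obtain ⟨z, hz, hR, g1, g2⟩ := heapLE_topOf_of_lt hf hi
    refine ⟨π.symm z, ?_, ?_, by rwa [Equiv.apply_symm_apply]⟩
    · rw [← hπ.lt_iff_lt]
      simp only [Equiv.apply_symm_apply]
      rw [sortKey_lt_iff]
      exact Or.inr ⟨g1.symm, Or.inr ⟨g2.symm, hz⟩⟩
    · rw [← hπ.le_iff_le]
      simp only [Equiv.apply_symm_apply]
      rw [e2]
      rcases eq_or_ne z (topOf n u f (π i)) with h | h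
      · rw [h]
      · refine le_of_lt (sortKey_lt_iff.2 (Or.inr ⟨?_, Or.inr ⟨?_, ?_⟩⟩))
        · rw [g1, (topOf_spec hf (π i)).1.2.2]
        · rw [g2, topOf_eq_self hf htop]
        · refine lt_of_le_of_ne ?_ h
          rw [← g2]
          exact (topOf_spec hf z).1.2.1.le
  descent := by
    intro i j hij hlt
    by_contra hi
    have hpos := position_lt_topOf hf hπ hi
    have hij' : i < j := Fin.lt_def.2 (by omega)
    have hj : j ≤ π.symm (topOf n u f (π i)) := by
      rw [Fin.lt_def] at hpos
      exact Fin.le_def.2 (by omega)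
    exact absurd (eq_of_between hf hπ hij' hj).2.2 hlt.asymm

theorem compatible_of_strictMono {s : ℕ} {f : Fin k → ℕ} (hf : f ∈ goodMaps n u s univ)
    {π : Equiv.Perm (Fin k)} (hπ : StrictMono fun i => sortKey n u f (π i)) :
    Compatible n u π f where
  mono := by
    intro i j hij
    rcases hij.lt_or_eq with h | h
    · rcases sortKey_lt_iff.1 (hπ h) with e | ⟨e, _⟩
      · exact e.le
      · exact e.le
    · rw [h]
  jump := by
    intro i j hij hne
    by_contra hi
    have hpos := position_lt_topOf hf hπ hi
    have hij' : i < j := Fin.lt_def.2 (by omega)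
    have hj : j ≤ π.symm (topOf n u f (π i)) := by
      rw [Fin.lt_def] at hpos
      exact Fin.le_def.2 (by omega)
    exact hne (eq_of_between hf hπ hij' hj).1.symm
  descent := by
    intro i j hij hi hj hlt
    rcases sortKey_lt_iff.1 (hπ hij) with e | ⟨e, e'⟩
    · exact e
    · rw [topOf_eq_self hf hi, topOf_eq_self hf hj] at e'
      rcases e' with e' | ⟨_, e'⟩ <;> exact absurd e' hlt.asymm

theorem Compatible.eq_of_low {π : Equiv.Perm (Fin k)} {f : Fin k → ℕ} (h : Compatible n u π f)
    {i j : Fin k} (hij : i ≤ j) (hlow : ∀ p, i ≤ p → p < j → ¬ IsHigh n (u (π p))) :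
    f (π i) = f (π j) := by
  obtain ⟨i, hi⟩ := i
  obtain ⟨j, hj⟩ := j
  rw [Fin.mk_le_mk] at hij
  induction j, hij using Nat.le_induction with
  | base => rfl
  | succ j hij ih =>
    rw [ih (by omega) fun p h1 h2 => hlow p h1 (by rw [Fin.lt_def] at h2 ⊢; simp at h2 ⊢; omega)]
    by_contra hne
    exact hlow ⟨j, by omega⟩ hij (by rw [Fin.lt_def]; simp) (h.jump _ _ rfl hne)

/-- The first position of a high cycle at or after `i`. -/
theorem Admissible.exists_first_high {π : Equiv.Perm (Fin k)} (h : Admissible n u π) (i : Fin k) :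
    ∃ j, i ≤ j ∧ IsHigh n (u (π j)) ∧ ∀ p, i ≤ p → p < j → ¬ IsHigh n (u (π p)) := by
  classical
  obtain ⟨j, hj, hmin⟩ := ((univ : Finset (Fin k)).filter fun j =>
    i ≤ j ∧ IsHigh n (u (π j))).exists_min_image id (by
      obtain ⟨j, hj⟩ := h.exists_high i
      exact ⟨j, mem_filter.2 ⟨mem_univ _, hj⟩⟩)
  rw [mem_filter] at hj
  refine ⟨j, hj.2.1, hj.2.2, fun p h1 h2 h3 => ?_⟩
  exact absurd (hmin p (mem_filter.2 ⟨mem_univ _, h1, h3⟩)) (not_le.2 h2)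

theorem Admissible.lt_of_linked {π : Equiv.Perm (Fin k)} (h : Admissible n u π) {i p : Fin k}
    (hip : i < p) (hR : ¬ DisjointCycles (u (π i)) (u (π p))) : π i < π p := by
  by_contra hc
  rcases (not_lt.1 hc).lt_or_eq with hlt | heq
  · exact hR (h.inversion i p hip hlt)
  · exact hip.ne' (π.injective heq)

/-- Iterating condition 3 gives a chain of non-disjoint cycles that ends at the first high cycle to
the right. -/
theorem Admissible.heapLE_first_high {π : Equiv.Perm (Fin k)} (h : Admissible n u π) {j : Fin k}
    (hj : IsHigh n (u (π j))) (i : Fin k) (hij : i ≤ j)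
    (hlow : ∀ p, i ≤ p → p < j → ¬ IsHigh n (u (π p))) : HeapLE u (π i) (π j) := by
  induction i using WellFoundedGT.induction with
  | _ i ih =>
    rcases hij.lt_or_eq with hij | rfl
    · obtain ⟨p, hip, hpj, hR⟩ := h.linked i j hij hj hlow
      refine Relation.ReflTransGen.head ⟨h.lt_of_linked hip hR, hR⟩
        (ih p hip hpj fun q hq => hlow q (hip.le.trans hq))
    · exact Relation.ReflTransGen.refl

theorem Admissible.position_le_of_heapLE {π : Equiv.Perm (Fin k)} (h : Admissible n u π)
    {x y : Fin k} (hxy : HeapLE u x y) : π.symm x ≤ π.symm y := by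
  induction hxy with
  | refl => exact le_rfl
  | @tail b c _ hb ih =>
    refine ih.trans (le_of_not_gt fun hc => hb.2 (DisjointCycles.symm ?_))
    have := h.inversion _ _ hc (by simpa using hb.1)
    simpa using this

/-- The permutation can be recovered from the map, because compatibility makes the top of each cycle
the first high cycle at or after its position. -/
theorem strictMono_of_compatible {s : ℕ} {f : Fin k → ℕ} (hf : f ∈ goodMaps n u s univ)
    {π : Equiv.Perm (Fin k)} (hπ : Admissible n u π) (hc : Compatible n u π f) :
    StrictMono fun i => sortKey n u f (π i) := by
  -- Within a fibre the high cycles appear in increasing order, since a drop would force the value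
  -- to increase.
  have key : ∀ i j, i ≤ j → IsHigh n (u (π j)) → f (π i) = f (π j) → ∀ i', i' = i →
      IsHigh n (u (π i')) → π i' ≤ π j := by
    rintro i j hij hj he i' rfl hi
    rcases hij.lt_or_eq with h | h
    · by_contra hlt
      exact absurd he (hc.descent _ _ h hi hj (not_le.1 hlt)).ne
    · rw [h]
  have htop : ∀ i j, i ≤ j → IsHigh n (u (π j)) →
      (∀ p, i ≤ p → p < j → ¬ IsHigh n (u (π p))) → topOf n u f (π i) = π j := by
    intro i j hij hj hlow
    obtain ⟨⟨h1, h2, h3⟩, h4⟩ := topOf_spec hf (π i)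
    have he := hc.eq_of_low hij hlow
    -- The first high cycle lies above in the same fibre, so it bounds the top. The top itself is a
    -- high cycle of that fibre at the same position or further right, so it is not smaller.
    refine le_antisymm (h4 _ hj (hπ.heapLE_first_high hj i hij hlow) he.symm) ?_
    have hpos := hπ.position_le_of_heapLE h2
    rw [Equiv.symm_apply_apply] at hpos
    have hpos' : j ≤ π.symm (topOf n u f (π i)) := by
      by_contra hlt
      exact hlow _ hpos (not_le.1 hlt) (by rwa [Equiv.apply_symm_apply])
    have := key j _ hpos' (by rwa [Equiv.apply_symm_apply])
      (by rw [Equiv.apply_symm_apply, h3, he]) j rfl hj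
    rwa [Equiv.apply_symm_apply] at this
  intro i j hij
  change sortKey n u f (π i) < sortKey n u f (π j)
  rw [sortKey_lt_iff]
  rcases (hc.mono i j hij.le).lt_or_eq with h | h
  · exact Or.inl h
  refine Or.inr ⟨h, ?_⟩
  obtain ⟨a, ha1, ha2, ha3⟩ := hπ.exists_first_high i
  obtain ⟨b, hb1, hb2, hb3⟩ := hπ.exists_first_high j
  rw [htop i a ha1 ha2 ha3, htop j b hb1 hb2 hb3]
  have hab : a ≤ b := by
    by_contra hlt
    exact ha3 b (hij.le.trans hb1) (not_le.1 hlt) hb2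
  rcases hab.lt_or_eq with hab | rfl
  · left
    refine lt_of_le_of_ne (key a b hab.le hb2 ?_ a rfl ha2) fun e => hab.ne (π.injective e)
    rw [← hc.eq_of_low ha1 ha3, ← hc.eq_of_low hb1 hb3, h]
  · right
    -- Both positions belong to the same block. All cycles before the last one are low, and
    -- condition 4 excludes descents after them.
    refine ⟨rfl, ?_⟩
    obtain ⟨i, hi⟩ := i
    obtain ⟨j, hj⟩ := j
    rw [Fin.mk_lt_mk] at hij
    have hlow : ∀ p (hp : p < k), i ≤ p → p < j → ¬ IsHigh n (u (π ⟨p, hp⟩)) := by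
      intro p hp h1 h2
      exact ha3 _ h1 (lt_of_lt_of_le (show (⟨p, hp⟩ : Fin k) < ⟨j, hj⟩ from h2) hb1)
    clear h hb1 hb3
    induction j, hij using Nat.le_induction with
    | base =>
      by_contra hc'
      refine hlow i hi le_rfl (by omega) (hπ.descent ⟨i, hi⟩ ⟨i + 1, hj⟩ rfl ?_)
      refine lt_of_le_of_ne (not_lt.1 hc') fun e => ?_
      have := congrArg Fin.val (π.injective e)
      simp at this
    | succ j hij ih =>
      refine (ih (by omega) fun p hp h1 h2 => hlow p hp h1 (by omega)).trans ?_
      by_contra hc'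
      refine hlow j (by omega) (by omega) (by omega)
        (hπ.descent ⟨j, by omega⟩ ⟨j + 1, hj⟩ rfl ?_)
      refine lt_of_le_of_ne (not_lt.1 hc') fun e => ?_
      have := congrArg Fin.val (π.injective e)
      simp at this

theorem exists_sorting (f : Fin k → ℕ) :
    ∃ π : Equiv.Perm (Fin k), StrictMono fun i => sortKey n u f (π i) :=
  ⟨Tuple.sort (sortKey n u f), (Tuple.monotone_sort _).strictMono_of_injective
    ((sortKey_injective f).comp (Equiv.injective _))⟩

theorem sorting_unique {f : Fin k → ℕ} {π π' : Equiv.Perm (Fin k)}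
    (h : StrictMono fun i => sortKey n u f (π i))
    (h' : StrictMono fun i => sortKey n u f (π' i)) : π = π' := by
  have h0 := (StrictMono.range_inj h h').1 (by
    have e : ∀ σ : Equiv.Perm (Fin k), Set.range (fun i => sortKey n u f (σ i)) =
        Set.range (sortKey n u f) := fun σ =>
      σ.surjective.range_comp (sortKey n u f)
    rw [e, e])
  ext i
  exact congrArg Fin.val (sortKey_injective f (congrFun h0 i))

end sorting

/-! ### Cuts of admissible permutations and the binomial sum -/

section counting

variable {m k n : ℕ} {u : Fin k → List (Step m)}

/-- The positions of high cycles, except for the last position. -/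
def highPos (n : ℕ) (u : Fin k → List (Step m)) (π : Equiv.Perm (Fin k)) : Finset (Fin k) :=
  (univ : Finset (Fin k)).filter fun i => IsHigh n (u (π i)) ∧ (i : ℕ) + 1 < k

/-- The pairs of positions counted by `highDescents`. -/
def IsHighDescent (n : ℕ) (u : Fin k → List (Step m)) (π : Equiv.Perm (Fin k)) (i j : Fin k) :
    Prop :=
  i < j ∧ IsHigh n (u (π i)) ∧ IsHigh n (u (π j)) ∧
    (∀ q, i < q → q < j → ¬ IsHigh n (u (π q))) ∧ π j < π i

open Classical in
/-- The positions of the descents of the subword formed by the high cycles. -/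
def descentPos (n : ℕ) (u : Fin k → List (Step m)) (π : Equiv.Perm (Fin k)) : Finset (Fin k) :=
  (univ : Finset (Fin k)).filter fun i => ∃ j, IsHighDescent n u π i j

theorem card_descentPos (π : Equiv.Perm (Fin k)) :
    #(descentPos n u π) = highDescents n u π := by
  classical
  rw [highDescents, descentPos]
  symm
  refine card_bij (fun p _ => p.1) ?_ ?_ ?_
  · intro p hp
    rw [mem_filter] at hp
    exact mem_filter.2 ⟨mem_univ _, p.2, hp.2⟩
  · rintro ⟨i, j⟩ hp ⟨i', j'⟩ hp' h
    rw [mem_filter] at hp hp'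
    obtain rfl : i = i' := h
    obtain ⟨-, h1, h2, h3, h4, h5⟩ := hp
    obtain ⟨-, g1, g2, g3, g4, g5⟩ := hp'
    congr 1
    refine le_antisymm (le_of_not_gt fun hlt => ?_) (le_of_not_gt fun hlt => ?_)
    · exact h4 _ g1 hlt g3
    · exact g4 _ h1 hlt h3
  · intro i hi
    obtain ⟨-, j, hj⟩ := mem_filter.1 hi
    exact ⟨(i, j), mem_filter.2 ⟨mem_univ _, hj⟩, rfl⟩

theorem descentPos_subset (π : Equiv.Perm (Fin k)) : descentPos n u π ⊆ highPos n u π := by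
  classical
  intro i hi
  obtain ⟨-, j, hj⟩ := mem_filter.1 hi
  refine mem_filter.2 ⟨mem_univ _, hj.2.1, ?_⟩
  have := Fin.lt_def.1 hj.1
  omega

theorem Admissible.isHigh_last {π : Equiv.Perm (Fin k)} (h : Admissible n u π) {i : Fin k}
    (hi : (i : ℕ) + 1 = k) : IsHigh n (u (π i)) := by
  obtain ⟨j, hij, hj⟩ := h.exists_high i
  have : i = j := by
    rw [Fin.le_def] at hij
    exact Fin.ext (by omega)
  rwa [this]

/-- The last position is high by condition 2, and it is the one left out of `highPos`. -/
theorem card_highPos {π : Equiv.Perm (Fin k)} (h : Admissible n u π) (hk : 0 < k) :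
    #(highPos n u π) + 1 = numHigh n u := by
  classical
  let l : Fin k := ⟨k - 1, by omega⟩
  have h1 : numHigh n u = #((univ : Finset (Fin k)).filter fun i => IsHigh n (u (π i))) := by
    rw [numHigh]
    symm
    refine card_bij (fun i _ => π i) ?_ (fun _ _ _ _ h => π.injective h) ?_
    · intro i hi
      exact mem_filter.2 ⟨mem_univ _, (mem_filter.1 hi).2⟩
    · intro j hj
      exact ⟨π.symm j, mem_filter.2 ⟨mem_univ _, by simpa using (mem_filter.1 hj).2⟩, by simp⟩
  have h2 : (univ : Finset (Fin k)).filter (fun i => IsHigh n (u (π i))) =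
      insert l (highPos n u π) := by
    ext i
    simp only [highPos, mem_filter, mem_univ, true_and, mem_insert]
    constructor
    · intro hi
      by_cases hl : (i : ℕ) + 1 < k
      · exact Or.inr ⟨hi, hl⟩
      · left; exact Fin.ext (by simp only [l]; omega)
    · rintro (rfl | hi)
      · exact h.isHigh_last (by simp only [l]; omega)
      · exact hi.1
  rw [h1, h2, card_insert_of_notMem]
  simp only [highPos, mem_filter, mem_univ, true_and, l]
  omega

/-- Split at an intermediate high position: one of the two parts still has a drop. `N` bounds the
distance for the induction. -/
theorem exists_highDescent {π : Equiv.Perm (Fin k)} : ∀ (N : ℕ) (i j : Fin k),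
    (j : ℕ) - i ≤ N → i < j → IsHigh n (u (π i)) → IsHigh n (u (π j)) → π j < π i →
    ∃ p q, i ≤ p ∧ q ≤ j ∧ IsHighDescent n u π p q := by
  intro N
  induction N with
  | zero => intro i j hN hij; rw [Fin.lt_def] at hij; omega
  | succ N ih =>
    intro i j hN hij hi hj hlt
    by_cases hmid : ∃ q, i < q ∧ q < j ∧ IsHigh n (u (π q))
    · obtain ⟨q, hq1, hq2, hq⟩ := hmid
      have hq1' := Fin.lt_def.1 hq1
      have hq2' := Fin.lt_def.1 hq2
      rcases lt_or_ge (π q) (π i) with h | h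
      · obtain ⟨a, b, h1, h2, h3⟩ := ih i q (by omega) hq1 hi hq h
        exact ⟨a, b, h1, h2.trans hq2.le, h3⟩
      · obtain ⟨a, b, h1, h2, h3⟩ := ih q j (by omega) hq2 hq hj (hlt.trans_le h)
        exact ⟨a, b, hq1.le.trans h1, h2, h3⟩
    · push Not at hmid
      exact ⟨i, j, le_rfl, le_rfl, hij, hi, hj, hmid, hlt⟩

/-- The number of cuts before a position. -/
def cutCount (C : Finset (Fin k)) (t : ℕ) : ℕ := #(C.filter fun c : Fin k => (c : ℕ) < t)

theorem cutCount_zero (C : Finset (Fin k)) : cutCount C 0 = 0 := by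
  simp [cutCount]

theorem cutCount_mono (C : Finset (Fin k)) : Monotone (cutCount C) := by
  intro a b hab
  refine card_le_card fun c hc => ?_
  rw [mem_filter] at hc ⊢
  exact ⟨hc.1, hc.2.trans_le hab⟩

theorem cutCount_succ (C : Finset (Fin k)) (t : Fin k) :
    cutCount C (t + 1) = cutCount C t + if t ∈ C then 1 else 0 := by
  classical
  split_ifs with h
  · have : C.filter (fun c : Fin k => (c : ℕ) < t + 1) = insert t (C.filter fun c : Fin k => (c : ℕ) < t) := by
      ext c
      simp only [mem_filter, mem_insert]
      constructor
      · rintro ⟨h1, h2⟩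
        by_cases hc : c = t
        · exact Or.inl hc
        · right; refine ⟨h1, ?_⟩
          have : (c : ℕ) ≠ t := fun e => hc (Fin.ext e)
          omega
      · rintro (rfl | h1)
        · exact ⟨h, by omega⟩
        · exact ⟨h1.1, by omega⟩
    rw [cutCount, this, card_insert_of_notMem (by simp), cutCount]
  · rw [cutCount, cutCount, add_zero]
    congr 1
    refine filter_congr fun c hc => ?_
    have : (c : ℕ) ≠ t := fun e => h (Fin.ext e ▸ hc)
    omega

theorem cutCount_le (C : Finset (Fin k)) (t : ℕ) : cutCount C t ≤ #C :=
  card_le_card (filter_subset _ _)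

theorem cutCount_lt {C : Finset (Fin k)} {t : Fin k} (ht : t ∈ C) {i : ℕ} (hi : (t : ℕ) < i) :
    cutCount C t < cutCount C i := by
  have h1 := cutCount_succ C t
  rw [if_pos ht] at h1
  have h2 := cutCount_mono C (show (t : ℕ) + 1 ≤ i by omega)
  omega

theorem cutCount_eq {C : Finset (Fin k)} {i j : ℕ} (hij : i ≤ j)
    (h : ∀ c ∈ C, i ≤ (c : ℕ) → (c : ℕ) < j → False) : cutCount C i = cutCount C j := by
  rw [cutCount, cutCount]
  congr 1
  refine filter_congr fun c hc => ?_
  have := h c hc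
  constructor
  · intro h; omega
  · intro h1
    by_contra h2
    exact this (by omega) h1

/-- The count grows by at most one per position, and it reaches `#C` at the last position because no
cut is made there. -/
theorem exists_cutCount_eq {C : Finset (Fin k)} (hk : 0 < k) (hC : ∀ c ∈ C, (c : ℕ) + 1 < k)
    {v : ℕ} (hv : v ≤ #C) : ∃ t : Fin k, cutCount C t = v := by
  have hlast : cutCount C (k - 1) = #C := by
    rw [cutCount, filter_true_of_mem]
    intro c hc
    have := hC c hc
    omega
  have hex : ∃ t, v ≤ cutCount C t := ⟨k - 1, by omega⟩
  classical
  have hlt : Nat.find hex < k := by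
    have := Nat.find_min' hex (show v ≤ cutCount C (k - 1) by omega)
    omega
  refine ⟨⟨Nat.find hex, hlt⟩, le_antisymm ?_ (Nat.find_spec hex)⟩
  change cutCount C (Nat.find hex) ≤ v
  rcases h0 : Nat.find hex with _ | t
  · rw [cutCount_zero]; omega
  · have h1 : ¬ v ≤ cutCount C t := Nat.find_min hex (by omega)
    have h2 := cutCount_succ C ⟨t, by omega⟩
    simp only at h2
    split_ifs at h2 <;> omega

/-- The map which takes the value `v` between the `(v-1)`-th and the `v`-th cut. -/
def cutMap (π : Equiv.Perm (Fin k)) (C : Finset (Fin k)) (x : Fin k) : ℕ :=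
  1 + cutCount C (π.symm x)

theorem cutMap_apply (π : Equiv.Perm (Fin k)) (C : Finset (Fin k)) (i : Fin k) :
    cutMap π C (π i) = 1 + cutCount C i := by simp [cutMap]

/-- Heap order agrees with position order, which gives monotonicity. Cuts occur only after high
cycles, so the neighbour supplied by condition 3 has the same value. -/
theorem cutMap_mem_goodMaps {π : Equiv.Perm (Fin k)} (h : Admissible n u π) (hk : 0 < k)
    {C : Finset (Fin k)} (hC : C ⊆ highPos n u π) :
    cutMap π C ∈ goodMaps n u (#C + 1) univ := by
  rw [mem_goodMaps]
  refine ⟨fun x _ => ?_, fun x hx => absurd (mem_univ x) hx, fun x _ y _ hxy hR => ?_,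
    fun x _ hx => ?_, fun v hv hv' => ?_⟩
  · have := cutCount_le C (π.symm x)
    rw [cutMap]; omega
  · have : π.symm x ≤ π.symm y :=
      h.position_le_of_heapLE (Relation.ReflTransGen.single ⟨hxy, hR⟩)
    have := cutCount_mono C (Fin.le_def.1 this)
    rw [cutMap, cutMap]; omega
  · obtain ⟨i, rfl⟩ := π.surjective x
    obtain ⟨j, hij, hj, hlow⟩ := h.exists_first_high i
    have hij' : i < j := lt_of_le_of_ne hij fun e => hx (e ▸ hj)
    obtain ⟨p, hip, hpj, hR⟩ := h.linked i j hij' hj hlow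
    refine ⟨π p, mem_univ _, h.lt_of_linked hip hR, hR, ?_⟩
    rw [cutMap_apply, cutMap_apply]
    congr 1
    refine (cutCount_eq (Fin.le_def.1 hip.le) fun c hc h1 h2 => ?_).symm
    exact hlow c h1 (lt_of_lt_of_le h2 hpj) (mem_filter.1 (hC hc)).2.1
  · obtain ⟨t, ht⟩ := exists_cutCount_eq hk (fun c hc => (mem_filter.1 (hC hc)).2.2)
      (show v - 1 ≤ #C by omega)
    refine ⟨π t, mem_univ _, ?_⟩
    rw [cutMap_apply, ht]; omega

theorem cutMap_compatible {π : Equiv.Perm (Fin k)} {C : Finset (Fin k)}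
    (hC : C ⊆ highPos n u π) (hD : descentPos n u π ⊆ C) :
    Compatible n u π (cutMap π C) where
  mono i j hij := by
    have := cutCount_mono C (Fin.le_def.1 hij)
    rw [cutMap_apply, cutMap_apply]; omega
  jump i j hij hne := by
    by_contra hi
    rw [cutMap_apply, cutMap_apply, ← hij, cutCount_succ, if_neg] at hne
    · exact hne rfl
    · exact fun hc => hi (mem_filter.1 (hC hc)).2.1
  descent i j hij hi hj hlt := by
    classical
    obtain ⟨p, q, h1, h2, h3⟩ := exists_highDescent _ i j le_rfl hij hi hj hlt
    have hp : p ∈ C := hD (mem_filter.2 ⟨mem_univ _, q, h3⟩)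
    have hpj : p < j := h3.1.trans_le h2
    have g1 := cutCount_lt hp (Fin.lt_def.1 hpj)
    have g2 := cutCount_mono C (Fin.le_def.1 h1)
    rw [cutMap_apply, cutMap_apply]; omega

theorem mem_cuts_iff {π : Equiv.Perm (Fin k)} {C : Finset (Fin k)}
    (hC : C ⊆ highPos n u π) (t : Fin k) :
    t ∈ C ↔ ∃ h : (t : ℕ) + 1 < k, cutMap π C (π t) < cutMap π C (π ⟨t + 1, h⟩) := by
  constructor
  · intro ht
    refine ⟨(mem_filter.1 (hC ht)).2.2, ?_⟩
    have := cutCount_lt ht (show (t : ℕ) < t + 1 by omega)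
    rw [cutMap_apply, cutMap_apply]; simp only; omega
  · rintro ⟨h, hlt⟩
    by_contra ht
    rw [cutMap_apply, cutMap_apply] at hlt
    simp only [cutCount_succ, if_neg ht] at hlt
    omega

theorem cutMap_injective {π π' : Equiv.Perm (Fin k)} (h : Admissible n u π)
    (h' : Admissible n u π') (hk : 0 < k) {C C' : Finset (Fin k)}
    (hC : C ⊆ highPos n u π) (hC' : C' ⊆ highPos n u π') (hD : descentPos n u π ⊆ C)
    (hD' : descentPos n u π' ⊆ C') (he : cutMap π C = cutMap π' C') : π = π' ∧ C = C' := by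
  have h1 := strictMono_of_compatible (cutMap_mem_goodMaps h hk hC) h (cutMap_compatible hC hD)
  have h2 := strictMono_of_compatible (cutMap_mem_goodMaps h' hk hC') h'
    (cutMap_compatible hC' hD')
  rw [← he] at h2
  obtain rfl := sorting_unique h1 h2
  refine ⟨rfl, ?_⟩
  ext t
  rw [mem_cuts_iff hC, mem_cuts_iff hC', he]

/-- Take for `π` the sorting permutation and for `C` the positions after which the value jumps. -/
theorem exists_cutMap_eq {s : ℕ} {f : Fin k → ℕ} (hf : f ∈ goodMaps n u s univ) (hk : 0 < k) :
    ∃ (π : Equiv.Perm (Fin k)) (C : Finset (Fin k)), Admissible n u π ∧ C ⊆ highPos n u π ∧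
      descentPos n u π ⊆ C ∧ #C + 1 = s ∧ cutMap π C = f := by
  classical
  obtain ⟨π, hπ⟩ := exists_sorting (n := n) (u := u) f
  have ha := admissible_of_strictMono hf hπ
  have hc := compatible_of_strictMono hf hπ
  obtain ⟨h1, -, -, -, h5⟩ := mem_goodMaps.1 hf
  let C : Finset (Fin k) := univ.filter fun t =>
    ∃ h : (t : ℕ) + 1 < k, f (π t) < f (π ⟨t + 1, h⟩)
  have hCmem : ∀ t, t ∈ C ↔ ∃ h : (t : ℕ) + 1 < k, f (π t) < f (π ⟨t + 1, h⟩) := by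
    intro t; simp [C]
  have hsub : C ⊆ highPos n u π := by
    intro t ht
    obtain ⟨hlt, h⟩ := (hCmem t).1 ht
    exact mem_filter.2 ⟨mem_univ _, hc.jump t ⟨t + 1, hlt⟩ rfl h.ne, hlt⟩
  have hD : descentPos n u π ⊆ C := by
    intro i hi
    obtain ⟨-, j, hij, g1, g2, g3, g4⟩ := mem_filter.1 hi
    have hij' := Fin.lt_def.1 hij
    refine (hCmem i).2 ⟨by omega, ?_⟩
    -- The value is constant from position `i + 1` to the next high position `j`, so the jump forced
    -- by the descent happens directly after `i`.
    have := hc.eq_of_low (i := ⟨i + 1, by omega⟩) (j := j) (Fin.le_def.2 (by simp only; omega))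
      fun p hp1 hp2 => g3 p (Fin.lt_def.2 (by have := Fin.le_def.1 hp1; simp only at this; omega))
        hp2
    rw [this]
    exact hc.descent i j hij g1 g2 g4
  have hval : ∀ t (ht : t < k), f (π ⟨t, ht⟩) = 1 + cutCount C t := by
    intro t
    induction t with
    | zero =>
      intro ht
      rw [cutCount_zero]
      have g1 := h1 (π ⟨0, ht⟩) (mem_univ _)
      obtain ⟨x, -, hx⟩ := h5 1 le_rfl (by omega)
      have g2 := hc.mono ⟨0, ht⟩ (π.symm x) (Fin.le_def.2 (by simp))
      rw [Equiv.apply_symm_apply] at g2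
      omega
    | succ t ih =>
      intro ht
      have e := ih (by omega)
      have g0 := cutCount_succ C ⟨t, by omega⟩
      simp only at g0
      have g1 := hc.mono ⟨t, by omega⟩ ⟨t + 1, ht⟩ (Fin.le_def.2 (by simp))
      rw [g0]
      split_ifs with hmem
      · obtain ⟨_, hlt⟩ := (hCmem _).1 hmem
        simp only at hlt
        have g2 := (h1 (π ⟨t + 1, ht⟩) (mem_univ _)).2
        -- By surjectivity the next value is attained, necessarily at a later position, so the jump
        -- cannot exceed one.
        obtain ⟨x, -, hx⟩ := h5 (f (π ⟨t, by omega⟩) + 1) (by omega) (by omega)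
        have g3 : t + 1 ≤ (π.symm x : ℕ) := by
          by_contra hlt'
          have := hc.mono (π.symm x) ⟨t, by omega⟩ (Fin.le_def.2 (by simp only; omega))
          rw [Equiv.apply_symm_apply] at this
          omega
        have g4 := hc.mono ⟨t + 1, ht⟩ (π.symm x) (Fin.le_def.2 g3)
        rw [Equiv.apply_symm_apply] at g4
        omega
      · have : ¬ f (π ⟨t, by omega⟩) < f (π ⟨t + 1, ht⟩) := fun hlt =>
          hmem ((hCmem _).2 ⟨ht, hlt⟩)
        omega
  refine ⟨π, C, ha, hsub, hD, ?_, ?_⟩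
  · have g1 := hval (k - 1) (by omega)
    have g2 : cutCount C (k - 1) = #C := by
      rw [cutCount, filter_true_of_mem]
      intro c hcm
      have := (mem_filter.1 (hsub hcm)).2.2
      omega
    have g3 := h1 (π ⟨k - 1, by omega⟩) (mem_univ _)
    obtain ⟨x, -, hx⟩ := h5 s (by omega) le_rfl
    have g4 := hc.mono (π.symm x) ⟨k - 1, by omega⟩ (Fin.le_def.2 (by simp only; omega))
    rw [Equiv.apply_symm_apply] at g4
    omega
  · funext x
    have := hval (π.symm x) (Fin.is_lt _)
    simp only [Fin.eta, Equiv.apply_symm_apply] at this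
    rw [cutMap, this]

/-- Vandermonde's identity, with the subsets grouped by size. -/
theorem sum_choose_sub_card {ι : Type} [DecidableEq ι] (X : Finset ι) (β : ℂ) {l : ℕ}
    (hl : #X ≤ l) :
    ∑ E ∈ X.powerset, Ring.choose β (l - #E) = Ring.choose (β + (#X : ℂ)) l := by
  rw [sum_powerset_apply_card (fun j => Ring.choose β (l - j)), Ring.add_choose_eq _ (Commute.all _ _),
    Nat.sum_antidiagonal_eq_sum_range_succ fun i j => Ring.choose β i * Ring.choose (#X : ℂ) j]
  symm
  rw [← sum_range_reflect]
  have h1 : ∀ j ∈ range (l + 1), Ring.choose β (l + 1 - 1 - j) *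
      Ring.choose (#X : ℂ) (l - (l + 1 - 1 - j)) =
      (#X).choose j • Ring.choose β (l - j) := by
    intro j hj
    rw [mem_range] at hj
    rw [show l + 1 - 1 - j = l - j by omega, show l - (l - j) = j by omega, Ring.choose_natCast,
      nsmul_eq_mul, mul_comm]
  rw [sum_congr rfl h1]
  symm
  refine sum_subset (by intro j; simp only [mem_range]; omega) fun j _ hj => ?_
  simp only [mem_range] at hj
  rw [Nat.choose_eq_zero_of_lt (by omega), zero_smul]

-- Here `E` is the set of possible places that are not cut; it avoids the forced cuts, and the map
-- takes l - #E values. As there are l - 1 - d(π) free places, the sum over `E` is the stated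
-- binomial coefficient.
open Classical in
theorem sum_choose_mul_card_goodMaps (hk : 0 < k) {N : ℕ} (hN : k ≤ N) (β : ℂ) :
    ∑ s ∈ range (N + 1), Ring.choose β s * (#(goodMaps n u s univ) : ℂ) =
      ∑ π : Equiv.Perm (Fin k) with Admissible n u π,
        Ring.choose (β + (numHigh n u : ℂ) - 1 - (highDescents n u π : ℂ)) (numHigh n u) := by
  have e1 : ∀ π ∈ (univ : Finset (Equiv.Perm (Fin k))).filter (Admissible n u),
      Ring.choose (β + (numHigh n u : ℂ) - 1 - (highDescents n u π : ℂ)) (numHigh n u) =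
      ∑ E ∈ (highPos n u π \ descentPos n u π).powerset, Ring.choose β (numHigh n u - #E) := by
    intro π hπ
    have hπ := (mem_filter.1 hπ).2
    have h1 := card_highPos hπ hk
    have h2 := card_descentPos (n := n) (u := u) π
    have h3 := card_sdiff_add_card_eq_card (descentPos_subset (n := n) (u := u) π)
    rw [sum_choose_sub_card _ _ (by omega)]
    congr 1
    rw [← h1, ← h3, ← h2]
    push_cast
    ring
  have e2 : ∀ s ∈ range (N + 1), Ring.choose β s * (#(goodMaps n u s univ) : ℂ) =
      ∑ _f ∈ goodMaps n u s univ, Ring.choose β s := by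
    intro s _
    rw [sum_const, nsmul_eq_mul, mul_comm]
  rw [sum_congr rfl e1, sum_congr rfl e2, sum_sigma', sum_sigma']
  symm
  have hsub : ∀ {π : Equiv.Perm (Fin k)} {E : Finset (Fin k)},
      E ⊆ highPos n u π \ descentPos n u π → highPos n u π \ E ⊆ highPos n u π ∧
      descentPos n u π ⊆ highPos n u π \ E ∧ #(highPos n u π \ E) + #E = #(highPos n u π) := by
    intro π E hE
    refine ⟨sdiff_subset, fun i hi => mem_sdiff.2 ⟨descentPos_subset π hi, fun hiE => ?_⟩,
      card_sdiff_add_card_eq_card (hE.trans sdiff_subset)⟩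
    exact (mem_sdiff.1 (hE hiE)).2 hi
  refine sum_bij (fun p _ => ⟨numHigh n u - #p.2, cutMap p.1 (highPos n u p.1 \ p.2)⟩) ?_ ?_ ?_ ?_
  · rintro ⟨π, E⟩ hp
    simp only [mem_sigma, mem_filter, mem_univ, true_and, mem_powerset] at hp
    obtain ⟨h1, h2, h3⟩ := hsub hp.2
    have h4 := card_highPos hp.1 hk
    have h5 : numHigh n u ≤ k := by
      rw [numHigh]; exact (card_le_univ _).trans (by simp)
    have h6 := cutMap_mem_goodMaps hp.1 hk h1
    rw [show #(highPos n u π \ E) + 1 = numHigh n u - #E by omega] at h6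
    simp only [mem_sigma, mem_range]
    exact ⟨by omega, h6⟩
  · rintro ⟨π, E⟩ hp ⟨π', E'⟩ hp' he
    simp only [mem_sigma, mem_filter, mem_univ, true_and, mem_powerset] at hp hp'
    obtain ⟨h1, h2, h3⟩ := hsub hp.2
    obtain ⟨g1, g2, g3⟩ := hsub hp'.2
    simp only [Sigma.mk.injEq, heq_eq_eq] at he
    obtain ⟨rfl, hC⟩ := cutMap_injective hp.1 hp'.1 hk h1 g1 h2 g2 he.2
    have := congrArg (fun A => highPos n u π \ A) hC
    simp only [Finset.sdiff_sdiff_eq_self (hp.2.trans sdiff_subset),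
      Finset.sdiff_sdiff_eq_self (hp'.2.trans sdiff_subset)] at this
    rw [this]
  · rintro ⟨s, f⟩ hf
    rw [mem_sigma] at hf
    obtain ⟨π, C, h1, h2, h3, h4, h5⟩ := exists_cutMap_eq hf.2 hk
    have hC : highPos n u π \ (highPos n u π \ C) = C := Finset.sdiff_sdiff_eq_self h2
    refine ⟨⟨π, highPos n u π \ C⟩, ?_, ?_⟩
    · simp only [mem_sigma, mem_filter, mem_univ, true_and, mem_powerset]
      exact ⟨h1, sdiff_subset_sdiff le_rfl h3⟩
    · have g1 := card_sdiff_add_card_eq_card h2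
      have g2 := card_highPos h1 hk
      simp only [hC, Sigma.mk.injEq, heq_eq_eq]
      refine ⟨?_, h5⟩
      simp only at h4
      omega
  · rintro ⟨π, E⟩ _
    rfl

end counting

/-! ### The main theorem -/

section main

variable {m n : ℕ}

theorem rowsOn_univ_get (us : List (List (Step m))) :
    rowsOn us.get univ = rowWord us.flatten := by
  rw [rowsOn, rowsOf]
  congr 1
  simp only [mem_univ, decide_true, List.filter_true, List.flatMap]
  rw [← List.ofFn_eq_map, List.ofFn_get]

theorem length_le_length_flatten {us : List (List (Step m))} (h : ∀ u ∈ us, u ≠ []) :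
    us.length ≤ us.flatten.length := by
  induction us with
  | nil => simp
  | cons u us ih =>
    rw [List.length_cons, List.flatten_cons, List.length_append]
    have h1 := List.length_pos_iff.2 (h u (by simp))
    have h2 := ih fun v hv => h v (by simp [hv])
    omega

theorem rowCoeff_cpow_eq_cyclesCoeff {S : NCSeries (Step m)}
    (hS : ∀ W, rowCoeff S W = open Classical in if IsBalanced W ∧ NoLowCycle n W then 1 else 0)
    (β : ℂ) {us : List (List (Step m))} (hus : ∀ u ∈ us, IsCycleWord u) :
    rowCoeff (S.cpow β) (rowWord us.flatten) = cyclesCoeff n us β := by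
  classical
  have hu : ∀ i, IsCycleWord (us.get i) := fun i => hus _ (List.get_mem _ _)
  rw [rowCoeff_cpow, ← length_eq_sum_rowWord, ← rowsOn_univ_get]
  simp only [rowCoeff_sub_one_pow hu hS]
  rw [cyclesCoeff]
  -- The empty decomposition is separate because it has no last position; both sides are then 1.
  rcases Nat.eq_zero_or_pos us.length with h0 | hk
  · rw [List.length_eq_zero_iff] at h0
    subst h0
    have ha : ∀ π : Equiv.Perm (Fin 0), Admissible n ([] : List (List (Step m))).get π := fun π =>
      ⟨fun i => i.elim0, fun i => i.elim0, fun i => i.elim0, fun i => i.elim0⟩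
    simp [card_goodMaps_zero, ha, numHigh]
  · exact sum_choose_mul_card_goodMaps hk
      (length_le_length_flatten fun u hu => (hus u hu).ne_nil) β

theorem exists_polynomial_choose (c : ℂ) (l : ℕ) :
    ∃ P : Polynomial ℂ, ∀ β : ℂ, Ring.choose (β + c) l = P.eval β := by
  refine ⟨Polynomial.C ((l.factorial : ℂ)⁻¹) *
    ((descPochhammer ℂ l).comp (Polynomial.X + Polynomial.C c)), fun β => ?_⟩
  rw [Ring.choose_eq_smul, Polynomial.eval_mul, Polynomial.eval_C, Polynomial.eval_comp,
    smul_eq_mul, ← Polynomial.aeval_eq_smeval, Polynomial.aeval_def, Polynomial.eval₂_eq_eval_map,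
    descPochhammer_map]
  simp

theorem exists_polynomial_betaCoeff (n : ℕ) (μ : List (Fin m)) :
    ∃ P : Polynomial ℂ, ∀ β : ℂ, betaCoeff n μ β = P.eval β := by
  classical
  choose P hP using exists_polynomial_choose
  refine ⟨∑ π : Equiv.Perm (Fin (cycleDecomp (oSeq μ)).length) with
    Admissible n (cycleDecomp (oSeq μ)).get π,
      P ((numHigh n (cycleDecomp (oSeq μ)).get : ℂ) - 1 -
        (highDescents n (cycleDecomp (oSeq μ)).get π : ℂ))
        (numHigh n (cycleDecomp (oSeq μ)).get), fun β => ?_⟩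
  rw [Polynomial.eval_finsetSum, betaCoeff, cyclesCoeff]
  refine sum_congr (by congr) fun π _ => ?_
  rw [← hP]
  congr 1
  ring

/-- A balanced tuple comes from a unique `μ`, whose cycle decomposition has the same rows. At other
tuples both sides vanish. -/
theorem rowCoeff_cpow_eq_betaSeries (h : n ≤ m) (β : ℂ) (W : Fin m → List (Fin m)) :
    rowCoeff ((ncDet (1 - matC h)).inv.cpow β) W = rowCoeff (betaSeries m n β) W := by
  by_cases hW : IsBalanced W
  · obtain ⟨μ, rfl⟩ := exists_rowWord_oSeq hW
    obtain ⟨h1, h2⟩ := decomposesTo_cycleDecomp μ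
    rw [rowCoeff_betaSeries_oSeq, betaCoeff, ← rowCoeff_cpow_eq_cyclesCoeff
      (rowCoeff_inv_det_one_sub_matC h) β h1, h2]
  · rw [rowCoeff_betaSeries_of_not_isBalanced n β hW, rowCoeff_cpow]
    refine sum_eq_zero fun s _ => ?_
    rw [isBalanced_of_rowCoeff_sub_one_pow _ s W hW, mul_zero]
    intro W hW
    rw [rowCoeff_inv_det_one_sub_matC, if_neg fun h => hW h.1]

end main

end BetaSylvester

end

theorem theorem12p1 (m n : ℕ) (hn : n < m) :
    (∀ μ : List (Fin m), ∃ P : Polynomial ℂ, ∀ β : ℂ,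
      BetaSylvester.betaCoeff n μ β = P.eval β) ∧
    ∀ β : ℂ, BetaSylvester.CFEq
      ((BetaSylvester.ncDet (1 - BetaSylvester.matC hn.le)).inv.cpow β)
      (BetaSylvester.betaSeries m n β) :=
  ⟨BetaSylvester.exists_polynomial_betaCoeff n, fun β =>
    BetaSylvester.CFEq_of_rowCoeff_eq (BetaSylvester.rowCoeff_cpow_eq_betaSeries hn.le β)⟩
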